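/- All functions are real valued, $\partial^j=\partial_x^{j_1}\partial_y^{j_2}$ and $|j|=j_1+j_2$ for $j=(j_1,j_2)$, and derivatives in $(x,y)$ are distributional. For integers $a,b\ge 0$ let $H^{(a,b)}(\mathbb R^2)=\{u:\ u,\ \partial_x^{a}u,\ \partial_y^{b}u\in L^2(\mathbb R^2)\}$. For an integer $N\ge 0$ and $T\ge 0$ let $$Z^N_T=\{u:\ u\in L^\infty([0,T];H^{(N+3,N+2)}(\mathbb R^2)),\ u_t\in L^\infty([0,T];H^N(\mathbb R^2))\},$$ where $u$ is identified with its representative that is continuous in time with values in $L^2(\mathbb R^2)$, and put $$\|u\|_{Z^N_T}^2=\sup_{s\in[0,T]}\Big(\|u(s)\|^2_{H^{(N+3,N+2)}}+\int_{\mathbb R^2}\sum_{|j|\in\{0,N\}}(\partial^j u_t(s))^2\,dx\,dy\Big),$$ $$\|f\|_{H^{(N+3,N+2)}}^2=\int_{\mathbb R^2}\Big(f^2+\sum_{|j|=N}\big[(\partial^j f_{xxx})^2+(\partial^j f_{yy})^2\big]\Big)dx\,dy,\qquad \|f\|_{H^N}^2=\sum_{|j|\le N}\int_{\mathbb R^2}(\partial^j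 f)^2\,dx\,dy .$$ The operator $\partial_x^{-1}$ is defined by $\widehat{\partial_x^{-1}f}(\xi,\eta)=\frac1{i\xi}\widehat f(\xi,\eta)$ for $f\in L^2$ with $\frac1\xi\widehat f\in L^2$. **Lemma 3.2.** For every integer $N\ge 0$ there is a constant $c>0$, depending only on $N$, such that the following holds. Let $v,w$ belong to $Z^M_T$ for all integers $M\ge 0$ and all $T\ge 0$, and suppose that at every time $t\ge 0$ (the value $v_t(\cdot,\cdot,t)$ being the one given by the equation) $$v_t+v_{xxx}+v_x+w\,v_x-\partial_x^{-1}v_{yy}=0 ,\qquad \partial_x^{-1}v_{yy}\in L^2(\mathbb R^2).$$ Then for all $t\ge 0$ $$\|v\|_{Z^N_t}^2\le \|v(\cdot,\cdot,0)\|_{H^{(N+3,N+2)}(\mathbb R^2)}^2+\|v_t(\cdot,\cdot,0)\|_{H^N(\mathbb R^2)}^2+c\,t\,\|w\|_{Z^N_t}\,\|v\|_{Z^N_t}^2 .$$ -/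

import Mathlib

open MeasureTheory Set
open scoped ENNReal SchwartzMap LineDeriv FourierTransform

noncomputable section

namespace KP

/-- The plane `ℝ²` with coordinates `(x, y) = (p 0, p 1)`; frequencies are `(ξ, η) = (p 0, p 1)`. -/
abbrev Plane : Type := EuclideanSpace ℝ (Fin 2)

/-- Real-valued square integrable functions on the plane. -/
abbrev L2 : Type := Lp ℝ 2 (volume : Measure Plane)

/-- A real square integrable function, seen as a complex-valued one. -/
def toComplex (f : L2) : Lp ℂ 2 (volume : Measure Plane) := Complex.ofRealCLM.compLp f

/-- A real square integrable function, seen as a tempered distribution. -/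
def toDist (f : L2) : 𝓢'(Plane, ℂ) := Lp.toTemperedDistribution (toComplex f)

/-- The distributional derivative `∂_x^a ∂_y^b`. -/
def distDeriv (a b : ℕ) (u : 𝓢'(Plane, ℂ)) : 𝓢'(Plane, ℂ) :=
  (fun T : 𝓢'(Plane, ℂ) => ∂_{(EuclideanSpace.single 0 1 : Plane)} T)^[a]
    ((fun T : 𝓢'(Plane, ℂ) => ∂_{(EuclideanSpace.single 1 1 : Plane)} T)^[b] u)

/-- `g ∈ L²` is the distributional (weak) derivative `∂_x^a ∂_y^b f` of `f ∈ L²`. -/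
def HasDerivL2 (a b : ℕ) (f g : L2) : Prop :=
  distDeriv a b (toDist f) = toDist g

/-- `∫ (∂_x^a ∂_y^b f)²`, with value `∞` if `∂_x^a ∂_y^b f` is not square integrable. (There is at
most one `g` as below, so the infimum is over a set with at most one element.) -/
def derivSq (a b : ℕ) (f : L2) : ℝ≥0∞ :=
  ⨅ (g : L2) (_ : HasDerivL2 a b f g), ‖g‖ₑ ^ 2

/-- `g = ∂_x⁻¹ f`, that is `ĝ = f̂ / (i ξ)` with `g ∈ L²`. Mathlib's Fourier transform has the kernel
`exp (-2 π i ⟨x, ξ⟩)`, for which the symbol of `∂_x` is `2 π i ξ`. -/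
def IsInvDx (f g : L2) : Prop :=
  ∀ᵐ p : Plane, 𝓕 (toComplex g) p = 𝓕 (toComplex f) p / (2 * Real.pi * Complex.I * (p 0 : ℂ))

/-- The square of the graph norm of `H^{(a,b)} = {u : u, ∂_x^a u, ∂_y^b u ∈ L²}`; it is finite
exactly on that space. -/
def anisoSq (a b : ℕ) (f : L2) : ℝ≥0∞ :=
  ‖f‖ₑ ^ 2 + derivSq a 0 f + derivSq 0 b f

/-- The square of the usual norm of the Sobolev space `H^N(ℝ²)`: the sum over `|j| ≤ N` of
`∫ (∂^j f)²`. -/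
def sobolevSq (N : ℕ) (f : L2) : ℝ≥0∞ :=
  ∑ n ∈ Finset.range (N + 1), ∑ j ∈ Finset.HasAntidiagonal.antidiagonal n, derivSq j.1 j.2 f

/-- The spatial part `∫ (f² + ∑_{|j| = N} [(∂^j f_xxx)² + (∂^j f_yy)²])` of the norm of `Z^N_T`, which
is the square of the norm used for `H^{(N+3,N+2)}`. -/
def spaceSq (N : ℕ) (f : L2) : ℝ≥0∞ :=
  ‖f‖ₑ ^ 2 + ∑ j ∈ Finset.HasAntidiagonal.antidiagonal N, (derivSq (j.1 + 3) j.2 f + derivSq j.1 (j.2 + 2) f)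

/-- The part `∫ (f² + ∑_{|j| = N} (∂^j f)²)` of the norm of `Z^N_T` in which `f = u_t`: the sum over
the multi-indices of order `0` or `N`, each taken once (so it is `∫ f²` for `N = 0`). -/
def timeSq (N : ℕ) (f : L2) : ℝ≥0∞ :=
  ∑ j ∈ insert (0, 0) (Finset.HasAntidiagonal.antidiagonal N), derivSq j.1 j.2 f

/-- `ut` is the time derivative of `u` on `[0, T]`: `u` is the continuous representative and
`ut` is its (almost everywhere, equivalently weak) derivative as an `L²`-valued function of time. -/
def IsTimeDeriv (T : ℝ) (u ut : ℝ → L2) : Prop :=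
  IntervalIntegrable ut volume 0 T ∧ ∀ t ∈ Icc 0 T, u t = u 0 + ∫ s in (0 : ℝ)..t, ut s

/-- `u`, with time derivative `ut`, belongs to
`Z^N_T = {u : u ∈ L^∞([0,T]; H^{(N+3,N+2)}), u_t ∈ L^∞([0,T]; H^N)}`. -/
def MemZ (N : ℕ) (T : ℝ) (u ut : ℝ → L2) : Prop :=
  IsTimeDeriv T u ut ∧
    (⨆ s ∈ Icc 0 T, anisoSq (N + 3) (N + 2) (u s)) < ∞ ∧
    (⨆ s ∈ Icc 0 T, sobolevSq N (ut s)) < ∞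

/-- The square of the norm of `Z^N_T`. -/
def zSq (N : ℕ) (T : ℝ) (u ut : ℝ → L2) : ℝ≥0∞ :=
  ⨆ s ∈ Icc 0 T, (spaceSq N (u s) + timeSq N (ut s))

/-- The norm of `Z^N_T`. -/
def zNorm (N : ℕ) (T : ℝ) (u ut : ℝ → L2) : ℝ≥0∞ :=
  zSq N T u ut ^ (1 / 2 : ℝ)

/-- The equation `v_t + v_xxx + v_x + w v_x - ∂_x⁻¹ v_yy = 0` at one instant; all the terms other than
`w v_x` are required to be in `L²`, and the equation holds almost everywhere in the plane. -/
def LinearizedKP (v vt w : L2) : Prop :=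
  ∃ vx vxxx vyy q : L2, HasDerivL2 1 0 v vx ∧ HasDerivL2 3 0 v vxxx ∧ HasDerivL2 0 2 v vyy ∧
    IsInvDx vyy q ∧ ∀ᵐ p : Plane, vt p + vxxx p + vx p + w p * vx p - q p = 0

end KP

end

/-! On the Fourier side, with $(X,Y)=2\pi(\xi,\eta)$, the equation reads $\hat v_t=i\varphi\hat
v-\hat w*\widehat{v_x}$, where the dispersion $\varphi=X^3-X+Y^2/X$ is real, and all the norms are
$L^2$ norms weighted by monomials $\sigma$ in $X,Y$. In the time derivative of $\|\sigma\hat v\|^2$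
the dispersive part is purely imaginary and drops out; what remains is
$-2\,\mathrm{Re}\int\sigma^2\,\overline{\hat v}\,(\hat w*\widehat{v_x})$. It suffices to bound such
trilinear forms by $\|w\|\,\|v\|^2$; integration in time then produces the factor $t$.

The transport term loses one $x$-derivative. With $p$ the frequency of the product, $q$ that of $v$
and $p-q$ that of $w$, write $\sigma(p)^2=\sigma(p)\sigma(q)+\sigma(p)(\sigma(p)-\sigma(q))$. In the
first piece, exchanging $p$ and $q$ and using that $w$ is real moves the derivative onto $w$
(`enorm_re_integral_symm_le`). In the second, the difference of weights gains a power of $p-q$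
(`commutator_x_le`, `commutator_y_le`, `commutator_time_le`). For the spatial norm this leaves the
isotropic weight `wR` to the power $N+1$ on one factor and the full weight `wS` on the other. The
first factor is put in $L^1$, and Cauchy–Schwarz returns it to the `wS`-weighted $L^2$ norm because
`wR`$^{N+1}/$`wS` is square integrable (`weight_sq_le`, `exists_lintegral_eR_le`); behind this is
the integrability of $1/(1+|x|^3+y^2)$, that is, $\frac13+\frac12<1$.

For $v_t$ the forcing is the time derivative $w_tv_x+wv_{tx}$. The second term has the same
commutator structure (`exists_time_estimate`), while the first is bounded directly
(`exists_time_coeff_estimate`).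

Membership in every $Z^M_T$ gives decay of the transforms faster than any power, uniformly on
$[0,T]$ (`UnifRapid`), which justifies every use of Fubini. Two obstacles remain: $\varphi$ is
unbounded, even near $X=0$, and $v_t$ is not assumed differentiable in time. Both are met by
restricting to the frequencies where $\sigma$ and $\varphi$ are bounded: there the equation itself
exhibits $\sigma\hat v_t$ as a primitive. The restriction is removed in `energy_estimate` before the
trilinear bounds are applied, since these hold only for the full weights. -/

open Filter
open scoped Topology Convolution

namespace KP

/-! ### Banach-valued primitives in time and their Leibniz rule -/

section Primitive

variable {E F G : Type*} [NormedAddCommGroup E] [NormedSpace ℝ E]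
  [NormedAddCommGroup F] [NormedSpace ℝ F]
  [NormedAddCommGroup G] [NormedSpace ℝ G]

/-- `u` is a primitive of the integrable function `u'` on `[0, T]`. -/
def IsPrimitive (T : ℝ) (u u' : ℝ → E) : Prop :=
  IntervalIntegrable u' volume 0 T ∧ ∀ t ∈ Icc 0 T, u t = u 0 + ∫ s in (0 : ℝ)..t, u' s

theorem IsPrimitive.intervalIntegrable {T : ℝ} {u u' : ℝ → E} (h : IsPrimitive T u u') {t : ℝ}
    (ht : t ∈ Icc 0 T) : IntervalIntegrable u' volume 0 t := by
  refine h.1.mono_set ?_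
  rw [uIcc_of_le ht.1, uIcc_of_le (ht.1.trans ht.2)]
  exact Icc_subset_Icc_right ht.2

theorem IsPrimitive.continuousOn {T : ℝ} {u u' : ℝ → E} (h : IsPrimitive T u u') :
    ContinuousOn u (Icc 0 T) := by
  rcases le_or_gt 0 T with hT | hT
  · have h1 : ContinuousOn (fun t => ∫ s in (0 : ℝ)..t, u' s) (Icc 0 T) := by
      rw [← uIcc_of_le hT]
      refine intervalIntegral.continuousOn_primitive_interval ?_
      rw [uIcc_of_le hT, integrableOn_Icc_iff_integrableOn_Ioc]
      exact (intervalIntegrable_iff_integrableOn_Ioc_of_le hT).1 h.1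
    exact (continuousOn_const.add h1).congr h.2
  · simp [hT]

theorem IsPrimitive.congr {T : ℝ} {u u' w w' : ℝ → E} (h : IsPrimitive T u u')
    (hT : 0 ≤ T) (h1 : ∀ t ∈ Icc 0 T, u t = w t) (h2 : ∀ t ∈ Icc 0 T, u' t = w' t) :
    IsPrimitive T w w' := by
  refine ⟨h.1.congr ?_, fun t ht => ?_⟩
  · intro s hs
    rw [uIoc_of_le hT] at hs
    exact h2 s (Ioc_subset_Icc_self hs)
  · rw [← h1 t ht, ← h1 0 ⟨le_rfl, hT⟩, h.2 t ht]
    congr 1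
    refine intervalIntegral.integral_congr fun s hs => ?_
    rw [uIcc_of_le ht.1] at hs
    exact h2 s ⟨hs.1, hs.2.trans ht.2⟩

theorem IsPrimitive.mono {T t : ℝ} {u u' : ℝ → E} (h : IsPrimitive T u u') (ht : t ∈ Icc 0 T) :
    IsPrimitive t u u' :=
  ⟨h.intervalIntegrable ht, fun s hs => h.2 s ⟨hs.1, hs.2.trans ht.2⟩⟩

theorem IsPrimitive.clm_comp [CompleteSpace E] [CompleteSpace F] {T : ℝ} {u u' : ℝ → E}
    (h : IsPrimitive T u u') (L : E →L[ℝ] F) :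
    IsPrimitive T (fun t => L (u t)) (fun t => L (u' t)) := by
  refine ⟨⟨L.integrable_comp h.1.1, L.integrable_comp h.1.2⟩, fun t ht => ?_⟩
  beta_reduce
  rw [h.2 t ht, map_add, L.intervalIntegral_comp_comm (h.intervalIntegrable ht)]

theorem IsPrimitive.sub {T : ℝ} {u u' w w' : ℝ → E} (h : IsPrimitive T u u')
    (h' : IsPrimitive T w w') :
    IsPrimitive T (fun t => u t - w t) (fun t => u' t - w' t) := by
  refine ⟨h.1.sub h'.1, fun t ht => ?_⟩
  beta_reduce
  rw [h.2 t ht, h'.2 t ht, intervalIntegral.integral_sub (h.intervalIntegrable ht)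
    (h'.intervalIntegrable ht)]
  abel

theorem integrable_bilin_prod (L : E →L[ℝ] F →L[ℝ] G) {μ : Measure ℝ} [SFinite μ] {f : ℝ → E}
    {g : ℝ → F} (hf : Integrable f μ) (hg : Integrable g μ) :
    Integrable (fun z : ℝ × ℝ => L (f z.1) (g z.2)) (μ.prod μ) := by
  have h1 : Integrable (fun z : ℝ × ℝ => ‖L‖ * (‖f z.1‖ * ‖g z.2‖)) (μ.prod μ) :=
    (hf.norm.mul_prod hg.norm).const_mul _
  refine h1.mono' ?_ ?_
  · exact L.aestronglyMeasurable_comp₂ hf.1.comp_fst hg.1.comp_snd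
  · refine Filter.Eventually.of_forall fun z => ?_
    rw [← mul_assoc]
    exact L.le_opNorm₂ _ _

theorem integrable_bilin_of_continuousOn (L : E →L[ℝ] F →L[ℝ] G) {T : ℝ} {u : ℝ → E} {g : ℝ → F}
    (hu : ContinuousOn u (Icc 0 T)) (hg : Integrable g (volume.restrict (Ioc 0 T))) :
    Integrable (fun s => L (u s) (g s)) (volume.restrict (Ioc 0 T)) := by
  obtain ⟨C, hC⟩ := isCompact_Icc.exists_bound_of_continuousOn hu
  refine (hg.norm.const_mul (‖L‖ * C)).mono' ?_ ?_
  · exact L.aestronglyMeasurable_comp₂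
      ((hu.mono Ioc_subset_Icc_self).aestronglyMeasurable measurableSet_Ioc) hg.1
  · filter_upwards [ae_restrict_mem measurableSet_Ioc] with s hs
    refine (L.le_opNorm₂ _ _).trans ?_
    gcongr
    exact hC s (Ioc_subset_Icc_self hs)

theorem setIntegral_Ioc_eq_integral_indicator {t s : ℝ} (hs : s ∈ Ioc 0 t) (f : ℝ → G) :
    ∫ r in Ioc 0 s, f r = ∫ r in Ioc 0 t, (Iic s).indicator f r := by
  rw [integral_indicator measurableSet_Iic, Measure.restrict_restrict measurableSet_Iic]
  congr 2
  ext r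
  simp only [mem_inter_iff, mem_Iic, mem_Ioc]
  constructor
  · rintro ⟨h1, h2⟩; exact ⟨h2, h1, h2.trans hs.2⟩
  · rintro ⟨h1, h2, _⟩; exact ⟨h2, h1⟩

/-- Fubini on the square $(0,t]^2$: the two terms are the integrals of $L(f(s),g(r))$ over the two
sides of the diagonal, and together they make up the product of the integrals. -/
theorem integral_bilin_primitive [CompleteSpace E] [CompleteSpace F] [CompleteSpace G]
    (L : E →L[ℝ] F →L[ℝ] G) {t : ℝ} {f : ℝ → E} {g : ℝ → F}
    (hf : Integrable f (volume.restrict (Ioc 0 t)))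
    (hg : Integrable g (volume.restrict (Ioc 0 t))) :
    (∫ s in Ioc 0 t, L (f s) (∫ r in Ioc 0 s, g r)) +
      ∫ s in Ioc 0 t, L (∫ r in Ioc 0 s, f r) (g s) =
    L (∫ s in Ioc 0 t, f s) (∫ s in Ioc 0 t, g s) := by
  set μ := (volume : Measure ℝ).restrict (Ioc 0 t) with hμ
  have hP := integrable_bilin_prod L hf hg
  set D : Set (ℝ × ℝ) := {z | z.2 ≤ z.1} with hD
  have hDm : MeasurableSet D := measurableSet_le measurable_snd measurable_fst
  have e1 : ∫ s in Ioc 0 t, L (f s) (∫ r in Ioc 0 s, g r) =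
      ∫ z, D.indicator (fun z : ℝ × ℝ => L (f z.1) (g z.2)) z ∂(μ.prod μ) := by
    rw [integral_prod _ (hP.indicator hDm)]
    refine setIntegral_congr_fun measurableSet_Ioc fun s hs => ?_
    rw [setIntegral_Ioc_eq_integral_indicator hs, ← (L (f s)).integral_comp_comm
      (hg.indicator measurableSet_Iic)]
    refine integral_congr_ae (Filter.Eventually.of_forall fun r => ?_)
    by_cases h : r ≤ s <;> simp [indicator, h, hD]
  have e2 : ∫ s in Ioc 0 t, L (∫ r in Ioc 0 s, f r) (g s) =
      ∫ z, (Dᶜ).indicator (fun z : ℝ × ℝ => L (f z.1) (g z.2)) z ∂(μ.prod μ) := by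
    rw [integral_prod_symm _ (hP.indicator hDm.compl)]
    refine setIntegral_congr_fun measurableSet_Ioc fun s hs => ?_
    rw [setIntegral_Ioc_eq_integral_indicator hs]
    have := (L.flip (g s)).integral_comp_comm (hf.indicator (measurableSet_Iic (a := s)))
    rw [ContinuousLinearMap.flip_apply] at this
    rw [← this]
    -- The inner integral runs over $r\le s$ but the complement of `D` is the strict region $r<s$;
    -- they differ by one point.
    have hne : ∀ᵐ r ∂μ, r ≠ s := by
      rw [hμ]
      exact ae_restrict_of_ae (by simp [ae_iff])
    refine integral_congr_ae ?_
    filter_upwards [hne] with r hr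
    rcases lt_or_gt_of_ne hr with h | h
    · simp [indicator, h.le, hD, h]
    · simp [indicator, h.le, hD, not_le.2 h]
  rw [e1, e2, ← integral_add (hP.indicator hDm) (hP.indicator hDm.compl)]
  have : ∀ z, D.indicator (fun z : ℝ × ℝ => L (f z.1) (g z.2)) z +
      Dᶜ.indicator (fun z : ℝ × ℝ => L (f z.1) (g z.2)) z = L (f z.1) (g z.2) := fun z => by
    rw [← Pi.add_apply, indicator_self_add_compl]
  simp only [this]
  rw [integral_prod _ hP]
  have h3 : ∀ s, ∫ r, L (f s) (g r) ∂μ = L (f s) (∫ r, g r ∂μ) := fun s =>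
    (L (f s)).integral_comp_comm hg
  simp only [h3]
  exact (L.flip (∫ r, g r ∂μ)).integral_comp_comm hf

/-- Integration by parts without pointwise derivatives: after substituting initial value plus
integral for $u$ and $w$, the double integrals combine by `integral_bilin_primitive`. -/
theorem IsPrimitive.bilin [CompleteSpace E] [CompleteSpace F] [CompleteSpace G]
    (L : E →L[ℝ] F →L[ℝ] G) {T : ℝ} (hT : 0 ≤ T) {u u' : ℝ → E} {w w' : ℝ → F}
    (hu : IsPrimitive T u u') (hw : IsPrimitive T w w') :
    IsPrimitive T (fun t => L (u t) (w t)) (fun t => L (u' t) (w t) + L (u t) (w' t)) := by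
  have key : ∀ t ∈ Icc 0 T, Integrable (fun s => L (u' s) (w s)) (volume.restrict (Ioc 0 t)) ∧
      Integrable (fun s => L (u s) (w' s)) (volume.restrict (Ioc 0 t)) := fun t ht => by
    have h1 := (intervalIntegrable_iff_integrableOn_Ioc_of_le ht.1).1 (hu.intervalIntegrable ht)
    have h2 := (intervalIntegrable_iff_integrableOn_Ioc_of_le ht.1).1 (hw.intervalIntegrable ht)
    exact ⟨integrable_bilin_of_continuousOn L.flip (hw.mono ht).continuousOn h1,
      integrable_bilin_of_continuousOn L (hu.mono ht).continuousOn h2⟩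
  refine ⟨?_, fun t ht => ?_⟩
  · rw [intervalIntegrable_iff_integrableOn_Ioc_of_le hT]
    exact (key T ⟨hT, le_rfl⟩).1.add (key T ⟨hT, le_rfl⟩).2
  · have h1 := (intervalIntegrable_iff_integrableOn_Ioc_of_le ht.1).1 (hu.intervalIntegrable ht)
    have h2 := (intervalIntegrable_iff_integrableOn_Ioc_of_le ht.1).1 (hw.intervalIntegrable ht)
    rw [intervalIntegral.integral_of_le ht.1, integral_add (key t ht).1 (key t ht).2]
    have c1 : ContinuousOn (fun s => ∫ r in Ioc 0 s, w' r) (Icc 0 t) := by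
      refine ((hw.mono ht).continuousOn.sub (continuousOn_const (c := w 0))).congr fun s hs => ?_
      simp only [Pi.sub_apply]
      rw [(hw.mono ht).2 s hs, intervalIntegral.integral_of_le hs.1]; abel
    have c2 : ContinuousOn (fun s => ∫ r in Ioc 0 s, u' r) (Icc 0 t) := by
      refine ((hu.mono ht).continuousOn.sub (continuousOn_const (c := u 0))).congr fun s hs => ?_
      simp only [Pi.sub_apply]
      rw [(hu.mono ht).2 s hs, intervalIntegral.integral_of_le hs.1]; abel
    have i1 : ∫ s in Ioc 0 t, L (u' s) (w s) = L (∫ s in Ioc 0 t, u' s) (w 0) +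
        ∫ s in Ioc 0 t, L (u' s) (∫ r in Ioc 0 s, w' r) := by
      have i3 := integral_add ((L.flip (w 0)).integrable_comp h1)
        (integrable_bilin_of_continuousOn L.flip c1 h1)
      simp only [ContinuousLinearMap.flip_apply] at i3
      rw [← L.flip_apply, ← (L.flip (w 0)).integral_comp_comm h1]
      simp only [ContinuousLinearMap.flip_apply]
      rw [← i3]
      refine setIntegral_congr_fun measurableSet_Ioc fun s hs => ?_
      rw [← map_add, hw.2 s ⟨hs.1.le, hs.2.trans ht.2⟩, intervalIntegral.integral_of_le hs.1.le]
    have i2 : ∫ s in Ioc 0 t, L (u s) (w' s) = L (u 0) (∫ s in Ioc 0 t, w' s) +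
        ∫ s in Ioc 0 t, L (∫ r in Ioc 0 s, u' r) (w' s) := by
      rw [← (L (u 0)).integral_comp_comm h2, ← integral_add
        ((L (u 0)).integrable_comp h2) (integrable_bilin_of_continuousOn L c2 h2)]
      refine setIntegral_congr_fun measurableSet_Ioc fun s hs => ?_
      rw [← add_apply, ← map_add, hu.2 s ⟨hs.1.le, hs.2.trans ht.2⟩,
        intervalIntegral.integral_of_le hs.1.le]
    have := integral_bilin_primitive L h1 h2
    beta_reduce
    rw [i1, i2, hu.2 t ht, hw.2 t ht, intervalIntegral.integral_of_le ht.1,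
      intervalIntegral.integral_of_le ht.1]
    simp only [map_add, add_apply]
    rw [← this]
    abel

end Primitive

/-! ### Multiplication operators on $L^2$ and frequency truncation -/

/-- Complex-valued square integrable functions on the plane. -/
abbrev CL2 : Type := Lp ℂ 2 (volume : Measure Plane)

theorem enorm_sq_eq_lintegral {E : Type*} [NormedAddCommGroup E]
    (f : Lp E 2 (volume : Measure Plane)) : ‖f‖ₑ ^ 2 = ∫⁻ p, ‖f p‖ₑ ^ 2 := by
  rw [Lp.enorm_def, eLpNorm_eq_lintegral_rpow_enorm_toReal (by norm_num) (by norm_num),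
    ← ENNReal.rpow_natCast, ← ENNReal.rpow_mul]
  norm_num

theorem lintegral_enorm_sq_ne_top {E : Type*} [NormedAddCommGroup E]
    (f : Lp E 2 (volume : Measure Plane)) : ∫⁻ p, ‖f p‖ₑ ^ 2 ≠ ∞ := by
  rw [← enorm_sq_eq_lintegral]; finiteness

theorem memLp_two_iff_lintegral {E : Type*} [NormedAddCommGroup E] {f : Plane → E}
    (hf : AEStronglyMeasurable f volume) : MemLp f 2 volume ↔ ∫⁻ p, ‖f p‖ₑ ^ 2 < ∞ := by
  rw [MemLp, and_iff_right hf, eLpNorm_lt_top_iff_lintegral_rpow_enorm_lt_top (by norm_num)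
    (by norm_num)]
  norm_num

open Classical in
/-- Multiplication by an essentially bounded function, as an operator on `L²`. -/
noncomputable def mulL (g : Plane → ℂ) : CL2 →L[ℝ] CL2 :=
  if h : MemLp g ∞ volume then
    ((ContinuousLinearMap.mul ℂ ℂ).holderL volume ∞ 2 2 (h.toLp g)).restrictScalars ℝ
  else 0

theorem coeFn_mulL {g : Plane → ℂ} (h : MemLp g ∞ volume) (f : CL2) :
    mulL g f =ᵐ[volume] fun p => g p * f p := by
  have h1 := (ContinuousLinearMap.mul ℂ ℂ).coeFn_holder (r := 2) (h.toLp g) f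
  simp only [mulL, h, dif_pos]
  filter_upwards [h1, h.coeFn_toLp] with p hp hq
  simp only [ContinuousLinearMap.coe_restrictScalars', ContinuousLinearMap.holderL_apply_apply]
  rw [hp, hq]
  rfl

theorem memLp_top_indicator_one {S : Set Plane} (hS : MeasurableSet S) :
    MemLp (S.indicator (fun _ => (1 : ℂ))) ∞ volume := by
  refine memLp_top_of_bound (measurable_const.indicator hS).aestronglyMeasurable 1
    (Eventually.of_forall fun p => ?_)
  by_cases h : p ∈ S <;> simp [h]

/-- Dominated convergence: at each point the error is eventually zero, and it never exceeds $|f|$.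
-/
theorem tendsto_mulL_indicator {S : ℕ → Set Plane} (hS : ∀ n, MeasurableSet (S n))
    (hS' : ∀ p, ∀ᶠ n in atTop, p ∈ S n) (f : CL2) :
    Tendsto (fun n => mulL ((S n).indicator (fun _ => (1 : ℂ))) f) atTop (𝓝 f) := by
  have key : Tendsto (fun n => ‖mulL ((S n).indicator (fun _ => (1 : ℂ))) f - f‖ₑ ^ 2) atTop
      (𝓝 0) := by
    have e : ∀ n, ‖mulL ((S n).indicator (fun _ => (1 : ℂ))) f - f‖ₑ ^ 2 =
        ∫⁻ p, ‖(S n).indicator (fun _ => (1 : ℂ)) p * f p - f p‖ₑ ^ 2 := fun n => by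
      rw [enorm_sq_eq_lintegral]
      refine lintegral_congr_ae ?_
      filter_upwards [coeFn_mulL (memLp_top_indicator_one (hS n)) f,
        Lp.coeFn_sub (mulL ((S n).indicator (fun _ => (1 : ℂ))) f) f] with p h1 h2
      rw [h2, Pi.sub_apply, h1]
    simp only [e]
    have := tendsto_lintegral_of_dominated_convergence' (μ := (volume : Measure Plane))
      (F := fun n p => ‖(S n).indicator (fun _ => (1 : ℂ)) p * f p - f p‖ₑ ^ 2)
      (f := fun _ => 0) (fun p => ‖f p‖ₑ ^ 2) (fun n => ?_) (fun n => ?_)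
      (lintegral_enorm_sq_ne_top f) ?_
    · simpa using this
    · exact ((((measurable_const.indicator (hS n)).aestronglyMeasurable.mul
        (Lp.aestronglyMeasurable f)).sub (Lp.aestronglyMeasurable f)).enorm).pow_const 2
    · refine Eventually.of_forall fun p => ?_
      by_cases h : p ∈ S n <;> simp [h]
    · refine Eventually.of_forall fun p => ?_
      refine tendsto_const_nhds.congr' ?_
      filter_upwards [hS' p] with n hn
      simp [hn]
  rw [tendsto_iff_edist_tendsto_0]
  have h2 := (ENNReal.continuous_rpow_const (y := 1 / 2)).tendsto 0 |>.comp key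
  refine (h2.congr fun n => ?_).trans (by simp)
  rw [Function.comp_apply, ← ENNReal.rpow_natCast, ← ENNReal.rpow_mul]
  simp [edist_eq_enorm_sub]

theorem memLp_top_indicator_le {g : Plane → ℂ} (hg : Measurable g) (n : ℕ) :
    MemLp ({p | ‖g p‖ ≤ n}.indicator g) ∞ volume := by
  refine memLp_top_of_bound
    (hg.indicator (measurableSet_le hg.norm measurable_const)).aestronglyMeasurable n
    (Eventually.of_forall fun p => ?_)
  by_cases h : ‖g p‖ ≤ n <;> simp [h]

/-- Multiplication by an unbounded symbol commutes with integration in time, as soon as the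
products are bounded in `L²`. -/
theorem IsPrimitive.multiplier {T : ℝ} (hT : 0 ≤ T) {U U' A A' : ℝ → CL2}
    (h : IsPrimitive T U U') {g : Plane → ℂ} (hg : Measurable g)
    (hA : ∀ t ∈ Icc 0 T, A t =ᵐ[volume] fun p => g p * U t p)
    (hA' : ∀ t ∈ Icc 0 T, A' t =ᵐ[volume] fun p => g p * U' t p)
    {C : ℝ} (hC : ∀ t ∈ Icc 0 T, ‖A' t‖ ≤ C) : IsPrimitive T A A' := by
  set S : ℕ → Set Plane := fun n => {p | ‖g p‖ ≤ n} with hS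
  have hSm : ∀ n, MeasurableSet (S n) := fun n => measurableSet_le hg.norm measurable_const
  have hSe : ∀ p, ∀ᶠ n in atTop, p ∈ S n := fun p => by
    obtain ⟨N, hN⟩ := exists_nat_ge ‖g p‖
    filter_upwards [eventually_ge_atTop N] with n hn
    exact hN.trans (by exact_mod_cast hn)
  have hmul : ∀ n (V W : CL2), (W =ᵐ[volume] fun p => g p * V p) →
      mulL ((S n).indicator g) V = mulL ((S n).indicator (fun _ => (1 : ℂ))) W := by
    intro n V W hVW
    refine Lp.ext ?_
    filter_upwards [coeFn_mulL (memLp_top_indicator_le hg n) V, hVW,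
      coeFn_mulL (memLp_top_indicator_one (hSm n)) W] with p h1 h2 h3
    rw [h1, h3, h2]
    change (S n).indicator g p * V p = _
    by_cases hp : p ∈ S n <;> simp only [hp, indicator_of_mem, indicator_of_notMem,
      not_false_eq_true, one_mul, zero_mul]
  -- Where $\|g\|\le n$ the symbol is a bounded operator, which commutes with the time integral. The
  -- rest of the proof lets $n\to\infty$.
  have hprim : ∀ n, IsPrimitive T (fun t => mulL ((S n).indicator (fun _ => (1 : ℂ))) (A t))
      (fun t => mulL ((S n).indicator (fun _ => (1 : ℂ))) (A' t)) := fun n =>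
    (h.clm_comp (mulL ((S n).indicator g))).congr hT (fun t ht => hmul n _ _ (hA t ht))
      (fun t ht => hmul n _ _ (hA' t ht))
  have hlim := fun f : CL2 => tendsto_mulL_indicator hSm hSe f
  have hint : IntervalIntegrable A' volume 0 T := by
    rw [intervalIntegrable_iff_integrableOn_Ioc_of_le hT]
    -- Measurability in time is not assumed for $A'$; it is inherited from the truncations, which
    -- converge to $A'(t)$ at every $t$.
    have hm : AEStronglyMeasurable A' (volume.restrict (Ioc 0 T)) :=
      aestronglyMeasurable_of_tendsto_ae atTop (fun n => ((hprim n).1.1).1)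
        (Eventually.of_forall fun t => hlim (A' t))
    refine Integrable.mono' (integrable_const C) hm ?_
    filter_upwards [ae_restrict_mem measurableSet_Ioc] with t ht
    exact hC t (Ioc_subset_Icc_self ht)
  refine ⟨hint, fun t ht => ?_⟩
  have hint' : IntervalIntegrable A' volume 0 t := by
    refine hint.mono_set ?_
    rw [uIcc_of_le ht.1, uIcc_of_le hT]
    exact Icc_subset_Icc_right ht.2
  refine tendsto_nhds_unique (hlim (A t)) ((hlim (A 0 + ∫ s in (0 : ℝ)..t, A' s)).congr fun n => ?_)
  rw [map_add, ← ContinuousLinearMap.intervalIntegral_comp_comm _ hint']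
  exact ((hprim n).2 t ht).symm

theorem IsPrimitive.norm_sq {T : ℝ} (hT : 0 ≤ T) {u u' : ℝ → CL2} (h : IsPrimitive T u u') :
    IsPrimitive T (fun t => ‖u t‖ ^ 2) (fun t => 2 * inner ℝ (u t) (u' t)) := by
  have := h.bilin (isBoundedBilinearMap_inner (𝕜 := ℝ) (E := CL2)).toContinuousLinearMap hT h
  refine this.congr hT (fun t _ => ?_) (fun t _ => ?_)
  · exact real_inner_self_eq_norm_sq (u _)
  · change inner ℝ (u' t) (u t) + inner ℝ (u t) (u' t) = _
    rw [real_inner_comm (u t)]; ring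

/-! ### The energy identity with real dispersion -/

theorem indicator_symbol_memLp {S : Set Plane} (hS : MeasurableSet S) {g : Plane → ℂ}
    (hg : Measurable g) {C : ℝ} (hC0 : 0 ≤ C) (hC : ∀ p ∈ S, ‖g p‖ ≤ C) :
    MemLp (S.indicator g) ∞ volume := by
  refine memLp_top_of_bound (hg.indicator hS).aestronglyMeasurable C
    (Eventually.of_forall fun p => ?_)
  by_cases h : p ∈ S <;> simp [h, hC0, hC p]

/-- The region on which both the weight `σ` and the dispersion `φ` are bounded by `n`. -/
def cutoff (σ φ : Plane → ℝ) (n : ℕ) : Set Plane := {p | |σ p| ≤ n ∧ |φ p| ≤ n}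

theorem measurableSet_cutoff {σ φ : Plane → ℝ} (hσ : Measurable σ) (hφ : Measurable φ) (n : ℕ) :
    MeasurableSet (cutoff σ φ n) :=
  (measurableSet_le (measurable_norm.comp hσ) measurable_const).inter
    (measurableSet_le (measurable_norm.comp hφ) measurable_const)

theorem eventually_mem_cutoff (σ φ : Plane → ℝ) (p : Plane) : ∀ᶠ n in atTop, p ∈ cutoff σ φ n := by
  obtain ⟨N, hN⟩ := exists_nat_ge (max |σ p| |φ p|)
  filter_upwards [eventually_ge_atTop N] with n hn
  have : (N : ℝ) ≤ n := by exact_mod_cast hn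
  exact ⟨(le_max_left _ _).trans (hN.trans this), (le_max_right _ _).trans (hN.trans this)⟩

/-- The weight `σ`, cut off. -/
noncomputable def cutWeight (σ φ : Plane → ℝ) (n : ℕ) : Plane → ℂ :=
  (cutoff σ φ n).indicator fun p => (σ p : ℂ)

/-- The symbol `i φ σ`, cut off. -/
noncomputable def cutDispersion (σ φ : Plane → ℝ) (n : ℕ) : Plane → ℂ :=
  (cutoff σ φ n).indicator fun p => Complex.I * φ p * σ p

theorem memLp_cutWeight {σ φ : Plane → ℝ} (hσ : Measurable σ) (hφ : Measurable φ) (n : ℕ) :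
    MemLp (cutWeight σ φ n) ∞ volume :=
  indicator_symbol_memLp (measurableSet_cutoff hσ hφ n) (Complex.measurable_ofReal.comp hσ)
    (Nat.cast_nonneg n) fun p hp => by simpa using hp.1

theorem memLp_cutDispersion {σ φ : Plane → ℝ} (hσ : Measurable σ) (hφ : Measurable φ) (n : ℕ) :
    MemLp (cutDispersion σ φ n) ∞ volume :=
  indicator_symbol_memLp (measurableSet_cutoff hσ hφ n)
    (((measurable_const.mul (Complex.measurable_ofReal.comp hφ))).mul
      (Complex.measurable_ofReal.comp hσ)) (C := n * n)
    (by positivity) fun p hp => by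
      have h1 := hp.1
      have h2 := hp.2
      simp only [norm_mul, Complex.norm_I, one_mul, Complex.norm_real, Real.norm_eq_abs]
      gcongr

/-- The real inner product of $\sigma U$ with $i\varphi\sigma U$ vanishes because $\varphi$ is real,
so only the forcing survives. -/
theorem inner_cut {σ φ : Plane → ℝ} (hσ : Measurable σ) (hφ : Measurable φ) (n : ℕ) (U G : CL2) :
    inner ℝ (mulL (cutWeight σ φ n) U) (mulL (cutDispersion σ φ n) U - mulL (cutWeight σ φ n) G) =
      -∫ p, (cutoff σ φ n).indicator
        (fun p => σ p ^ 2 * ((starRingEnd ℂ) (U p) * G p).re) p := by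
  rw [L2.inner_def, ← integral_neg]
  refine integral_congr_ae ?_
  filter_upwards [coeFn_mulL (memLp_cutWeight hσ hφ n) U,
    coeFn_mulL (memLp_cutWeight hσ hφ n) G, coeFn_mulL (memLp_cutDispersion hσ hφ n) U,
    Lp.coeFn_sub (mulL (cutDispersion σ φ n) U) (mulL (cutWeight σ φ n) G)] with p h1 h2 h3 h4
  rw [h4, Pi.sub_apply, h1, h2, h3, Complex.inner]
  by_cases hp : p ∈ cutoff σ φ n
  · simp only [cutWeight, cutDispersion, indicator_of_mem hp]
    simp
    ring
  · simp [cutWeight, cutDispersion, indicator_of_notMem hp]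

theorem abs_re_conj_mul_le (a b : ℂ) : ‖((starRingEnd ℂ) a * b).re‖ ≤ ‖a‖ * ‖b‖ := by
  refine (Complex.abs_re_le_norm _).trans ?_
  simp

theorem enorm_weight_re_le (c : ℝ) (a b : ℂ) :
    ‖c ^ 2 * ((starRingEnd ℂ) a * b).re‖ₑ ≤ ‖c‖ₑ ^ 2 * ‖a‖ₑ * ‖b‖ₑ := by
  rw [enorm_mul, enorm_pow, mul_assoc]
  gcongr
  rw [← enorm_mul, ← ofReal_norm, ← ofReal_norm (a * b), norm_mul]
  exact ENNReal.ofReal_le_ofReal (abs_re_conj_mul_le a b)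

/-- Energy estimate for the mild equation `U' = i φ U - G`, where `φ` is real. -/
theorem energy_estimate {T : ℝ} (hT : 0 ≤ T) {U G : ℝ → CL2} {σ φ : Plane → ℝ}
    (hσ : Measurable σ) (hφ : Measurable φ)
    (hU : ∀ n, IsPrimitive T (fun t => mulL (cutWeight σ φ n) (U t))
      (fun t => mulL (cutDispersion σ φ n) (U t) - mulL (cutWeight σ φ n) (G t)))
    {C B : ℝ} (hC : ∀ t ∈ Icc 0 T, ∫⁻ p, ‖σ p‖ₑ ^ 2 * ‖U t p‖ₑ * ‖G t p‖ₑ ≤ ENNReal.ofReal C)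
    (hB : ∀ t ∈ Icc 0 T, |∫ p, σ p ^ 2 * ((starRingEnd ℂ) (U t p) * G t p).re| ≤ B) :
    ∫⁻ p, ‖(σ p : ℂ) * U T p‖ₑ ^ 2 ≤
      (∫⁻ p, ‖(σ p : ℂ) * U 0 p‖ₑ ^ 2) + ENNReal.ofReal (2 * T * B) := by
  have hmeas := measurableSet_cutoff hσ hφ
  set f : ℝ → Plane → ℝ := fun t p => σ p ^ 2 * ((starRingEnd ℂ) (U t p) * G t p).re with hf
  set g : ℕ → ℝ → ℝ := fun n t => ∫ p, (cutoff σ φ n).indicator (f t) p with hg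
  have hfm : ∀ t, AEStronglyMeasurable (f t) volume := fun t => by
    refine (hσ.pow_const 2).aestronglyMeasurable.mul ?_
    exact Complex.continuous_re.comp_aestronglyMeasurable
      ((Complex.continuous_conj.comp_aestronglyMeasurable (Lp.aestronglyMeasurable _)).mul
        (Lp.aestronglyMeasurable _))
  have hfb : ∀ t ∈ Icc 0 T, ∫⁻ p, ‖f t p‖ₑ ≤ ENNReal.ofReal C := fun t ht =>
    (lintegral_mono fun p => enorm_weight_re_le _ _ _).trans (hC t ht)
  have hfi : ∀ t ∈ Icc 0 T, Integrable (f t) volume := fun t ht =>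
    ⟨hfm t, (hfb t ht).trans_lt ENNReal.ofReal_lt_top⟩
  -- `C` serves only to dominate the truncated pairings uniformly in $n$ and $t$; it does not appear
  -- in the final bound.
  have hgb : ∀ n, ∀ t ∈ Icc 0 T, |g n t| ≤ |C| := fun n t ht => by
    have h1 : ‖g n t‖ₑ ≤ ENNReal.ofReal |C| :=
      (enorm_integral_le_lintegral_enorm _).trans <|
        ((lintegral_mono fun p => enorm_indicator_le_enorm_self _ _).trans (hfb t ht)).trans
          (ENNReal.ofReal_le_ofReal (le_abs_self C))
    rw [← ofReal_norm, ENNReal.ofReal_le_ofReal_iff (abs_nonneg _)] at h1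
    exact h1
  have hglim : ∀ t ∈ Icc 0 T, Tendsto (fun n => g n t) atTop (𝓝 (∫ p, f t p)) := fun t ht => by
    refine tendsto_integral_of_dominated_convergence (fun p => ‖f t p‖)
      (fun n => (hfm t).indicator (hmeas n)) (hfi t ht).norm
      (fun n => Eventually.of_forall fun p => norm_indicator_le_norm_self _ _)
      (Eventually.of_forall fun p => ?_)
    refine tendsto_const_nhds.congr' ?_
    filter_upwards [eventually_mem_cutoff σ φ p] with n hn
    rw [indicator_of_mem hn]
  have hid : ∀ n, ‖mulL (cutWeight σ φ n) (U T)‖ ^ 2 =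
      ‖mulL (cutWeight σ φ n) (U 0)‖ ^ 2 + ∫ t in (0 : ℝ)..T, 2 * -g n t := fun n => by
    have := ((hU n).norm_sq hT).2 T ⟨hT, le_rfl⟩
    simpa only [inner_cut hσ hφ] using this
  have hgint : ∀ n, IntervalIntegrable (fun t => 2 * -g n t) volume 0 T := fun n => by
    have := ((hU n).norm_sq hT).1
    simpa only [inner_cut hσ hφ] using this
  have hlim : Tendsto (fun n => ∫ t in (0 : ℝ)..T, 2 * -g n t) atTop
      (𝓝 (∫ t in (0 : ℝ)..T, 2 * -∫ p, f t p)) := by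
    refine intervalIntegral.tendsto_integral_filter_of_dominated_convergence (fun _ => 2 * |C|)
      (Eventually.of_forall fun n => ?_) (Eventually.of_forall fun n => ?_)
      intervalIntegrable_const ?_
    · rw [uIoc_of_le hT]; exact (hgint n).1.1
    · refine Eventually.of_forall fun t ht => ?_
      rw [uIoc_of_le hT] at ht
      rw [norm_mul, norm_neg, Real.norm_eq_abs, Real.norm_eq_abs, abs_two]
      exact mul_le_mul_of_nonneg_left (hgb n t (Ioc_subset_Icc_self ht)) zero_le_two
    · refine Eventually.of_forall fun t ht => ?_
      rw [uIoc_of_le hT] at ht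
      exact ((hglim t (Ioc_subset_Icc_self ht)).neg).const_mul 2
  -- `B` controls only the untruncated pairing, where cancellations are available, so it can be used
  -- only on the limit.
  have hle : (∫ t in (0 : ℝ)..T, 2 * -∫ p, f t p) ≤ 2 * T * B := by
    refine (le_abs_self _).trans ?_
    have := intervalIntegral.norm_integral_le_of_norm_le_const (a := (0 : ℝ)) (b := T)
      (f := fun t => 2 * -∫ p, f t p) (C := 2 * B) fun t ht => by
        rw [uIoc_of_le hT] at ht
        rw [norm_mul, norm_neg, Real.norm_eq_abs, Real.norm_eq_abs, abs_two]
        exact mul_le_mul_of_nonneg_left (hB t (Ioc_subset_Icc_self ht)) zero_le_two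
    rw [Real.norm_eq_abs, sub_zero, abs_of_nonneg hT] at this
    linarith
  have hn : ∀ n (V : CL2), ‖mulL (cutWeight σ φ n) V‖ₑ ^ 2 =
      ∫⁻ p, (cutoff σ φ n).indicator (fun p => ‖(σ p : ℂ) * V p‖ₑ ^ 2) p := fun n V => by
    rw [enorm_sq_eq_lintegral]
    refine lintegral_congr_ae ?_
    filter_upwards [coeFn_mulL (memLp_cutWeight hσ hφ n) V] with p hp
    rw [hp]
    by_cases h : p ∈ cutoff σ φ n <;> simp [cutWeight, h]
  have hmain : ∀ n, ∫⁻ p, (cutoff σ φ n).indicator (fun p => ‖(σ p : ℂ) * U T p‖ₑ ^ 2) p ≤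
      (∫⁻ p, ‖(σ p : ℂ) * U 0 p‖ₑ ^ 2) + ENNReal.ofReal (∫ t in (0 : ℝ)..T, 2 * -g n t) :=
    fun n => by
    have h0 : ‖mulL (cutWeight σ φ n) (U 0)‖ₑ ^ 2 ≤ ∫⁻ p, ‖(σ p : ℂ) * U 0 p‖ₑ ^ 2 := by
      rw [hn]
      exact lintegral_mono fun p => indicator_le_self _ _ p
    rw [← hn]
    refine le_trans ?_ (add_le_add_left h0 _)
    simp only [← ofReal_norm]
    rw [← ENNReal.ofReal_pow (norm_nonneg _), ← ENNReal.ofReal_pow (norm_nonneg _), hid n]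
    exact ENNReal.ofReal_add_le
  -- On the left the truncation regions increase, so monotone convergence applies without knowing
  -- beforehand that the weighted norm at time $T$ is finite.
  refine le_of_tendsto_of_tendsto' (lintegral_tendsto_of_tendsto_of_monotone
    (f := fun n => (cutoff σ φ n).indicator (fun p => ‖(σ p : ℂ) * U T p‖ₑ ^ 2)) ?_ ?_ ?_)
    (((ENNReal.continuous_ofReal.tendsto _).comp hlim).const_add _) hmain |>.trans ?_
  · intro n
    refine AEMeasurable.indicator ?_ (hmeas n)
    exact (((Complex.measurable_ofReal.comp hσ).aestronglyMeasurable.mul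
      (Lp.aestronglyMeasurable (U T))).enorm).pow_const 2
  · refine Eventually.of_forall fun p m n hmn => ?_
    refine indicator_le_indicator_of_subset (fun q hq => ?_) (fun _ => zero_le) p
    have : (m : ℝ) ≤ n := by exact_mod_cast hmn
    exact ⟨hq.1.trans this, hq.2.trans this⟩
  · refine Eventually.of_forall fun p => tendsto_const_nhds.congr' ?_
    filter_upwards [eventually_mem_cutoff σ φ p] with n hn
    rw [indicator_of_mem hn]
  · gcongr

/-! ### Weak derivatives and products on the Fourier side -/

/-- Smooth compactly supported functions already separate locally integrable functions, and they are
Schwartz. -/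
theorem ae_eq_of_integral_schwartz_eq {f g : Plane → ℂ} (hf : LocallyIntegrable f volume)
    (hg : LocallyIntegrable g volume)
    (h : ∀ φ : 𝓢(Plane, ℂ), ∫ p, φ p • f p = ∫ p, φ p • g p) : f =ᵐ[volume] g := by
  refine ae_eq_of_integral_contDiff_smul_eq hf hg fun φ hφ hc => ?_
  have hg₁ : HasCompactSupport (Complex.ofRealCLM ∘ φ) := hc.comp_left rfl
  have hg₂ : ContDiff ℝ ((⊤ : ℕ∞) : WithTop ℕ∞) (Complex.ofRealCLM ∘ φ) := by fun_prop
  simpa using h (hg₁.toSchwartzMap hg₂)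

/-- The Fourier transform of a real square integrable function. -/
noncomputable def fhat (f : L2) : CL2 := 𝓕 (toComplex f)

/-- The Fourier transform as a real continuous linear map. -/
noncomputable def fhatL : L2 →L[ℝ] CL2 :=
  (FourierTransform.fourierCLM ℂ CL2).restrictScalars ℝ ∘L Complex.ofRealCLM.compLpL 2 volume

theorem fhatL_apply (f : L2) : fhatL f = fhat f := rfl

theorem coeFn_toComplex (f : L2) : toComplex f =ᵐ[volume] fun p => ((f p : ℝ) : ℂ) :=
  Complex.ofRealCLM.coeFn_compLp f

theorem enorm_toComplex (f : L2) : ‖toComplex f‖ₑ = ‖f‖ₑ := by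
  rw [Lp.enorm_def, Lp.enorm_def]
  refine eLpNorm_congr_enorm_ae ?_
  filter_upwards [coeFn_toComplex f] with p hp
  rw [hp, ← ofReal_norm, ← ofReal_norm, Complex.norm_real]

theorem enorm_fhat (f : L2) : ‖fhat f‖ₑ = ‖f‖ₑ := by
  rw [← enorm_toComplex, fhat, ← ofReal_norm, Lp.norm_fourier_eq, ofReal_norm]

/-- The symbol of `∂_x^a ∂_y^b`. -/
noncomputable def symb (a b : ℕ) (p : Plane) : ℂ :=
  (2 * Real.pi * Complex.I * (p 0 : ℂ)) ^ a * (2 * Real.pi * Complex.I * (p 1 : ℂ)) ^ b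

theorem continuous_symb (a b : ℕ) : Continuous (symb a b) := by
  unfold symb
  fun_prop

theorem hasTemperateGrowth_coord (i : Fin 2) :
    (fun p : Plane => 2 * Real.pi * Complex.I * (p i : ℂ)).HasTemperateGrowth := by
  have h : (fun p : Plane => inner ℝ p (EuclideanSpace.single i (1 : ℝ))).HasTemperateGrowth := by
    fun_prop
  have h2 : (fun p : Plane => ((inner ℝ p (EuclideanSpace.single i (1 : ℝ)) : ℝ) : ℂ)).HasTemperateGrowth := by
    fun_prop
  have h3 := (Function.HasTemperateGrowth.const (E := Plane) (2 * Real.pi * Complex.I : ℂ)).mul h2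
  simpa [EuclideanSpace.inner_single_right, Pi.mul_def] using h3

theorem hasTemperateGrowth_symb (a b : ℕ) : (symb a b).HasTemperateGrowth := by
  have h0 := hasTemperateGrowth_coord 0
  have h1 := hasTemperateGrowth_coord 1
  have hp : ∀ (g : Plane → ℂ), g.HasTemperateGrowth → ∀ n : ℕ,
      (fun p => g p ^ n).HasTemperateGrowth := fun g hg n => by
    induction n with
    | zero =>
      simp only [pow_zero]
      exact Function.HasTemperateGrowth.const (E := Plane) (1 : ℂ)
    | succ n ih => simp only [pow_succ]; exact ih.mul hg
  exact (hp _ h0 a).mul (hp _ h1 b)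

theorem fourier_lineDeriv_single (i : Fin 2) (u : 𝓢'(Plane, ℂ)) :
    𝓕 (∂_{(EuclideanSpace.single i 1 : Plane)} u) =
      TemperedDistribution.smulLeftCLM ℂ (fun p : Plane => 2 * Real.pi * Complex.I * (p i : ℂ))
        (𝓕 u) := by
  have h2 : (fun p : Plane =>
      ((inner ℝ p (EuclideanSpace.single i (1 : ℝ)) : ℝ) : ℂ)).HasTemperateGrowth := by
    fun_prop
  have h3 := TemperedDistribution.smulLeftCLM_smul (F := ℂ) h2 (2 * Real.pi * Complex.I)
  rw [TemperedDistribution.fourier_lineDerivOp_eq]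
  have h4 : (fun p : Plane => 2 * Real.pi * Complex.I * (p i : ℂ)) =
      (2 * Real.pi * Complex.I : ℂ) • (fun p : Plane =>
      ((inner ℝ p (EuclideanSpace.single i (1 : ℝ)) : ℝ) : ℂ)) := by
    funext p
    simp [EuclideanSpace.inner_single_right]
  rw [h4, h3]
  rfl

theorem fourier_distDeriv (a b : ℕ) (u : 𝓢'(Plane, ℂ)) :
    𝓕 (distDeriv a b u) = TemperedDistribution.smulLeftCLM ℂ (symb a b) (𝓕 u) := by
  induction a with
  | zero =>
    induction b with
    | zero =>
      have : symb 0 0 = fun _ => (1 : ℂ) := by funext p; simp [symb]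
      rw [this, TemperedDistribution.smulLeftCLM_const, one_smul]
      rfl
    | succ b ih =>
      have e : distDeriv 0 (b + 1) u =
          ∂_{(EuclideanSpace.single 1 1 : Plane)} (distDeriv 0 b u) := by
        simp only [distDeriv, Function.iterate_zero, id_eq, Function.iterate_succ_apply']
      rw [e, fourier_lineDeriv_single, ih, TemperedDistribution.smulLeftCLM_smulLeftCLM_apply
        (hasTemperateGrowth_symb 0 b) (hasTemperateGrowth_coord 1)]
      congr 2
      funext p
      simp [symb, pow_succ]
  | succ a ih =>
    have e : distDeriv (a + 1) b u =
        ∂_{(EuclideanSpace.single 0 1 : Plane)} (distDeriv a b u) := by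
      simp only [distDeriv, Function.iterate_succ_apply']
    rw [e, fourier_lineDeriv_single, ih, TemperedDistribution.smulLeftCLM_smulLeftCLM_apply
      (hasTemperateGrowth_symb a b) (hasTemperateGrowth_coord 0)]
    congr 2
    funext p
    simp [symb, pow_succ]
    ring

theorem locallyIntegrable_coe (f : CL2) : LocallyIntegrable f volume :=
  (Lp.memLp f).locallyIntegrable (by norm_num)

theorem LocallyIntegrable.continuous_mul' {g f : Plane → ℂ} (hf : LocallyIntegrable f volume)
    (hg : Continuous g) : LocallyIntegrable (fun p => g p * f p) volume := by
  rw [locallyIntegrable_iff] at hf ⊢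
  intro K hK
  exact (hf K hK).continuousOn_mul hg.continuousOn hK

/-- Weak derivatives are multiplications by symbols on the Fourier side. -/
theorem hasDerivL2_iff (a b : ℕ) (f g : L2) :
    HasDerivL2 a b f g ↔ fhat g =ᵐ[volume] fun p => symb a b p * fhat f p := by
  have h1 : HasDerivL2 a b f g ↔ 𝓕 (distDeriv a b (toDist f)) = 𝓕 (toDist g) := by
    constructor
    · intro h; rw [h]
    · intro h
      have := congrArg (fun u : 𝓢'(Plane, ℂ) => 𝓕⁻ u) h
      rw [HasDerivL2]
      simpa using this
  rw [h1, fourier_distDeriv]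
  simp only [toDist]
  rw [Lp.fourier_toTemperedDistribution_eq, Lp.fourier_toTemperedDistribution_eq]
  change TemperedDistribution.smulLeftCLM ℂ (symb a b) (Lp.toTemperedDistribution (fhat f)) =
    Lp.toTemperedDistribution (fhat g) ↔ _
  constructor
  · intro h
    refine ae_eq_of_integral_schwartz_eq (locallyIntegrable_coe _)
      (LocallyIntegrable.continuous_mul' (locallyIntegrable_coe _) (continuous_symb a b))
      fun φ => ?_
    have := congrArg (fun u : 𝓢'(Plane, ℂ) => u φ) h
    simp only [TemperedDistribution.smulLeftCLM_apply_apply, Lp.toTemperedDistribution_apply] at this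
    rw [← this]
    refine integral_congr_ae (Eventually.of_forall fun p => ?_)
    simp only [SchwartzMap.smulLeftCLM_apply_apply (hasTemperateGrowth_symb a b), smul_eq_mul]
    ring
  · intro h
    ext φ
    simp only [TemperedDistribution.smulLeftCLM_apply_apply, Lp.toTemperedDistribution_apply]
    refine integral_congr_ae ?_
    filter_upwards [h] with p hp
    simp only [SchwartzMap.smulLeftCLM_apply_apply (hasTemperateGrowth_symb a b), smul_eq_mul, hp]
    ring

/-- On `L¹ ∩ L²`, the inverse Fourier transform is given by the integral. -/
theorem fourierInv_ae_eq (G : CL2) (hG : Integrable G volume) :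
    (𝓕⁻ G : CL2) =ᵐ[volume] 𝓕⁻ (G : Plane → ℂ) := by
  have hc : Continuous (𝓕⁻ (G : Plane → ℂ)) := by
    have : Continuous (𝓕 (G : Plane → ℂ)) :=
      VectorFourier.fourierIntegral_continuous Real.continuous_fourierChar
        continuous_inner hG
    have e : 𝓕⁻ (G : Plane → ℂ) = fun p => 𝓕 (G : Plane → ℂ) (-p) :=
      funext fun p => Real.fourierInv_eq_fourier_neg _ _
    rw [e]
    exact this.comp continuous_neg
  refine ae_eq_of_integral_schwartz_eq (locallyIntegrable_coe _) hc.locallyIntegrable fun φ => ?_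
  have h1 : ∫ p, φ p • (𝓕⁻ G : CL2) p = Lp.toTemperedDistribution (𝓕⁻ G : CL2) φ := by simp
  rw [h1, ← Lp.fourierInv_toTemperedDistribution_eq, TemperedDistribution.fourierInv_apply,
    Lp.toTemperedDistribution_apply]
  -- The inverse transform is the Fourier integral for the pairing $-\langle\cdot,\cdot\rangle$.
  -- Moving it from the test function to `G` is then the general duality formula, and the pairing is
  -- symmetric.
  have h2 : ∀ (ψ : Plane → ℂ), 𝓕⁻ ψ = VectorFourier.fourierIntegral Real.fourierChar volume
    (-innerₗ Plane) ψ := fun ψ => rfl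
  have h3 := VectorFourier.integral_fourierIntegral_smul_eq_flip (μ := (volume : Measure Plane))
    (ν := (volume : Measure Plane)) (e := Real.fourierChar) (L := -innerₗ Plane)
    (f := φ) (g := (G : Plane → ℂ)) Real.continuous_fourierChar
    (by simp only [LinearMap.neg_apply, innerₗ_apply_apply]; fun_prop) φ.integrable hG
  rw [SchwartzMap.fourierInv_coe, h2, h2, h3]
  have h4 : (-innerₗ Plane).flip = -innerₗ Plane := by
    refine LinearMap.ext₂ fun p q => ?_
    simpa using real_inner_comm p q
  rw [h4]

/-! ### Trilinear convolution bounds -/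

/-- The `L²` seminorm of a nonnegative function. -/
noncomputable def nTwo (f : Plane → ℝ≥0∞) : ℝ≥0∞ := (∫⁻ p, f p ^ 2) ^ (1 / 2 : ℝ)

theorem nTwo_sq (f : Plane → ℝ≥0∞) : nTwo f ^ 2 = ∫⁻ p, f p ^ 2 := by
  rw [nTwo, ← ENNReal.rpow_natCast, ← ENNReal.rpow_mul]
  norm_num

theorem nTwo_mono {f g : Plane → ℝ≥0∞} (h : ∀ p, f p ≤ g p) : nTwo f ≤ nTwo g := by
  unfold nTwo
  gcongr
  exact h _

theorem lintegral_mul_le_nTwo {f g : Plane → ℝ≥0∞} (hf : AEMeasurable f) (hg : AEMeasurable g) :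
    ∫⁻ p, f p * g p ≤ nTwo f * nTwo g := by
  have := ENNReal.lintegral_mul_le_Lp_mul_Lq (volume : Measure Plane)
    (Real.holderConjugate_iff.2 ⟨one_lt_two, by norm_num⟩ : Real.HolderConjugate 2 2) hf hg
  simpa [nTwo] using this

/-- The trilinear form `∫∫ a(p) A(p - q) B(q)`. -/
noncomputable def tri (a A B : Plane → ℝ≥0∞) : ℝ≥0∞ := ∫⁻ p, ∫⁻ q, a p * A (p - q) * B q

theorem nTwo_comp_sub (f : Plane → ℝ≥0∞) (z : Plane) : nTwo (fun p => f (p - z)) = nTwo f := by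
  unfold nTwo
  rw [lintegral_sub_right_eq_self (fun p => f p ^ 2) z]

/-- Young's inequality with exponents $2,1,2$: for a fixed shift $z=p-q$ apply Cauchy–Schwarz in
$p$, then integrate in $z$. In `tri_le_two_one` the fixed variable is $q$ instead. -/
theorem tri_le_one_two {a A B : Plane → ℝ≥0∞} (ha : Measurable a) (hA : Measurable A)
    (hB : Measurable B) : tri a A B ≤ nTwo a * (∫⁻ p, A p) * nTwo B := by
  have h1 : tri a A B = ∫⁻ p, ∫⁻ z, a p * A z * B (p - z) := by
    refine lintegral_congr fun p => ?_
    rw [← lintegral_sub_left_eq_self (fun z => a p * A z * B (p - z)) p]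
    simp
  rw [h1, lintegral_lintegral_swap (by fun_prop)]
  calc ∫⁻ z, ∫⁻ p, a p * A z * B (p - z) ≤ ∫⁻ z, A z * (nTwo a * nTwo B) := by
        refine lintegral_mono fun z => ?_
        have : ∀ p, a p * A z * B (p - z) = A z * (a p * B (p - z)) := fun p => by ring
        simp only [this]
        rw [lintegral_const_mul _ (by fun_prop)]
        gcongr
        rw [← nTwo_comp_sub B z]
        exact lintegral_mul_le_nTwo ha.aemeasurable (by fun_prop)
    _ = nTwo a * (∫⁻ p, A p) * nTwo B := by
        rw [lintegral_mul_const _ hA]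
        ring

theorem tri_le_two_one {a A B : Plane → ℝ≥0∞} (ha : Measurable a) (hA : Measurable A)
    (hB : Measurable B) : tri a A B ≤ nTwo a * nTwo A * ∫⁻ p, B p := by
  unfold tri
  rw [lintegral_lintegral_swap (by fun_prop)]
  calc ∫⁻ q, ∫⁻ p, a p * A (p - q) * B q ≤ ∫⁻ q, (nTwo a * nTwo A) * B q := by
        refine lintegral_mono fun q => ?_
        rw [lintegral_mul_const _ (by fun_prop)]
        gcongr
        rw [← nTwo_comp_sub A q]
        exact lintegral_mul_le_nTwo ha.aemeasurable (by fun_prop)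
    _ = nTwo a * nTwo A * ∫⁻ p, B p := by
        rw [lintegral_const_mul _ hB]

theorem lintegral_conv_le {A B : Plane → ℝ≥0∞} (hA : Measurable A) (hB : Measurable B)
    (p : Plane) : ∫⁻ q, A (p - q) * B q ≤ nTwo A * nTwo B := by
  refine (lintegral_mul_le_nTwo (by fun_prop) (by fun_prop)).trans (le_of_eq ?_)
  congr 1
  unfold nTwo
  rw [lintegral_sub_left_eq_self (fun p => A p ^ 2) p]

theorem lintegral_lintegral_conv {A B : Plane → ℝ≥0∞} (hA : Measurable A) (hB : Measurable B) :
    ∫⁻ p, ∫⁻ q, A (p - q) * B q = (∫⁻ p, A p) * ∫⁻ p, B p := by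
  rw [lintegral_lintegral_swap (by fun_prop), ← lintegral_const_mul _ hB]
  refine lintegral_congr fun q => ?_
  rw [lintegral_mul_const _ (by fun_prop), lintegral_sub_right_eq_self]

/-! ### Convolution and products -/

/-- The convolution of two functions on the plane. -/
noncomputable def conv (a b : Plane → ℂ) (p : Plane) : ℂ := ∫ q, a (p - q) * b q

theorem conv_eq (a b : Plane → ℂ) : conv a b = b ⋆[ContinuousLinearMap.mul ℂ ℂ] a := by
  funext p
  simp [conv, convolution, mul_comm]

theorem nTwo_enorm_lt_top (f : CL2) : nTwo (fun p => ‖f p‖ₑ) < ∞ :=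
  ENNReal.rpow_lt_top_of_nonneg (by norm_num) (lintegral_enorm_sq_ne_top f)

theorem nTwo_enorm_eq (f : CL2) : nTwo (fun p => ‖f p‖ₑ) = ‖f‖ₑ := by
  rw [nTwo, ← enorm_sq_eq_lintegral, ← ENNReal.rpow_natCast, ← ENNReal.rpow_mul]
  norm_num

theorem measurable_enorm_coe (f : CL2) : Measurable fun p => ‖f p‖ₑ :=
  (Lp.stronglyMeasurable f).measurable.enorm

/-- Interpolation between $\|a*b\|_\infty\le\|a\|_2\|b\|_2$ and $\|a*b\|_1\le\|a\|_1\|b\|_1$. -/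
theorem lintegral_enorm_conv_sq_le (a b : CL2) :
    ∫⁻ p, ‖conv a b p‖ₑ ^ 2 ≤ (nTwo (fun p => ‖a p‖ₑ) * nTwo (fun p => ‖b p‖ₑ)) *
      ((∫⁻ p, ‖a p‖ₑ) * ∫⁻ p, ‖b p‖ₑ) := by
  have hle : ∀ p, ‖conv a b p‖ₑ ≤ ∫⁻ q, ‖a (p - q)‖ₑ * ‖b q‖ₑ := fun p =>
    (enorm_integral_le_lintegral_enorm _).trans (by simp [enorm_mul])
  have ma := measurable_enorm_coe a
  have mb := measurable_enorm_coe b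
  calc ∫⁻ p, ‖conv a b p‖ₑ ^ 2
      ≤ ∫⁻ p, (nTwo (fun p => ‖a p‖ₑ) * nTwo (fun p => ‖b p‖ₑ)) *
          ∫⁻ q, ‖a (p - q)‖ₑ * ‖b q‖ₑ := by
        refine lintegral_mono fun p => ?_
        rw [sq]
        exact mul_le_mul' ((hle p).trans (lintegral_conv_le ma mb p)) (hle p)
    _ = (nTwo (fun p => ‖a p‖ₑ) * nTwo (fun p => ‖b p‖ₑ)) *
          ((∫⁻ p, ‖a p‖ₑ) * ∫⁻ p, ‖b p‖ₑ) := by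
        rw [lintegral_const_mul' _ _
          (ENNReal.mul_lt_top (nTwo_enorm_lt_top a) (nTwo_enorm_lt_top b)).ne,
          lintegral_lintegral_conv ma mb]

theorem memLp_conv (a b : CL2) (ha : Integrable a volume) (hb : Integrable b volume) :
    MemLp (conv a b) 2 volume := by
  have hi : Integrable (conv a b) volume := by
    rw [conv_eq]; exact Integrable.integrable_convolution _ hb ha
  rw [memLp_two_iff_lintegral hi.1]
  exact (lintegral_enorm_conv_sq_le a b).trans_lt (ENNReal.mul_lt_top
    (ENNReal.mul_lt_top (nTwo_enorm_lt_top a) (nTwo_enorm_lt_top b))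
    (ENNReal.mul_lt_top ha.2 hb.2))

theorem fourierInv_conv {a b : Plane → ℂ} (ha : Integrable a volume) (hb : Integrable b volume)
    (p : Plane) : 𝓕⁻ (conv a b) p = 𝓕⁻ a p * 𝓕⁻ b p := by
  rw [conv_eq, Real.fourierInv_eq_fourier_neg, Real.fourier_mul_convolution_eq hb ha,
    Real.fourierInv_eq_fourier_neg, Real.fourierInv_eq_fourier_neg, mul_comm]

theorem toComplex_eq_fourierInv (f : L2) : toComplex f = 𝓕⁻ (fhat f) := by
  rw [fhat, FourierTransform.fourierInv_fourier_eq]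

/-- The Fourier transform of a product is a convolution. -/
theorem fhat_mul {f g r : L2} (hr : r =ᵐ[volume] fun p => f p * g p)
    (hf : Integrable (fhat f) volume) (hg : Integrable (fhat g) volume) :
    fhat r =ᵐ[volume] conv (fhat f) (fhat g) := by
  have hm := memLp_conv _ _ hf hg
  have hi : Integrable (conv (fhat f) (fhat g)) volume := by
    rw [conv_eq]; exact Integrable.integrable_convolution _ hg hf
  have hH : Integrable (hm.toLp _) volume := hi.congr hm.coeFn_toLp.symm
  -- The comparison is made after inverting the transform: $\hat f$, $\hat g$ and their convolution
  -- are integrable, so their inverse transforms are honest integrals, whereas $f$ and $g$ need not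
  -- be integrable.
  have e : toComplex r = 𝓕⁻ (hm.toLp _) := by
    refine Lp.ext ?_
    have h1 := fourierInv_ae_eq _ hf
    have h2 := fourierInv_ae_eq _ hg
    rw [← toComplex_eq_fourierInv] at h1 h2
    filter_upwards [fourierInv_ae_eq _ hH, coeFn_toComplex r, coeFn_toComplex f,
      coeFn_toComplex g, h1, h2, hr] with p k1 k2 k3 k4 k5 k6 k7
    rw [k1, k2, k7, Real.fourierInv_congr_ae hm.coeFn_toLp p, fourierInv_conv hf hg, ← k5, ← k6,
      k3, k4]
    simp
  rw [fhat, e, FourierTransform.fourier_fourierInv_eq]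
  exact hm.coeFn_toLp

/-! ### Real functions have conjugation symmetric Fourier transforms -/

theorem conj_fourierInv (G : Plane → ℂ) (p : Plane) :
    (starRingEnd ℂ) (𝓕⁻ G p) = 𝓕⁻ (fun q => (starRingEnd ℂ) (G (-q))) p := by
  rw [Real.fourierInv_eq', Real.fourierInv_eq', ← integral_conj,
    ← integral_neg_eq_self]
  refine integral_congr_ae (Eventually.of_forall fun q => ?_)
  simp [← Complex.exp_conj, map_ofNat]

theorem memLp_conj_neg (G : CL2) : MemLp (fun q => (starRingEnd ℂ) (G (-q))) 2 volume := by
  have h1 : MemLp (fun q => G (-q)) 2 volume :=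
    (Lp.memLp G).comp_measurePreserving (Measure.measurePreserving_neg volume)
  exact h1.star

theorem integrable_conj_neg {G : Plane → ℂ} (hG : Integrable G volume) :
    Integrable (fun q => (starRingEnd ℂ) (G (-q))) volume := by
  exact memLp_one_iff_integrable.1 (memLp_one_iff_integrable.2 hG.comp_neg).star

/-- Conjugating and reflecting the transform conjugates the inverse transform, which changes nothing
for a real function; injectivity of $\mathcal F^{-1}$ concludes. -/
theorem fhat_neg {f : L2} (hf : Integrable (fhat f) volume) :
    ∀ᵐ p, fhat f (-p) = (starRingEnd ℂ) (fhat f p) := by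
  have hm := memLp_conj_neg (fhat f)
  have hH : Integrable (hm.toLp _) volume :=
    (integrable_conj_neg hf).congr hm.coeFn_toLp.symm
  have e : 𝓕⁻ (hm.toLp _) = 𝓕⁻ (fhat f) := by
    refine Lp.ext ?_
    have h2 := coeFn_toComplex f
    rw [toComplex_eq_fourierInv] at h2
    filter_upwards [fourierInv_ae_eq _ hH, fourierInv_ae_eq _ hf, h2] with p k1 k2 k3
    rw [k1, Real.fourierInv_congr_ae hm.coeFn_toLp p, ← conj_fourierInv, ← k2, k3,
      Complex.conj_ofReal]
  have e2 : hm.toLp _ = fhat f := by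
    have := congrArg (fun u : CL2 => 𝓕 u) e
    simpa [FourierTransform.fourier_fourierInv_eq] using this
  have h3 := hm.coeFn_toLp
  rw [e2] at h3
  filter_upwards [h3] with p hp
  rw [hp]
  simp

/-- Hermitian symmetry makes the inverse transform real, so its real part loses nothing. This is how
weak derivatives are produced as real functions. -/
theorem exists_fhat_eq {G : CL2} (hG : Integrable G volume)
    (h : ∀ᵐ p, G (-p) = (starRingEnd ℂ) (G p)) : ∃ g : L2, fhat g = G := by
  refine ⟨Complex.reCLM.compLp (𝓕⁻ G : CL2), ?_⟩
  have e : toComplex (Complex.reCLM.compLp (𝓕⁻ G : CL2)) = 𝓕⁻ G := by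
    refine Lp.ext ?_
    filter_upwards [coeFn_toComplex (Complex.reCLM.compLp (𝓕⁻ G : CL2)),
      Complex.reCLM.coeFn_compLp (𝓕⁻ G : CL2), fourierInv_ae_eq _ hG] with p k1 k2 k3
    rw [k1, k2, k3]
    have h2 : (fun q => (starRingEnd ℂ) (G (-q))) =ᵐ[volume] G := by
      filter_upwards [h] with q hq
      rw [hq, Complex.conj_conj]
    have h3 := conj_fourierInv G p
    rw [Real.fourierInv_congr_ae h2] at h3
    exact Complex.conj_eq_iff_re.1 h3
  rw [fhat, e, FourierTransform.fourier_fourierInv_eq]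

theorem symb_neg (a b : ℕ) (p : Plane) : symb a b (-p) = (starRingEnd ℂ) (symb a b p) := by
  simp [symb, map_ofNat]

/-! ### Squared norms of derivatives as weighted integrals -/

/-- This direction needs no regularity: without a weak derivative the infimum is over the empty set
and equals $\infty$. -/
theorem lintegral_symb_le_derivSq (a b : ℕ) (f : L2) :
    ∫⁻ p, ‖symb a b p * fhat f p‖ₑ ^ 2 ≤ derivSq a b f := by
  refine le_iInf₂ fun g hg => ?_
  rw [hasDerivL2_iff] at hg
  rw [← enorm_fhat g, enorm_sq_eq_lintegral]
  refine le_of_eq (lintegral_congr_ae ?_)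
  filter_upwards [hg] with p hp
  rw [hp]

/-- For the reverse bound a real $L^2$ weak derivative must be exhibited; it is the function whose
transform is the symbol times $\hat f$, real by Hermitian symmetry. -/
theorem derivSq_eq {a b : ℕ} {f : L2} (h0 : Integrable (fhat f) volume)
    (h1 : Integrable (fun p => symb a b p * fhat f p) volume)
    (h2 : MemLp (fun p => symb a b p * fhat f p) 2 volume) :
    derivSq a b f = ∫⁻ p, ‖symb a b p * fhat f p‖ₑ ^ 2 := by
  refine le_antisymm ?_ (lintegral_symb_le_derivSq a b f)
  obtain ⟨g, hg⟩ := exists_fhat_eq (G := h2.toLp _) (h1.congr h2.coeFn_toLp.symm) (by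
    have hn := (Measure.measurePreserving_neg (volume : Measure Plane)).quasiMeasurePreserving.ae
      h2.coeFn_toLp
    filter_upwards [h2.coeFn_toLp, hn, fhat_neg h0] with p k1 k2 k3
    rw [k2, k1, k3, symb_neg, map_mul])
  have hD : HasDerivL2 a b f g := by
    rw [hasDerivL2_iff, hg]
    exact h2.coeFn_toLp
  refine (iInf₂_le g hD).trans (le_of_eq ?_)
  rw [← enorm_fhat g, hg, enorm_sq_eq_lintegral]
  refine lintegral_congr_ae ?_
  filter_upwards [h2.coeFn_toLp] with p hp
  rw [hp]

/-! ### Symbol inequalities -/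

section Symbols

/-- The weight of the spatial norm. -/
def wS (N : ℕ) (x y : ℝ) : ℝ := 1 + (|x| + |y|) ^ N * (|x| ^ 3 + y ^ 2)

/-- The isotropic weight `1 + |x| + |y|`. -/
def wR (x y : ℝ) : ℝ := 1 + |x| + |y|

theorem one_le_wR (x y : ℝ) : 1 ≤ wR x y := by
  unfold wR; linarith [abs_nonneg x, abs_nonneg y]

theorem one_le_wS (N : ℕ) (x y : ℝ) : 1 ≤ wS N x y := by
  unfold wS
  have : 0 ≤ (|x| + |y|) ^ N * (|x| ^ 3 + y ^ 2) := by positivity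
  linarith

theorem wR_pow_mul_le (N : ℕ) (x y : ℝ) :
    wR x y ^ N * (1 + |x| ^ 3 + y ^ 2) ≤ 9 * 2 ^ N * wS N x y := by
  have hx := abs_nonneg x
  have hy := abs_nonneg y
  rw [← sq_abs y]
  unfold wS wR
  rw [← sq_abs y]
  generalize |x| = x at *
  generalize |y| = y at *
  rcases le_total (x + y) 1 with h | h
  · have h1 : (1 + x + y) ^ N ≤ 2 ^ N := pow_le_pow_left₀ (by linarith) (by linarith) N
    have h2 : 1 + x ^ 3 + y ^ 2 ≤ 9 := by
      have := pow_le_one₀ (n := 3) hx (by linarith)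
      have := pow_le_one₀ (n := 2) hy (by linarith)
      linarith
    have h3 : 0 ≤ (x + y) ^ N * (x ^ 3 + y ^ 2) := by positivity
    calc (1 + x + y) ^ N * (1 + x ^ 3 + y ^ 2) ≤ 2 ^ N * 9 := by gcongr
      _ ≤ 9 * 2 ^ N * (1 + (x + y) ^ N * (x ^ 3 + y ^ 2)) := by
        have : (0 : ℝ) ≤ 9 * 2 ^ N := by positivity
        nlinarith
  · have h1 : (1 + x + y) ^ N ≤ 2 ^ N * (x + y) ^ N := by
      rw [← mul_pow]
      exact pow_le_pow_left₀ (by linarith) (by linarith) N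
    -- As $x+y\ge1$, one of $x,y$ is at least $\frac12$, and the worse case is $x^3\ge\frac18$. This
    -- is the origin of the constant $9=1+8$.
    have h2 : 1 ≤ 8 * (x ^ 3 + y ^ 2) := by
      rcases le_total (1 / 2) x with hh | hh
      · have : (1 / 2 : ℝ) ^ 3 ≤ x ^ 3 := pow_le_pow_left₀ (by norm_num) hh 3
        nlinarith
      · have : (1 / 2 : ℝ) ^ 2 ≤ y ^ 2 := pow_le_pow_left₀ (by norm_num) (by linarith) 2
        have : 0 ≤ x ^ 3 := by positivity
        linarith
    calc (1 + x + y) ^ N * (1 + x ^ 3 + y ^ 2)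
        ≤ (2 ^ N * (x + y) ^ N) * (9 * (x ^ 3 + y ^ 2)) := by gcongr; linarith
      _ ≤ 9 * 2 ^ N * (1 + (x + y) ^ N * (x ^ 3 + y ^ 2)) := by
        have : (0 : ℝ) ≤ 9 * 2 ^ N := by positivity
        nlinarith

/-- In the $y$ direction `wS` has only degree $N+2$, so this is the most it gives isotropically. A
term of higher degree must keep an explicit factor $|x|^3$. -/
theorem wR_pow_add_two_le (N : ℕ) (x y : ℝ) :
    wR x y ^ (N + 2) ≤ 54 * 2 ^ N * wS N x y := by
  have h1 : wR x y ^ 2 ≤ 6 * (1 + |x| ^ 3 + y ^ 2) := by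
    rw [← sq_abs y]
    unfold wR
    have hx := abs_nonneg x
    have hy := abs_nonneg y
    generalize |x| = x at *
    generalize |y| = y at *
    have : x ^ 2 ≤ 1 + x ^ 3 := by
      rcases le_total x 1 with h | h
      · have : 0 ≤ x ^ 3 := by positivity
        nlinarith
      · nlinarith [sq_nonneg x]
    nlinarith [sq_nonneg (1 - x), sq_nonneg (1 - y), sq_nonneg (x - y)]
  have h2 := wR_pow_mul_le N x y
  have h3 : 0 ≤ wR x y ^ N := pow_nonneg (zero_le_one.trans (one_le_wR x y)) N
  calc wR x y ^ (N + 2) = wR x y ^ N * wR x y ^ 2 := by ring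
    _ ≤ wR x y ^ N * (6 * (1 + |x| ^ 3 + y ^ 2)) := by gcongr
    _ ≤ _ := by linarith

theorem abs_pow_sub_pow_le_add (x a : ℝ) (i : ℕ) {t : ℝ} (ht : |a| + |x| ≤ t) :
    |(a + x) ^ i - x ^ i| ≤ |a| * i * t ^ (i - 1) := by
  refine (abs_pow_sub_pow_le _ _ _).trans ?_
  have : max |a + x| |x| ≤ t :=
    max_le ((abs_add_le _ _).trans ht) ((le_add_of_nonneg_left (abs_nonneg a)).trans ht)
  rw [add_sub_cancel_right]
  gcongr

theorem abs_monomial_le (a b x y : ℝ) (i k : ℕ) :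
    |(a + x) ^ i * (b + y) ^ k| ≤ ((|a| + |b|) + (|x| + |y|)) ^ (i + k) := by
  rw [abs_mul, abs_pow, abs_pow, pow_add]
  have hb := abs_nonneg b
  have hy := abs_nonneg y
  have ha := abs_nonneg a
  have hx := abs_nonneg x
  have h1 := abs_add_le a x
  have h2 := abs_add_le b y
  gcongr <;> linarith

/-- Telescoping over the two factors: every term of the difference carries at least one power of
$(a,b)$. That power is the gain of the commutator. -/
theorem abs_monomial_sub_le (a b x y : ℝ) (i k : ℕ) :
    |(a + x) ^ i * (b + y) ^ k - x ^ i * y ^ k| ≤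
      (i + k : ℕ) * (|a| + |b|) * ((|a| + |b|) + (|x| + |y|)) ^ (i + k - 1) := by
  set t := (|a| + |b|) + (|x| + |y|) with ht
  have hb := abs_nonneg b
  have hy := abs_nonneg y
  have ha := abs_nonneg a
  have hx := abs_nonneg x
  have ht0 : 0 ≤ t := by positivity
  have h1 := abs_pow_sub_pow_le_add x a i (t := t) (by linarith)
  have h2 := abs_pow_sub_pow_le_add y b k (t := t) (by linarith)
  have h3 : |b + y| ^ k ≤ t ^ k :=
    pow_le_pow_left₀ (abs_nonneg _) ((abs_add_le b y).trans (by linarith)) k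
  have h4 : |x| ^ i ≤ t ^ i := pow_le_pow_left₀ (abs_nonneg _) (by linarith) i
  have e : (a + x) ^ i * (b + y) ^ k - x ^ i * y ^ k =
      ((a + x) ^ i - x ^ i) * (b + y) ^ k + x ^ i * ((b + y) ^ k - y ^ k) := by ring
  rw [e]
  refine (abs_add_le _ _).trans ?_
  rw [abs_mul, abs_mul, abs_pow, abs_pow x]
  have h5 : |a| * i * t ^ (i - 1) * t ^ k = |a| * i * t ^ (i + k - 1) := by
    rcases i with _ | i
    · simp
    · rw [mul_assoc, ← pow_add]; congr 2; omega
  have h6 : t ^ i * (|b| * k * t ^ (k - 1)) = |b| * k * t ^ (i + k - 1) := by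
    rcases k with _ | k
    · simp
    · rw [mul_comm, mul_assoc, ← pow_add]; congr 2; omega
  calc |(a + x) ^ i - x ^ i| * |b + y| ^ k + |x| ^ i * |(b + y) ^ k - y ^ k|
      ≤ |a| * i * t ^ (i - 1) * t ^ k + t ^ i * (|b| * k * t ^ (k - 1)) := by gcongr
    _ = (|a| * i + |b| * k) * t ^ (i + k - 1) := by rw [h5, h6]; ring
    _ ≤ (i + k : ℕ) * (|a| + |b|) * t ^ (i + k - 1) := by
      gcongr
      push_cast
      nlinarith [mul_nonneg ha (Nat.cast_nonneg (α := ℝ) k), mul_nonneg hb (Nat.cast_nonneg (α := ℝ) i)]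

theorem add_pow_le_two_pow (s r : ℝ) (hs : 0 ≤ s) (hr : 0 ≤ r) (n : ℕ) :
    (s + r) ^ n ≤ 2 ^ n * (s ^ n + r ^ n) := by
  rcases le_total s r with h | h
  · calc (s + r) ^ n ≤ (2 * r) ^ n := pow_le_pow_left₀ (by linarith) (by linarith) n
      _ = 2 ^ n * r ^ n := mul_pow _ _ _
      _ ≤ _ := by gcongr; linarith [pow_nonneg hs n]
  · calc (s + r) ^ n ≤ (2 * s) ^ n := pow_le_pow_left₀ (by linarith) (by linarith) n
      _ = 2 ^ n * s ^ n := mul_pow _ _ _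
      _ ≤ _ := by gcongr; linarith [pow_nonneg hr n]

/-- Geometric interpolation between the extreme splittings of a total degree. -/
theorem mul_pow_le_extremes {S R : ℝ} (hS : 0 ≤ S) (hR : 0 ≤ R) {p q n : ℕ}
    (h : p + q = n + 4) (hp : 2 ≤ p) (hq : 2 ≤ q) :
    S ^ p * R ^ q ≤ S ^ 2 * R ^ (n + 2) + S ^ (n + 2) * R ^ 2 := by
  have h1 : 0 ≤ S ^ 2 * R ^ (n + 2) := by positivity
  have h2 : 0 ≤ S ^ (n + 2) * R ^ 2 := by positivity
  rcases le_total S R with h' | h'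
  · have : S ^ p * R ^ q ≤ S ^ 2 * R ^ (n + 2) := by
      have e1 : S ^ p = S ^ 2 * S ^ (p - 2) := by rw [← pow_add]; congr 1; omega
      have e2 : R ^ (n + 2) = R ^ (p - 2) * R ^ q := by rw [← pow_add]; congr 1; omega
      rw [e1, e2, mul_assoc]
      gcongr
    linarith
  · have : S ^ p * R ^ q ≤ S ^ (n + 2) * R ^ 2 := by
      have e1 : R ^ q = R ^ (q - 2) * R ^ 2 := by rw [← pow_add]; congr 1; omega
      have e2 : S ^ (n + 2) = S ^ p * S ^ (q - 2) := by rw [← pow_add]; congr 1; omega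
      rw [e1, e2, ← mul_assoc]
      gcongr
    linarith

/-- The symmetric majorant of the commutator symbols. -/
def wC (N : ℕ) (a b x y : ℝ) : ℝ :=
  wR a b ^ (N + 1) * wS N x y + wS N a b * wR x y ^ (N + 1)

theorem wC_nonneg (N : ℕ) (a b x y : ℝ) : 0 ≤ wC N a b x y := by
  have h1 := zero_le_one.trans (one_le_wR a b)
  have h2 := zero_le_one.trans (one_le_wR x y)
  have h3 := zero_le_one.trans (one_le_wS N a b)
  have h4 := zero_le_one.trans (one_le_wS N x y)
  unfold wC; positivity

/-- The factor of degree $N+2$ is absorbed by `wS`, and the other must fit into degree $N+1$. Hence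
$j=2$ is available only for $N\ge1$. -/
theorem wR_pow_mul_le_wC (N j : ℕ) (hj : j ≤ N + 1) (a b x y : ℝ) :
    wR a b ^ j * wR x y ^ (N + 2) + wR a b ^ (N + 2) * wR x y ^ j ≤
      54 * 2 ^ N * wC N a b x y := by
  have h1 := one_le_wR a b
  have h2 := one_le_wR x y
  have h3 := wR_pow_add_two_le N a b
  have h4 := wR_pow_add_two_le N x y
  have h5 : wR a b ^ j ≤ wR a b ^ (N + 1) := pow_le_pow_right₀ h1 hj
  have h6 : wR x y ^ j ≤ wR x y ^ (N + 1) := pow_le_pow_right₀ h2 hj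
  have h7 := zero_le_one.trans (one_le_wS N a b)
  have h8 := zero_le_one.trans (one_le_wS N x y)
  calc wR a b ^ j * wR x y ^ (N + 2) + wR a b ^ (N + 2) * wR x y ^ j
      ≤ wR a b ^ (N + 1) * (54 * 2 ^ N * wS N x y) +
        (54 * 2 ^ N * wS N a b) * wR x y ^ (N + 1) := by
        have : 0 ≤ wR x y := by linarith
        have : 0 ≤ wR a b := by linarith
        gcongr
    _ = _ := by unfold wC; ring

/-- The total degree is $N+3$, with at least one power of $(a,b)$ from the difference and one of
$(x,y)$ from $|x|$, so the extreme terms are $SR^{N+2}$ and $S^{N+2}R$, with $S,R$ the values of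
`wR`. -/
theorem commutator_y_le (N i k : ℕ) (h : i + k = N) :
    ∃ C : ℝ, 0 ≤ C ∧ ∀ a b x y : ℝ,
      |(a + x) ^ i * (b + y) ^ (k + 2) - x ^ i * y ^ (k + 2)| * |x| ≤ C * wC N a b x y := by
  refine ⟨(N + 2 : ℕ) * (2 ^ (N + 1) * (54 * 2 ^ N)), by positivity, fun a b x y => ?_⟩
  have h1 := abs_monomial_sub_le a b x y i (k + 2)
  rw [show i + (k + 2) = N + 2 by omega, show N + 2 - 1 = N + 1 by omega] at h1
  have ha := abs_nonneg a
  have hb := abs_nonneg b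
  have hx := abs_nonneg x
  have hy := abs_nonneg y
  have h2 := add_pow_le_two_pow (wR a b) (wR x y) (by linarith [one_le_wR a b])
    (by linarith [one_le_wR x y]) (N + 1)
  have hRa := one_le_wR a b
  have hRx := one_le_wR x y
  have hCw := wR_pow_mul_le_wC N 1 (by omega) a b x y
  have e1 : |a| + |b| ≤ wR a b := by unfold wR; linarith
  have e2 : |x| + |y| ≤ wR x y := by unfold wR; linarith
  have e3 : |x| ≤ wR x y := by linarith
  calc |(a + x) ^ i * (b + y) ^ (k + 2) - x ^ i * y ^ (k + 2)| * |x|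
      ≤ ((N + 2 : ℕ) * (|a| + |b|) * ((|a| + |b|) + (|x| + |y|)) ^ (N + 1)) * |x| := by gcongr
    _ ≤ ((N + 2 : ℕ) * wR a b * (wR a b + wR x y) ^ (N + 1)) * wR x y := by gcongr
    _ ≤ ((N + 2 : ℕ) * wR a b * (2 ^ (N + 1) * (wR a b ^ (N + 1) + wR x y ^ (N + 1)))) *
        wR x y := by
        have : 0 ≤ wR x y := by linarith
        have : 0 ≤ wR a b := by linarith
        gcongr
    _ = (N + 2 : ℕ) * 2 ^ (N + 1) * (wR a b ^ 1 * wR x y ^ (N + 2) + wR a b ^ (N + 2) * wR x y ^ 1) := by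
        ring
    _ ≤ (N + 2 : ℕ) * 2 ^ (N + 1) * (54 * 2 ^ N * wC N a b x y) := by gcongr
    _ = _ := by ring

theorem commutator_cube_le (a x : ℝ) :
    |((a + x) ^ 3 - x ^ 3) * x| ≤ 3 * (|a| * |x| ^ 3) + 3 * (|a| ^ 2 * |x| ^ 2) + |a| ^ 3 * |x| := by
  have e : ((a + x) ^ 3 - x ^ 3) * x = 3 * (a * x ^ 3) + 3 * (a ^ 2 * x ^ 2) + a ^ 3 * x := by ring
  rw [e]
  refine (abs_add_three _ _ _).trans (le_of_eq ?_)
  simp only [abs_mul, abs_pow]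
  norm_num

theorem commutator_x_zero_le (a b x y : ℝ) :
    |(a + x) ^ 3 - x ^ 3| * |x| ≤ 6 * wC 0 a b x y := by
  rw [← abs_mul]
  refine (commutator_cube_le a x).trans ?_
  have ha := abs_nonneg a
  have hx := abs_nonneg x
  have hb := abs_nonneg b
  have hy := abs_nonneg y
  -- For $N=0$ the weight `wR` occurs only to the first power and cannot absorb a square, so the
  -- balanced term is interpolated between its neighbours.
  have h1 : |a| ^ 2 * |x| ^ 2 ≤ |a| * |x| ^ 3 + |a| ^ 3 * |x| := by
    have : 0 ≤ |a| * |x| * (|a| - |x|) ^ 2 := by positivity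
    nlinarith [mul_nonneg ha hx]
  have h2 : |a| * |x| ^ 3 ≤ wR a b ^ (0 + 1) * wS 0 x y := by
    unfold wR wS
    rw [zero_add, pow_one, pow_zero, one_mul]
    have : 0 ≤ |x| ^ 3 := by positivity
    gcongr
    · linarith
    · linarith [sq_nonneg y]
  have h3 : |a| ^ 3 * |x| ≤ wS 0 a b * wR x y ^ (0 + 1) := by
    unfold wR wS
    rw [zero_add, pow_one, pow_zero, one_mul]
    have : 0 ≤ |a| ^ 3 := by positivity
    gcongr
    · linarith [sq_nonneg b]
    · linarith
  have h4 : 0 ≤ |a| ^ 3 * |x| := by positivity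
  have h5 : 0 ≤ |a| * |x| ^ 3 := by positivity
  unfold wC
  linarith

/-- The total degree is now $N+4$. Terms with at least two powers on each side follow from
interpolation and the isotropic bound. A term with a single power of $(a,b)$ has degree $N+3$ in
$(x,y)$, too high for that bound, but it retains a factor $|x|^3$ because the derivative falling on
$v$ is in $x$. Symmetrically, a single power of $x$ comes with $|a|^3$. -/
theorem commutator_x_le (N i k : ℕ) (h : i + k = N) :
    ∃ C : ℝ, 0 ≤ C ∧ ∀ a b x y : ℝ,
      |(a + x) ^ (i + 3) * (b + y) ^ k - x ^ (i + 3) * y ^ k| * |x| ≤ C * wC N a b x y := by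
  rcases N with _ | m
  · obtain ⟨rfl, rfl⟩ : i = 0 ∧ k = 0 := by omega
    exact ⟨6, by norm_num, fun a b x y => by simpa using commutator_x_zero_le a b x y⟩
  set N := m + 1 with hN
  set D : ℝ := 54 * 2 ^ N with hD
  refine ⟨N * 2 ^ m * (D + 1) + 2 ^ N * (3 * (D + 1) + 3 * D + (D + 1)), by positivity,
    fun a b x y => ?_⟩
  have ha := abs_nonneg a
  have hb := abs_nonneg b
  have hx := abs_nonneg x
  have hy := abs_nonneg y
  set s := |a| + |b| with hs
  set r := |x| + |y| with hr
  have hs0 : 0 ≤ s := by positivity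
  have hr0 : 0 ≤ r := by positivity
  set S := wR a b with hS
  set R := wR x y with hR
  have hS1 : 1 ≤ S := one_le_wR a b
  have hR1 : 1 ≤ R := one_le_wR x y
  have hS0 : 0 ≤ S := by linarith
  have hR0 : 0 ≤ R := by linarith
  have hsS : s ≤ S := by simp only [hS, wR]; linarith
  have hrR : r ≤ R := by simp only [hR, wR]; linarith
  have haS : |a| ≤ S := by linarith
  have hxR : |x| ≤ R := by linarith
  have hxr : |x| ≤ r := by linarith
  set Ct := wC N a b x y with hCt
  have hCt0 : 0 ≤ Ct := wC_nonneg _ _ _ _ _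
  have hD1 : 1 ≤ D := by
    have : (1 : ℝ) ≤ 2 ^ N := one_le_pow₀ (by norm_num)
    linarith
  -- Balanced terms, where the isotropic bound suffices; `left` and `right` below treat a single
  -- power on one side.
  have mid : ∀ p q : ℕ, p + q = N + 4 → 2 ≤ p → 2 ≤ q → S ^ p * R ^ q ≤ D * Ct :=
    fun p q h1 h2 h3 => (mul_pow_le_extremes hS0 hR0 h1 h2 h3).trans
      (wR_pow_mul_le_wC N 2 (by omega) a b x y)
  have hwz := zero_le_one.trans (one_le_wS N a b)
  have hwq := zero_le_one.trans (one_le_wS N x y)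
  have left : ∀ u : ℝ, 0 ≤ u → u ≤ S → u * (|x| ^ 3 * r ^ N) ≤ Ct := fun u hu hu' => by
    have h1 : |x| ^ 3 * r ^ N ≤ wS N x y := by
      simp only [wS, ← hr]
      have : 0 ≤ r ^ N * y ^ 2 := by positivity
      nlinarith
    have h2 : S ≤ S ^ (N + 1) := le_self_pow₀ hS1 (by omega)
    have h3 : 0 ≤ wS N a b * R ^ (N + 1) := by positivity
    calc u * (|x| ^ 3 * r ^ N) ≤ S ^ (N + 1) * wS N x y := by gcongr; exact hu'.trans h2
      _ ≤ Ct := by simp only [hCt, wC]; linarith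
  have right : |a| ^ 3 * |x| * s ^ N ≤ Ct := by
    have h1 : |a| ^ 3 * s ^ N ≤ wS N a b := by
      simp only [wS, ← hs]
      have : 0 ≤ s ^ N * b ^ 2 := by positivity
      nlinarith
    have h2 : R ≤ R ^ (N + 1) := le_self_pow₀ hR1 (by omega)
    have h3 : 0 ≤ S ^ (N + 1) * wS N x y := by positivity
    calc |a| ^ 3 * |x| * s ^ N = (|a| ^ 3 * s ^ N) * |x| := by ring
      _ ≤ wS N a b * R ^ (N + 1) := by gcongr; exact hxR.trans h2
      _ ≤ Ct := by simp only [hCt, wC]; linarith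
  have first : |x| ^ 4 * (s * (s + r) ^ m) ≤ 2 ^ m * (D + 1) * Ct := by
    have hl : |x| ^ 4 * s * r ^ m ≤ Ct := by
      calc |x| ^ 4 * s * r ^ m = s * (|x| ^ 3 * (|x| * r ^ m)) := by ring
        _ ≤ s * (|x| ^ 3 * (r * r ^ m)) := by gcongr
        _ = s * (|x| ^ 3 * r ^ N) := by rw [hN, pow_succ]; ring
        _ ≤ Ct := left s hs0 hsS
    -- For $N=1$ the difference of monomials is linear in $(a,b)$, so only the unbalanced term
    -- occurs; for $N\ge2$ the term $s^N|x|^4$ is balanced.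
    rcases m with _ | m
    · rw [pow_zero, mul_one] at hl ⊢
      rw [pow_zero, one_mul]
      nlinarith
    · have hm : |x| ^ 4 * (s * s ^ (m + 1)) ≤ D * Ct := by
        calc |x| ^ 4 * (s * s ^ (m + 1)) = s ^ N * |x| ^ 4 := by rw [hN]; ring
          _ ≤ S ^ N * R ^ 4 := by gcongr
          _ ≤ D * Ct := mid N 4 rfl (by omega) (by omega)
      have := add_pow_le_two_pow s r hs0 hr0 (m + 1)
      calc |x| ^ 4 * (s * (s + r) ^ (m + 1))
          ≤ |x| ^ 4 * (s * (2 ^ (m + 1) * (s ^ (m + 1) + r ^ (m + 1)))) := by gcongr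
        _ = 2 ^ (m + 1) * (|x| ^ 4 * (s * s ^ (m + 1)) + |x| ^ 4 * s * r ^ (m + 1)) := by ring
        _ ≤ 2 ^ (m + 1) * (D * Ct + Ct) := by gcongr
        _ = _ := by ring
  have g1 : |a| * |x| ^ 3 * (s ^ N + r ^ N) ≤ (D + 1) * Ct := by
    have h1 : |a| * |x| ^ 3 * s ^ N ≤ D * Ct := by
      calc |a| * |x| ^ 3 * s ^ N ≤ S * R ^ 3 * S ^ N := by gcongr
        _ = S ^ (N + 1) * R ^ 3 := by ring
        _ ≤ D * Ct := mid (N + 1) 3 (by omega) (by omega) (by omega)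
    have h2 := left |a| ha haS
    calc |a| * |x| ^ 3 * (s ^ N + r ^ N) = |a| * |x| ^ 3 * s ^ N + |a| * (|x| ^ 3 * r ^ N) := by ring
      _ ≤ D * Ct + Ct := by gcongr
      _ = _ := by ring
  have g2 : |a| ^ 2 * |x| ^ 2 * (s ^ N + r ^ N) ≤ D * Ct := by
    calc |a| ^ 2 * |x| ^ 2 * (s ^ N + r ^ N) ≤ S ^ 2 * R ^ 2 * (S ^ N + R ^ N) := by gcongr
      _ = S ^ 2 * R ^ (N + 2) + S ^ (N + 2) * R ^ 2 := by ring
      _ ≤ D * Ct := wR_pow_mul_le_wC N 2 (by omega) a b x y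
  have g3 : |a| ^ 3 * |x| * (s ^ N + r ^ N) ≤ (D + 1) * Ct := by
    have h1 : |a| ^ 3 * |x| * r ^ N ≤ D * Ct := by
      calc |a| ^ 3 * |x| * r ^ N ≤ S ^ 3 * R * R ^ N := by gcongr
        _ = S ^ 3 * R ^ (N + 1) := by ring
        _ ≤ D * Ct := mid 3 (N + 1) (by omega) (by omega) (by omega)
    calc |a| ^ 3 * |x| * (s ^ N + r ^ N) = |a| ^ 3 * |x| * s ^ N + |a| ^ 3 * |x| * r ^ N := by ring
      _ ≤ Ct + D * Ct := by gcongr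
      _ = _ := by ring
  have second : (3 * (|a| * |x| ^ 3) + 3 * (|a| ^ 2 * |x| ^ 2) + |a| ^ 3 * |x|) * (s + r) ^ N ≤
      2 ^ N * (3 * (D + 1) + 3 * D + (D + 1)) * Ct := by
    have := add_pow_le_two_pow s r hs0 hr0 N
    calc (3 * (|a| * |x| ^ 3) + 3 * (|a| ^ 2 * |x| ^ 2) + |a| ^ 3 * |x|) * (s + r) ^ N
        ≤ (3 * (|a| * |x| ^ 3) + 3 * (|a| ^ 2 * |x| ^ 2) + |a| ^ 3 * |x|) *
          (2 ^ N * (s ^ N + r ^ N)) := by gcongr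
      _ = 2 ^ N * (3 * (|a| * |x| ^ 3 * (s ^ N + r ^ N)) +
          3 * (|a| ^ 2 * |x| ^ 2 * (s ^ N + r ^ N)) + |a| ^ 3 * |x| * (s ^ N + r ^ N)) := by ring
      _ ≤ 2 ^ N * (3 * ((D + 1) * Ct) + 3 * (D * Ct) + (D + 1) * Ct) := by gcongr
      _ = _ := by ring
  -- The difference falls either on the monomial of degree $N$, keeping $x^4$, or on the cube, which
  -- is expanded exactly so that the factors $|x|^3$ and $|a|^3$ stay visible.
  have e : ((a + x) ^ (i + 3) * (b + y) ^ k - x ^ (i + 3) * y ^ k) * x =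
      x ^ 4 * ((a + x) ^ i * (b + y) ^ k - x ^ i * y ^ k) +
      (((a + x) ^ 3 - x ^ 3) * x) * ((a + x) ^ i * (b + y) ^ k) := by ring
  rw [← abs_mul, e]
  have m1 := abs_monomial_sub_le a b x y i k
  have m2 := abs_monomial_le a b x y i k
  rw [h] at m1 m2
  simp only [← hs, ← hr] at m1 m2
  refine (abs_add_le _ _).trans ?_
  rw [abs_mul, abs_mul _ ((a + x) ^ i * (b + y) ^ k), abs_pow x]
  have hNm : N - 1 = m := by omega
  rw [hNm] at m1
  calc |x| ^ 4 * |(a + x) ^ i * (b + y) ^ k - x ^ i * y ^ k| +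
        |((a + x) ^ 3 - x ^ 3) * x| * |(a + x) ^ i * (b + y) ^ k|
      ≤ |x| ^ 4 * (N * s * (s + r) ^ m) +
        (3 * (|a| * |x| ^ 3) + 3 * (|a| ^ 2 * |x| ^ 2) + |a| ^ 3 * |x|) * (s + r) ^ N := by
        gcongr
        exact commutator_cube_le a x
    _ = N * (|x| ^ 4 * (s * (s + r) ^ m)) +
        (3 * (|a| * |x| ^ 3) + 3 * (|a| ^ 2 * |x| ^ 2) + |a| ^ 3 * |x|) * (s + r) ^ N := by ring
    _ ≤ N * (2 ^ m * (D + 1) * Ct) + 2 ^ N * (3 * (D + 1) + 3 * D + (D + 1)) * Ct := by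
        gcongr
    _ = _ := by ring

theorem wR_add_le (a b x y : ℝ) :
    (|a| + |b|) + (|x| + |y|) ≤ 2 * (wR a b * wR x y) := by
  have h1 := one_le_wR a b
  have h2 := one_le_wR x y
  have e1 : |a| + |b| ≤ wR a b := by unfold wR; linarith
  have e2 : |x| + |y| ≤ wR x y := by unfold wR; linarith
  nlinarith

/-- Here $(x,y)$ belongs to $v_t$ and may carry only $N$ powers: the power gained from the
difference pays for $|x|$. The surplus goes to the coefficient, through the crude bound of a sum by
twice the product of the weights. -/
theorem commutator_time_le (N i k : ℕ) (h : i + k ≤ N) (a b x y : ℝ) :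
    |(a + x) ^ i * (b + y) ^ k - x ^ i * y ^ k| * |x| ≤
      N * 2 ^ N * (wR a b ^ (N + 1) * wR x y ^ N) := by
  have hS1 := one_le_wR a b
  have hR1 := one_le_wR x y
  have hS0 : 0 ≤ wR a b := by linarith
  have hR0 : 0 ≤ wR x y := by linarith
  have ha := abs_nonneg a
  have hb := abs_nonneg b
  have hx := abs_nonneg x
  have hy := abs_nonneg y
  have m1 := abs_monomial_sub_le a b x y i k
  generalize hn : i + k = n at *
  rcases n with _ | n
  · have : |(a + x) ^ i * (b + y) ^ k - x ^ i * y ^ k| ≤ 0 := by simpa using m1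
    have h0 : |(a + x) ^ i * (b + y) ^ k - x ^ i * y ^ k| = 0 := le_antisymm this (abs_nonneg _)
    rw [h0, zero_mul]
    positivity
  · simp only [Nat.add_sub_cancel] at m1
    have e1 : |a| + |b| ≤ wR a b := by unfold wR; linarith
    have e2 : |x| ≤ wR x y := by unfold wR; linarith
    calc |(a + x) ^ i * (b + y) ^ k - x ^ i * y ^ k| * |x|
        ≤ ((n + 1 : ℕ) * (|a| + |b|) * ((|a| + |b|) + (|x| + |y|)) ^ n) * |x| := by gcongr
      _ ≤ ((n + 1 : ℕ) * wR a b * (2 * (wR a b * wR x y)) ^ n) * wR x y := by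
          gcongr; exact wR_add_le a b x y
      _ = (n + 1 : ℕ) * 2 ^ n * (wR a b ^ (n + 1) * wR x y ^ (n + 1)) := by ring
      _ ≤ N * 2 ^ N * (wR a b ^ (N + 1) * wR x y ^ N) := by
          gcongr
          all_goals first | exact hS1 | exact hR1 | omega | norm_num

/-- For $w_tv_x$ no commutator is needed: $v$ has derivatives to spare, and $w_t$ takes only the $N$
powers it can afford. -/
theorem symbol_time_le (N i k : ℕ) (h : i + k ≤ N) (a b x y : ℝ) :
    |(a + x) ^ i * (b + y) ^ k| * |x| ≤ 2 ^ N * (wR a b ^ N * wR x y ^ (N + 1)) := by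
  have hS1 := one_le_wR a b
  have hR1 := one_le_wR x y
  have hx := abs_nonneg x
  have hy := abs_nonneg y
  have e2 : |x| ≤ wR x y := by unfold wR; linarith
  have h1 : 1 ≤ 2 * (wR a b * wR x y) := by nlinarith
  calc |(a + x) ^ i * (b + y) ^ k| * |x|
      ≤ ((|a| + |b|) + (|x| + |y|)) ^ (i + k) * wR x y := by
        gcongr; exact abs_monomial_le a b x y i k
    _ ≤ (2 * (wR a b * wR x y)) ^ N * wR x y := by
        gcongr
        exact (pow_le_pow_left₀ (by positivity) (wR_add_le a b x y) _).trans
          (pow_le_pow_right₀ h1 h)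
    _ = _ := by ring

end Symbols

/-! ### Weighted norms on the Fourier side -/

/-- The symbol of `-i ∂_x`. -/
noncomputable def cx (p : Plane) : ℝ := 2 * Real.pi * p 0

/-- The symbol of `-i ∂_y`. -/
noncomputable def cy (p : Plane) : ℝ := 2 * Real.pi * p 1

theorem continuous_cx : Continuous cx := by unfold cx; fun_prop

theorem continuous_cy : Continuous cy := by unfold cy; fun_prop

theorem cx_sub (p q : Plane) : cx (p - q) = cx p - cx q := by simp [cx]; ring

theorem cy_sub (p q : Plane) : cy (p - q) = cy p - cy q := by simp [cy]; ring

/-- The monomial `X^a Y^b`. -/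
noncomputable def mono (a b : ℕ) (p : Plane) : ℝ := cx p ^ a * cy p ^ b

theorem continuous_mono (a b : ℕ) : Continuous (mono a b) :=
  (continuous_cx.pow a).mul (continuous_cy.pow b)

theorem enorm_symb (a b : ℕ) (p : Plane) : ‖symb a b p‖ₑ = ‖mono a b p‖ₑ := by
  rw [← ofReal_norm, ← ofReal_norm]
  congr 1
  simp [symb, mono, cx, cy, abs_of_pos Real.pi_pos]

theorem enorm_real_mul (c : ℝ) (z : ℂ) : ‖(c : ℂ) * z‖ₑ = ‖c‖ₑ * ‖z‖ₑ := by
  rw [enorm_mul]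
  congr 1
  rw [← ofReal_norm, ← ofReal_norm, Complex.norm_real]

/-- With $K=1+|x|^3+y^2$ the quotient is at most a constant times `wR`$/K$, and `wR`$^2\le9K$ leaves
$1/K$. Since $|x|\le K^{1/3}$ and $|y|\le K^{1/2}$, splitting $K=K^{2/5}K^{3/5}$ gives the same
integrable exponent $\frac65>1$ in each variable. -/
theorem weight_sq_le (N : ℕ) (x y : ℝ) :
    (wR x y ^ (N + 1) / wS N x y) ^ 2 ≤
      (9 * 2 ^ N) ^ 2 * 54 * ((1 + |x|) ^ (-(6 / 5) : ℝ) * (1 + |y|) ^ (-(6 / 5) : ℝ)) := by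
  have hS := one_le_wS N x y
  have hR := one_le_wR x y
  set K := 1 + |x| ^ 3 + y ^ 2 with hK
  have hx := abs_nonneg x
  have hy := abs_nonneg y
  have hK1 : 1 ≤ K := by
    have : 0 ≤ |x| ^ 3 := by positivity
    have := sq_nonneg y
    linarith
  have hK0 : 0 < K := by linarith
  have h1 : wR x y ^ (N + 1) / wS N x y ≤ 9 * 2 ^ N * (wR x y / K) := by
    rw [div_le_iff₀ (by linarith)]
    have h2 := wR_pow_mul_le N x y
    rw [← hK] at h2
    calc wR x y ^ (N + 1) = wR x y / K * (wR x y ^ N * K) := by field_simp; ring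
      _ ≤ wR x y / K * (9 * 2 ^ N * wS N x y) := by gcongr
      _ = _ := by ring
  have hx3 : |x| ≤ K ^ (1 / 3 : ℝ) := by
    have : (|x| ^ (3 : ℕ)) ^ (1 / 3 : ℝ) ≤ K ^ (1 / 3 : ℝ) := by
      apply Real.rpow_le_rpow (by positivity) _ (by norm_num)
      have := sq_nonneg y
      linarith
    rwa [← Real.rpow_natCast, ← Real.rpow_mul hx, show ((3 : ℕ) : ℝ) * (1 / 3) = 1 by norm_num,
      Real.rpow_one] at this
  have hy2 : |y| ≤ K ^ (1 / 2 : ℝ) := by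
    have : (|y| ^ (2 : ℕ)) ^ (1 / 2 : ℝ) ≤ K ^ (1 / 2 : ℝ) := by
      apply Real.rpow_le_rpow (by positivity) _ (by norm_num)
      have : 0 ≤ |x| ^ 3 := by positivity
      rw [sq_abs]
      linarith
    rwa [← Real.rpow_natCast, ← Real.rpow_mul hy, show ((2 : ℕ) : ℝ) * (1 / 2) = 1 by norm_num,
      Real.rpow_one] at this
  have hk3 : 1 ≤ K ^ (1 / 3 : ℝ) := Real.one_le_rpow hK1 (by norm_num)
  have hk2 : 1 ≤ K ^ (1 / 2 : ℝ) := Real.one_le_rpow hK1 (by norm_num)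
  have hk32 : K ^ (1 / 3 : ℝ) ≤ K ^ (1 / 2 : ℝ) :=
    Real.rpow_le_rpow_of_exponent_le hK1 (by norm_num)
  have hRK : wR x y ^ 2 ≤ 9 * K := by
    have : wR x y ≤ 3 * K ^ (1 / 2 : ℝ) := by unfold wR; linarith
    calc wR x y ^ 2 ≤ (3 * K ^ (1 / 2 : ℝ)) ^ 2 := by gcongr
      _ = 9 * (K ^ (1 / 2 : ℝ)) ^ 2 := by ring
      _ = 9 * K := by
        rw [← Real.rpow_natCast, ← Real.rpow_mul hK0.le]
        norm_num
  have hX : (1 + |x|) ^ (6 / 5 : ℝ) ≤ 2 ^ (6 / 5 : ℝ) * K ^ (2 / 5 : ℝ) := by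
    have : (1 + |x|) ^ (6 / 5 : ℝ) ≤ (2 * K ^ (1 / 3 : ℝ)) ^ (6 / 5 : ℝ) :=
      Real.rpow_le_rpow (by positivity) (by linarith) (by norm_num)
    rwa [Real.mul_rpow (by norm_num) (by positivity), ← Real.rpow_mul hK0.le,
      show (1 / 3 : ℝ) * (6 / 5) = 2 / 5 by norm_num] at this
  have hY : (1 + |y|) ^ (6 / 5 : ℝ) ≤ 2 ^ (6 / 5 : ℝ) * K ^ (3 / 5 : ℝ) := by
    have : (1 + |y|) ^ (6 / 5 : ℝ) ≤ (2 * K ^ (1 / 2 : ℝ)) ^ (6 / 5 : ℝ) :=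
      Real.rpow_le_rpow (by positivity) (by linarith) (by norm_num)
    rwa [Real.mul_rpow (by norm_num) (by positivity), ← Real.rpow_mul hK0.le,
      show (1 / 2 : ℝ) * (6 / 5) = 3 / 5 by norm_num] at this
  have hXY : (1 + |x|) ^ (6 / 5 : ℝ) * (1 + |y|) ^ (6 / 5 : ℝ) ≤ 6 * K := by
    have h2 : (2 : ℝ) ^ (6 / 5 : ℝ) * 2 ^ (6 / 5 : ℝ) ≤ 6 := by
      rw [← Real.rpow_add (by norm_num)]
      have h3 : ((2 : ℝ) ^ (6 / 5 + 6 / 5 : ℝ)) ≤ 2 ^ (5 / 2 : ℝ) :=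
        Real.rpow_le_rpow_of_exponent_le (by norm_num) (by norm_num)
      have h4 : ((2 : ℝ) ^ (5 / 2 : ℝ)) ^ 2 = 32 := by
        rw [← Real.rpow_natCast, ← Real.rpow_mul (by norm_num)]
        norm_num
      have h5 : (0 : ℝ) ≤ 2 ^ (5 / 2 : ℝ) := by positivity
      nlinarith
    calc (1 + |x|) ^ (6 / 5 : ℝ) * (1 + |y|) ^ (6 / 5 : ℝ)
        ≤ (2 ^ (6 / 5 : ℝ) * K ^ (2 / 5 : ℝ)) * (2 ^ (6 / 5 : ℝ) * K ^ (3 / 5 : ℝ)) := by gcongr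
      _ = (2 ^ (6 / 5 : ℝ) * 2 ^ (6 / 5 : ℝ)) * (K ^ (2 / 5 : ℝ) * K ^ (3 / 5 : ℝ)) := by ring
      _ ≤ 6 * (K ^ (2 / 5 : ℝ) * K ^ (3 / 5 : ℝ)) := by gcongr
      _ = 6 * K := by rw [← Real.rpow_add hK0]; norm_num
  have hpos : 0 < (1 + |x|) ^ (6 / 5 : ℝ) * (1 + |y|) ^ (6 / 5 : ℝ) := by positivity
  have hfin : (wR x y / K) ^ 2 ≤
      54 * ((1 + |x|) ^ (-(6 / 5) : ℝ) * (1 + |y|) ^ (-(6 / 5) : ℝ)) := by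
    rw [Real.rpow_neg (by positivity), Real.rpow_neg (by positivity), ← mul_inv,
      ← div_eq_mul_inv, le_div_iff₀ hpos, div_pow, div_mul_eq_mul_div, div_le_iff₀ (by positivity)]
    calc wR x y ^ 2 * ((1 + |x|) ^ (6 / 5 : ℝ) * (1 + |y|) ^ (6 / 5 : ℝ))
        ≤ 9 * K * (6 * K) := by gcongr
      _ = 54 * K ^ 2 := by ring
  have h0 : 0 ≤ wR x y ^ (N + 1) / wS N x y := by
    have : 0 ≤ wR x y := by linarith
    have : 0 ≤ wS N x y := by linarith
    positivity
  calc (wR x y ^ (N + 1) / wS N x y) ^ 2 ≤ (9 * 2 ^ N * (wR x y / K)) ^ 2 := by gcongr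
    _ = (9 * 2 ^ N) ^ 2 * (wR x y / K) ^ 2 := by ring
    _ ≤ (9 * 2 ^ N) ^ 2 * (54 * ((1 + |x|) ^ (-(6 / 5) : ℝ) * (1 + |y|) ^ (-(6 / 5) : ℝ))) := by
      gcongr
    _ = _ := by ring

theorem integrable_japanese_prod :
    Integrable (fun p : Plane => (1 + |p 0|) ^ (-(6 / 5) : ℝ) * (1 + |p 1|) ^ (-(6 / 5) : ℝ))
      volume := by
  have h1 : Integrable (fun x : ℝ => (1 + |x|) ^ (-(6 / 5) : ℝ)) volume := by
    have := integrable_one_add_norm (E := ℝ) (μ := volume) (r := 6 / 5) (by norm_num)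
    simpa using this
  have h2 := Integrable.fintype_prod (ι := Fin 2) (𝕜 := ℝ) (μ := fun _ => (volume : Measure ℝ))
    (f := fun _ x => (1 + |x|) ^ (-(6 / 5) : ℝ)) (fun _ => h1)
  have h3 := (EuclideanSpace.volume_preserving_symm_measurableEquiv_toLp (Fin 2)).integrable_comp_emb
    (MeasurableEquiv.measurableEmbedding _) |>.2 h2
  simpa [Function.comp_def, Fin.prod_univ_two] using h3

theorem continuous_wR : Continuous fun p : Plane => wR (cx p) (cy p) := by
  have h1 := continuous_cx
  have h2 := continuous_cy
  unfold wR
  fun_prop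

theorem continuous_wS (N : ℕ) : Continuous fun p : Plane => wS N (cx p) (cy p) := by
  have h1 := continuous_cx
  have h2 := continuous_cy
  unfold wS
  fun_prop

/-- The isotropic weight as an extended nonnegative function. -/
noncomputable def eR (p : Plane) : ℝ≥0∞ := ENNReal.ofReal (wR (cx p) (cy p))

/-- The weight of the spatial norm as an extended nonnegative function. -/
noncomputable def eS (N : ℕ) (p : Plane) : ℝ≥0∞ := ENNReal.ofReal (wS N (cx p) (cy p))

@[fun_prop]
theorem measurable_eR : Measurable eR := continuous_wR.measurable.ennreal_ofReal

@[fun_prop]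
theorem measurable_eS (N : ℕ) : Measurable (eS N) := (continuous_wS N).measurable.ennreal_ofReal

theorem lintegral_weight_lt_top (N : ℕ) :
    ∫⁻ p, (eR p ^ (N + 1) / eS N p) ^ 2 < ∞ := by
  have h := (integrable_japanese_prod.const_mul ((9 * 2 ^ N) ^ 2 * 54)).lintegral_lt_top
  refine lt_of_le_of_lt (lintegral_mono fun p => ?_) h
  have hS := one_le_wS N (cx p) (cy p)
  have hR := one_le_wR (cx p) (cy p)
  have hS0 : 0 < wS N (cx p) (cy p) := by linarith
  have hR0 : 0 ≤ wR (cx p) (cy p) := by linarith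
  rw [eR, eS, ← ENNReal.ofReal_pow hR0, ← ENNReal.ofReal_div_of_pos hS0,
    ← ENNReal.ofReal_pow (by positivity)]
  refine ENNReal.ofReal_le_ofReal ((weight_sq_le N _ _).trans ?_)
  have hpi : 1 ≤ 2 * Real.pi := by linarith [Real.pi_gt_three]
  have hmono : ∀ t : ℝ, (1 + |2 * Real.pi * t|) ^ (-(6 / 5) : ℝ) ≤ (1 + |t|) ^ (-(6 / 5) : ℝ) :=
    fun t => by
      refine Real.rpow_le_rpow_of_nonpos (by positivity) ?_ (by norm_num)
      rw [abs_mul, abs_of_nonneg (by linarith : 0 ≤ 2 * Real.pi)]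
      nlinarith [abs_nonneg t]
  unfold cx cy
  gcongr ?_ * (?_ * ?_)
  · exact hmono _
  · exact hmono _

/-- Isotropically weighted Fourier transforms are integrable, by Cauchy–Schwarz. -/
theorem exists_lintegral_eR_le (N : ℕ) : ∃ C : ℝ≥0∞, C ≠ ∞ ∧ ∀ f : CL2,
    ∫⁻ p, eR p ^ (N + 1) * ‖f p‖ₑ ≤ C * nTwo (fun p => eS N p * ‖f p‖ₑ) := by
  refine ⟨nTwo fun p => eR p ^ (N + 1) / eS N p,
    (ENNReal.rpow_lt_top_of_nonneg (by norm_num) (lintegral_weight_lt_top N).ne).ne, fun f => ?_⟩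
  have hf := measurable_enorm_coe f
  refine le_trans (le_of_eq (lintegral_congr fun p => ?_))
    (lintegral_mul_le_nTwo (f := fun p => eR p ^ (N + 1) / eS N p)
      (g := fun p => eS N p * ‖f p‖ₑ) (by fun_prop) (by fun_prop))
  have h1 : eS N p ≠ 0 := by
    have := one_le_wS N (cx p) (cy p)
    simp only [eS, ne_eq, ENNReal.ofReal_eq_zero, not_le]
    linarith
  have h2 : eS N p ≠ ∞ := ENNReal.ofReal_ne_top
  rw [← mul_assoc, ENNReal.div_mul_cancel h1 h2]

/-- Up to constants the two extreme multi-indices $(N,0)$ and $(0,N)$ control the mixed ones, so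
four top-order derivatives and $f$ itself suffice. -/
theorem wS_sq_le (N : ℕ) (x y : ℝ) :
    wS N x y ^ 2 ≤ 3 * 4 ^ N * (1 + (x ^ (N + 3)) ^ 2 + (x ^ 3 * y ^ N) ^ 2 +
      (x ^ N * y ^ 2) ^ 2 + (y ^ (N + 2)) ^ 2) := by
  have h1 := add_pow_le_two_pow |x| |y| (abs_nonneg x) (abs_nonneg y) (2 * N)
  have e1 : ∀ z : ℝ, |z| ^ (2 * N) = z ^ (2 * N) := fun z => by
    rw [pow_mul, sq_abs, ← pow_mul]
  have e2 : |x| ^ 6 = x ^ 6 := by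
    rw [show 6 = 2 * 3 by norm_num, pow_mul, sq_abs, ← pow_mul]
  have e3 : (2 : ℝ) ^ (2 * N) = 4 ^ N := by rw [pow_mul]; norm_num
  rw [e1, e1, e3] at h1
  have h4 : (1 : ℝ) ≤ 4 ^ N := one_le_pow₀ (by norm_num)
  have hx6 : 0 ≤ x ^ 6 := by positivity
  set A := (|x| + |y|) ^ N with hA
  have h2 : (1 + A * (|x| ^ 3 + y ^ 2)) ^ 2 ≤ 3 * (1 + A ^ 2 * x ^ 6 + A ^ 2 * y ^ 4) := by
    rw [← e2]
    nlinarith [sq_nonneg (1 - A * |x| ^ 3), sq_nonneg (1 - A * y ^ 2),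
      sq_nonneg (A * |x| ^ 3 - A * y ^ 2)]
  have e5 : A ^ 2 = (|x| + |y|) ^ (2 * N) := by rw [hA, ← pow_mul, mul_comm]
  calc wS N x y ^ 2 ≤ 3 * (1 + A ^ 2 * x ^ 6 + A ^ 2 * y ^ 4) := h2
    _ ≤ 3 * (4 ^ N + (4 ^ N * (x ^ (2 * N) + y ^ (2 * N))) * x ^ 6 +
        (4 ^ N * (x ^ (2 * N) + y ^ (2 * N))) * y ^ 4) := by
      rw [e5]
      gcongr
    _ = _ := by ring

theorem wR_sq_le (N : ℕ) (x y : ℝ) :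
    (wR x y ^ N) ^ 2 ≤ 16 ^ N * (1 + (x ^ N) ^ 2 + (y ^ N) ^ 2) := by
  have hx := abs_nonneg x
  have hy := abs_nonneg y
  have h1 := add_pow_le_two_pow 1 (|x| + |y|) zero_le_one (by positivity) (2 * N)
  have h2 := add_pow_le_two_pow |x| |y| hx hy (2 * N)
  have e1 : ∀ z : ℝ, |z| ^ (2 * N) = z ^ (2 * N) := fun z => by
    rw [pow_mul, sq_abs, ← pow_mul]
  have e3 : (2 : ℝ) ^ (2 * N) = 4 ^ N := by rw [pow_mul]; norm_num
  rw [e1, e1, e3] at h2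
  rw [one_pow, e3] at h1
  have h4 : (1 : ℝ) ≤ 4 ^ N := one_le_pow₀ (by norm_num)
  calc (wR x y ^ N) ^ 2 = (1 + (|x| + |y|)) ^ (2 * N) := by unfold wR; rw [← pow_mul]; ring
    _ ≤ 4 ^ N * (1 + (|x| + |y|) ^ (2 * N)) := h1
    _ ≤ 4 ^ N * (4 ^ N + 4 ^ N * (x ^ (2 * N) + y ^ (2 * N))) := by gcongr
    _ = (4 * 4) ^ N * (1 + (x ^ N) ^ 2 + (y ^ N) ^ 2) := by rw [mul_pow]; ring
    _ = _ := by norm_num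

theorem lintegral_mono_le_derivSq (a b : ℕ) (f : L2) :
    ∫⁻ p, ‖mono a b p‖ₑ ^ 2 * ‖fhat f p‖ₑ ^ 2 ≤ derivSq a b f := by
  refine le_trans (le_of_eq (lintegral_congr fun p => ?_)) (lintegral_symb_le_derivSq a b f)
  rw [enorm_mul, mul_pow, enorm_symb]

theorem enorm_pow_two (z : ℝ) : ‖z‖ₑ ^ 2 = ENNReal.ofReal (z ^ 2) := by
  rw [← ofReal_norm, ← ENNReal.ofReal_pow (norm_nonneg _), Real.norm_eq_abs, sq_abs]

theorem nTwo_eS_sq_le (N : ℕ) (f : L2) :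
    nTwo (fun p => eS N p * ‖fhat f p‖ₑ) ^ 2 ≤ ENNReal.ofReal (15 * 4 ^ N) * spaceSq N f := by
  have hf := measurable_enorm_coe (fhat f)
  have hm := fun a b => (continuous_mono a b).measurable.enorm
  have hle : ∀ p, (eS N p * ‖fhat f p‖ₑ) ^ 2 ≤ ENNReal.ofReal (3 * 4 ^ N) *
      (‖fhat f p‖ₑ ^ 2 + ‖mono (N + 3) 0 p‖ₑ ^ 2 * ‖fhat f p‖ₑ ^ 2 +
        ‖mono 3 N p‖ₑ ^ 2 * ‖fhat f p‖ₑ ^ 2 + ‖mono N 2 p‖ₑ ^ 2 * ‖fhat f p‖ₑ ^ 2 +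
        ‖mono 0 (N + 2) p‖ₑ ^ 2 * ‖fhat f p‖ₑ ^ 2) := fun p => by
    have h := ENNReal.ofReal_le_ofReal (wS_sq_le N (cx p) (cy p))
    rw [ENNReal.ofReal_pow (zero_le_one.trans (one_le_wS _ _ _)),
      ENNReal.ofReal_mul (by positivity), ENNReal.ofReal_add (by positivity) (by positivity),
      ENNReal.ofReal_add (by positivity) (by positivity),
      ENNReal.ofReal_add (by positivity) (by positivity),
      ENNReal.ofReal_add (by positivity) (by positivity), ENNReal.ofReal_one] at h
    rw [mul_pow]
    refine (mul_le_mul_left h _).trans (le_of_eq ?_)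
    simp only [enorm_pow_two, mono, pow_zero, mul_one, one_mul]
    ring
  rw [nTwo_sq]
  refine (lintegral_mono hle).trans ?_
  rw [lintegral_const_mul _ (by fun_prop), lintegral_add_right _ (by fun_prop),
    lintegral_add_right _ (by fun_prop), lintegral_add_right _ (by fun_prop),
    lintegral_add_right _ (by fun_prop)]
  have hsum : ∀ j ∈ Finset.HasAntidiagonal.antidiagonal N,
      derivSq (j.1 + 3) j.2 f + derivSq j.1 (j.2 + 2) f ≤ spaceSq N f := fun j hj =>
    (Finset.single_le_sum (f := fun j : ℕ × ℕ => derivSq (j.1 + 3) j.2 f + derivSq j.1 (j.2 + 2) f)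
      (fun _ _ => zero_le) hj).trans le_add_self
  have hN := hsum (N, 0) (by simp)
  have h0 := hsum (0, N) (by simp)
  have k0 : ∫⁻ p, ‖fhat f p‖ₑ ^ 2 ≤ spaceSq N f := by
    rw [← enorm_sq_eq_lintegral, enorm_fhat]
    exact le_self_add
  have k1 := (lintegral_mono_le_derivSq (N + 3) 0 f).trans (le_self_add.trans hN)
  have k2 := (lintegral_mono_le_derivSq 3 N f).trans
    ((le_of_eq (by simp)).trans (le_self_add.trans h0))
  have k3 := (lintegral_mono_le_derivSq N 2 f).trans
    ((le_of_eq (by simp)).trans (le_add_self.trans hN))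
  have k4 := (lintegral_mono_le_derivSq 0 (N + 2) f).trans (le_add_self.trans h0)
  calc _ ≤ ENNReal.ofReal (3 * 4 ^ N) *
        (spaceSq N f + spaceSq N f + spaceSq N f + spaceSq N f + spaceSq N f) := by gcongr
    _ = ENNReal.ofReal (3 * 4 ^ N) * (5 * spaceSq N f) := by ring
    _ = _ := by
      rw [← mul_assoc, show (15 * 4 ^ N : ℝ) = 3 * 4 ^ N * 5 by ring,
        ENNReal.ofReal_mul (by positivity)]
      norm_num

theorem nTwo_eR_sq_le (N : ℕ) (f : L2) :
    nTwo (fun p => eR p ^ N * ‖fhat f p‖ₑ) ^ 2 ≤ ENNReal.ofReal (3 * 16 ^ N) * timeSq N f := by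
  have hf := measurable_enorm_coe (fhat f)
  have hm := fun a b => (continuous_mono a b).measurable.enorm
  have hle : ∀ p, (eR p ^ N * ‖fhat f p‖ₑ) ^ 2 ≤ ENNReal.ofReal (16 ^ N) *
      (‖mono 0 0 p‖ₑ ^ 2 * ‖fhat f p‖ₑ ^ 2 + ‖mono N 0 p‖ₑ ^ 2 * ‖fhat f p‖ₑ ^ 2 +
        ‖mono 0 N p‖ₑ ^ 2 * ‖fhat f p‖ₑ ^ 2) := fun p => by
    have h := ENNReal.ofReal_le_ofReal (wR_sq_le N (cx p) (cy p))
    have h0 := zero_le_one.trans (one_le_wR (cx p) (cy p))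
    rw [ENNReal.ofReal_pow (by positivity), ENNReal.ofReal_pow h0,
      ENNReal.ofReal_mul (by positivity), ENNReal.ofReal_add (by positivity) (by positivity),
      ENNReal.ofReal_add (by positivity) (by positivity), ENNReal.ofReal_one] at h
    rw [mul_pow]
    refine (mul_le_mul_left h _).trans (le_of_eq ?_)
    simp only [enorm_pow_two, mono, pow_zero, mul_one, one_mul, one_pow, ENNReal.ofReal_one]
    ring
  rw [nTwo_sq]
  refine (lintegral_mono hle).trans ?_
  rw [lintegral_const_mul _ (by fun_prop), lintegral_add_right _ (by fun_prop),
    lintegral_add_right _ (by fun_prop)]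
  have hsum : ∀ j ∈ insert (0, 0) (Finset.HasAntidiagonal.antidiagonal N),
      derivSq j.1 j.2 f ≤ timeSq N f := fun j hj =>
    (Finset.single_le_sum (f := fun j : ℕ × ℕ => derivSq j.1 j.2 f) (fun _ _ => zero_le) hj)
  have k0 := (lintegral_mono_le_derivSq 0 0 f).trans (hsum (0, 0) (by simp))
  have k1 := (lintegral_mono_le_derivSq N 0 f).trans (hsum (N, 0) (by simp))
  have k2 := (lintegral_mono_le_derivSq 0 N f).trans (hsum (0, N) (by simp))
  calc _ ≤ ENNReal.ofReal (16 ^ N) * (timeSq N f + timeSq N f + timeSq N f) := by gcongr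
    _ = ENNReal.ofReal (16 ^ N) * (3 * timeSq N f) := by ring
    _ = _ := by
      rw [← mul_assoc, show (3 * 16 ^ N : ℝ) = 16 ^ N * 3 by ring,
        ENNReal.ofReal_mul (by positivity)]
      norm_num

/-! ### Cancellation of the leading order term -/

/-- The integrand of the trilinear form `∫ conj U (w * ∂ₓ U)` on the Fourier side. -/
noncomputable def kern (w U : Plane → ℂ) (z : Plane × Plane) : ℂ :=
  Complex.I * cx z.2 * ((starRingEnd ℂ) (U z.1) * (w (z.1 - z.2) * U z.2))

theorem aestronglyMeasurable_kern (w U : CL2) :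
    AEStronglyMeasurable (kern w U) ((volume : Measure Plane).prod volume) := by
  have hw := (Lp.stronglyMeasurable w).measurable
  have hU := (Lp.stronglyMeasurable U).measurable
  have hc := continuous_cx.measurable
  have hconj := Complex.continuous_conj.measurable
  refine Measurable.aestronglyMeasurable ?_
  unfold kern
  exact (measurable_const.mul (Complex.measurable_ofReal.comp (hc.comp measurable_snd))).mul
    ((hconj.comp (hU.comp measurable_fst)).mul
      ((hw.comp (measurable_fst.sub measurable_snd)).mul (hU.comp measurable_snd)))

theorem enorm_kern (w U : Plane → ℂ) (z : Plane × Plane) :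
    ‖kern w U z‖ₑ = ‖cx z.2‖ₑ * (‖U z.1‖ₑ * (‖w (z.1 - z.2)‖ₑ * ‖U z.2‖ₑ)) := by
  have h1 : ‖(cx z.2 : ℂ)‖ₑ = ‖cx z.2‖ₑ := by rw [← ofReal_norm, ← ofReal_norm, Complex.norm_real]
  have h2 : ‖(starRingEnd ℂ) (U z.1)‖ₑ = ‖U z.1‖ₑ := by
    rw [← ofReal_norm, ← ofReal_norm, RCLike.norm_conj]
  have h3 : ‖Complex.I‖ₑ = 1 := by rw [← ofReal_norm]; simp
  simp only [kern, enorm_mul, h1, h2, h3, one_mul]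

theorem lintegral_prod_eq {f : Plane × Plane → ℂ}
    (hf : AEStronglyMeasurable f ((volume : Measure Plane).prod volume)) :
    ∫⁻ z, ‖f z‖ₑ ∂((volume : Measure Plane).prod volume) = ∫⁻ p, ∫⁻ q, ‖f (p, q)‖ₑ :=
  lintegral_prod _ hf.enorm

theorem integrable_prod_of_lintegral {f : Plane × Plane → ℂ}
    (hf : AEStronglyMeasurable f ((volume : Measure Plane).prod volume))
    (h : ∫⁻ p, ∫⁻ q, ‖f (p, q)‖ₑ ≠ ∞) : Integrable f ((volume : Measure Plane).prod volume) :=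
  ⟨hf, by rw [HasFiniteIntegral, lintegral_prod_eq hf]; exact h.lt_top⟩

theorem ae_prod_conj {w : Plane → ℂ} (hw : ∀ᵐ p, w (-p) = (starRingEnd ℂ) (w p)) :
    ∀ᵐ z : Plane × Plane ∂((volume : Measure Plane).prod volume),
      w (z.2 - z.1) = (starRingEnd ℂ) (w (z.1 - z.2)) := by
  have h := (quasiMeasurePreserving_sub (volume : Measure Plane) volume).ae hw
  filter_upwards [h] with z hz
  rw [← hz, neg_sub]

theorem enorm_re_le (z : ℂ) : ‖z.re‖ₑ ≤ ‖z‖ₑ := by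
  rw [← ofReal_norm, ← ofReal_norm]
  exact ENNReal.ofReal_le_ofReal (Complex.abs_re_le_norm z)

/-- The leading order term is antisymmetric up to a derivative of the coefficient. -/
theorem enorm_re_integral_symm_le {σ : Plane → ℝ} {w U : CL2}
    (hw : ∀ᵐ p, w (-p) = (starRingEnd ℂ) (w p))
    (hS : Integrable (fun z : Plane × Plane => ((σ z.1 * σ z.2 : ℝ) : ℂ) * kern w U z)
      ((volume : Measure Plane).prod volume)) :
    ‖(∫ z : Plane × Plane, ((σ z.1 * σ z.2 : ℝ) : ℂ) * kern w U z).re‖ₑ ≤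
      tri (fun p => ‖σ p‖ₑ * ‖U p‖ₑ) (fun p => ‖cx p‖ₑ * ‖w p‖ₑ) (fun p => ‖σ p‖ₑ * ‖U p‖ₑ) := by
  set S : Plane × Plane → ℂ := fun z => ((σ z.1 * σ z.2 : ℝ) : ℂ) * kern w U z with hSdef
  set D : Plane × Plane → ℂ := fun z => ((σ z.1 * σ z.2 : ℝ) : ℂ) *
    (Complex.I * (-cx (z.1 - z.2) : ℝ) *
      ((starRingEnd ℂ) (U z.1) * (w (z.1 - z.2) * U z.2))) with hD
  have hS' : Integrable (fun z => (starRingEnd ℂ) (S z.swap))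
      ((volume : Measure Plane).prod volume) :=
    memLp_one_iff_integrable.1 (memLp_one_iff_integrable.2 hS.swap).star
  have e1 : (starRingEnd ℂ) (∫ z, S z) = ∫ z : Plane × Plane, (starRingEnd ℂ) (S z.swap) := by
    rw [← integral_conj]
    exact (integral_prod_swap (μ := (volume : Measure Plane)) (ν := (volume : Measure Plane))
      (fun z => (starRingEnd ℂ) (S z))).symm
  -- The factor $i$ changes sign under conjugation while $w(q-p)=\overline{w(p-q)}$, so the
  -- multipliers combine to $X(q)-X(p)=-X(p-q)$: the derivative has moved onto $w$.
  have hsum : (fun z => S z + (starRingEnd ℂ) (S z.swap)) =ᵐ[(volume : Measure Plane).prod volume]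
      D := by
    filter_upwards [ae_prod_conj hw] with z hz
    simp only [hSdef, hD, kern, Prod.fst_swap, Prod.snd_swap, hz, map_mul, Complex.conj_conj,
      Complex.conj_I, Complex.conj_ofReal, cx_sub]
    push_cast
    ring
  have e2 : (∫ z, S z) + (starRingEnd ℂ) (∫ z, S z) = ∫ z, D z := by
    rw [e1]
    exact (integral_add hS hS').symm.trans (integral_congr_ae hsum)
  have hDm : AEStronglyMeasurable D ((volume : Measure Plane).prod volume) :=
    (hS.1.add hS'.1).congr hsum
  have e3 : ‖(∫ z, S z).re‖ₑ ≤ ‖∫ z, D z‖ₑ := by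
    rw [← e2, Complex.add_conj, ← ofReal_norm, ← ofReal_norm]
    refine ENNReal.ofReal_le_ofReal ?_
    rw [Complex.norm_real, norm_mul]
    norm_num
    linarith [abs_nonneg (∫ z, S z).re]
  refine e3.trans ((enorm_integral_le_lintegral_enorm _).trans ?_)
  change ∫⁻ z, ‖D z‖ₑ ∂((volume : Measure Plane).prod volume) ≤ _
  rw [lintegral_prod_eq hDm]
  refine le_of_eq (lintegral_congr fun p => lintegral_congr fun q => ?_)
  have h2 : ‖(starRingEnd ℂ) (U p)‖ₑ = ‖U p‖ₑ := by
    rw [← ofReal_norm, ← ofReal_norm, RCLike.norm_conj]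
  have h3 : ‖Complex.I‖ₑ = 1 := by rw [← ofReal_norm]; simp
  have h1 : ∀ c : ℝ, ‖(c : ℂ)‖ₑ = ‖c‖ₑ := fun c => by
    rw [← ofReal_norm, ← ofReal_norm, Complex.norm_real]
  simp only [hD, enorm_mul, h1, h2, h3, one_mul, enorm_neg]
  ring

theorem symb_one_zero (q : Plane) : symb 1 0 q = Complex.I * cx q := by
  simp [symb, cx]; ring

theorem conv_congr {a b b' : Plane → ℂ} (h : b =ᵐ[volume] b') (p : Plane) :
    conv a b p = conv a b' p :=
  integral_congr_ae (by filter_upwards [h] with q hq; rw [hq])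

/-- Commutator bound for the transport term `w ∂ₓ U` paired with `U` in a weighted space. -/
theorem enorm_transport_le {σ : Plane → ℝ} (hσ : Measurable σ) {w U Ux : CL2}
    (hw : ∀ᵐ p, w (-p) = (starRingEnd ℂ) (w p))
    (hUx : Ux =ᵐ[volume] fun q => symb 1 0 q * U q)
    (h1 : tri (fun p => ‖σ p‖ₑ ^ 2 * ‖U p‖ₑ) (fun p => ‖w p‖ₑ) (fun q => ‖cx q‖ₑ * ‖U q‖ₑ) ≠ ∞)
    (h2 : tri (fun p => ‖σ p‖ₑ * ‖U p‖ₑ) (fun p => ‖w p‖ₑ)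
      (fun q => ‖σ q‖ₑ * (‖cx q‖ₑ * ‖U q‖ₑ)) ≠ ∞) :
    ‖∫ p, σ p ^ 2 * ((starRingEnd ℂ) (U p) * conv w Ux p).re‖ₑ ≤
      (∫⁻ p, ∫⁻ q, (‖σ p‖ₑ * ‖U p‖ₑ) * (‖σ p - σ q‖ₑ * ‖cx q‖ₑ * ‖w (p - q)‖ₑ * ‖U q‖ₑ)) +
      tri (fun p => ‖σ p‖ₑ * ‖U p‖ₑ) (fun p => ‖cx p‖ₑ * ‖w p‖ₑ) (fun p => ‖σ p‖ₑ * ‖U p‖ₑ) := by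
  have hofR : ∀ c : ℝ, ‖(c : ℂ)‖ₑ = ‖c‖ₑ := fun c => by
    rw [← ofReal_norm, ← ofReal_norm, Complex.norm_real]
  have hσ1 : Measurable fun z : Plane × Plane => ((σ z.1 : ℝ) : ℂ) :=
    Complex.measurable_ofReal.comp (hσ.comp measurable_fst)
  have hσ2 : Measurable fun z : Plane × Plane => ((σ z.2 : ℝ) : ℂ) :=
    Complex.measurable_ofReal.comp (hσ.comp measurable_snd)
  have hk := aestronglyMeasurable_kern w U
  set F : Plane × Plane → ℂ := fun z => ((σ z.1 ^ 2 : ℝ) : ℂ) * kern w U z with hF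
  set S : Plane × Plane → ℂ := fun z => ((σ z.1 * σ z.2 : ℝ) : ℂ) * kern w U z with hS
  have hFi : Integrable F ((volume : Measure Plane).prod volume) := by
    refine integrable_prod_of_lintegral ?_ ?_
    · refine AEStronglyMeasurable.mul (Measurable.aestronglyMeasurable ?_) hk
      simpa using hσ1.pow_const 2
    · refine ne_of_eq_of_ne (lintegral_congr fun p => lintegral_congr fun q => ?_) h1
      simp only [hF, enorm_mul, enorm_kern, hofR, enorm_pow]
      ring
  have hSi : Integrable S ((volume : Measure Plane).prod volume) := by
    refine integrable_prod_of_lintegral ?_ ?_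
    · refine AEStronglyMeasurable.mul (Measurable.aestronglyMeasurable ?_) hk
      simp only [Complex.ofReal_mul]
      exact hσ1.mul hσ2
    · refine ne_of_eq_of_ne (lintegral_congr fun p => lintegral_congr fun q => ?_) h2
      simp only [hS, enorm_mul, enorm_kern, hofR]
      ring
  have e1 : ∫ p, σ p ^ 2 * ((starRingEnd ℂ) (U p) * conv w Ux p).re = (∫ z, F z).re := by
    have hpt : ∀ p, σ p ^ 2 * ((starRingEnd ℂ) (U p) * conv w Ux p).re =
        (∫ q, F (p, q)).re := fun p => by
      rw [conv_congr hUx, conv, ← Complex.re_ofReal_mul, ← integral_const_mul,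
        ← integral_const_mul]
      congr 1
      refine integral_congr_ae (Eventually.of_forall fun q => ?_)
      simp only [hF, kern, symb_one_zero]
      ring
    simp only [hpt]
    have h3 := integral_prod F hFi
    change (∫ z, F z) = _ at h3
    rw [h3]
    exact integral_re hFi.integral_prod_left
  -- `S` carries the symmetric weight $\sigma(p)\sigma(q)$, to which the exchange argument applies;
  -- the remainder carries the commutator $\sigma(p)(\sigma(p)-\sigma(q))$.
  have e2 : ∫ z, F z = (∫ z, S z) + ∫ z, (F z - S z) := by
    have := integral_add hSi (hFi.sub hSi)
    rw [show (∫ z, F z) = ∫ z, (S z + (F - S) z) by simp]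
    exact this
  have hdiff : ∀ z, F z - S z = ((σ z.1 * (σ z.1 - σ z.2) : ℝ) : ℂ) * kern w U z := fun z => by
    simp only [hF, hS]; push_cast; ring
  rw [e1, e2, Complex.add_re]
  refine (enorm_add_le _ _).trans ?_
  rw [add_comm]
  refine add_le_add ?_ (enorm_re_integral_symm_le hw hSi)
  refine (enorm_re_le _).trans ((enorm_integral_le_lintegral_enorm _).trans ?_)
  have hm := (hFi.sub hSi).1
  have := lintegral_prod_eq hm
  refine (le_of_eq this).trans (le_of_eq (lintegral_congr fun p => lintegral_congr fun q => ?_))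
  simp only [Pi.sub_apply, hdiff, enorm_mul, enorm_kern, hofR]
  ring

/-- Direct bound for a product paired with a third function. -/
theorem enorm_pairing_le (σ : Plane → ℝ) (U a b : Plane → ℂ) :
    ‖∫ p, σ p ^ 2 * ((starRingEnd ℂ) (U p) * conv a b p).re‖ₑ ≤
      ∫⁻ p, ∫⁻ q, (‖σ p‖ₑ * ‖U p‖ₑ) * (‖σ p‖ₑ * ‖a (p - q)‖ₑ * ‖b q‖ₑ) := by
  refine (enorm_integral_le_lintegral_enorm _).trans (lintegral_mono fun p => ?_)
  refine (enorm_weight_re_le _ _ _).trans ?_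
  have h : ‖conv a b p‖ₑ ≤ ∫⁻ q, ‖a (p - q)‖ₑ * ‖b q‖ₑ :=
    (enorm_integral_le_lintegral_enorm _).trans (by simp [enorm_mul])
  calc ‖σ p‖ₑ ^ 2 * ‖U p‖ₑ * ‖conv a b p‖ₑ
      ≤ ‖σ p‖ₑ ^ 2 * ‖U p‖ₑ * ∫⁻ q, ‖a (p - q)‖ₑ * ‖b q‖ₑ := by gcongr
    _ = ∫⁻ q, (‖σ p‖ₑ ^ 2 * ‖U p‖ₑ) * (‖a (p - q)‖ₑ * ‖b q‖ₑ) :=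
      (lintegral_const_mul' _ _ (by finiteness)).symm
    _ = _ := lintegral_congr fun q => by ring

/-! ### Rapidly decaying Fourier transforms and the trilinear estimates -/

/-- All polynomially weighted `L²` norms are finite. -/
def Rapid (U : CL2) : Prop := ∀ K : ℕ, nTwo (fun p => eR p ^ K * ‖U p‖ₑ) < ∞

theorem one_le_eR (p : Plane) : 1 ≤ eR p := by
  rw [eR, ← ENNReal.ofReal_one]
  exact ENNReal.ofReal_le_ofReal (one_le_wR _ _)

theorem nTwo_const_mul (c : ℝ≥0∞) (f : Plane → ℝ≥0∞) (hf : Measurable f) :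
    nTwo (fun p => c * f p) = c * nTwo f := by
  unfold nTwo
  simp only [mul_pow]
  rw [lintegral_const_mul _ (by fun_prop), ENNReal.mul_rpow_of_nonneg _ _ (by norm_num),
    ← ENNReal.rpow_natCast, ← ENNReal.rpow_mul]
  norm_num

theorem nTwo_weight_le {U : CL2} {g : Plane → ℝ≥0∞} {c : ℝ≥0∞} {K : ℕ}
    (hg : ∀ p, g p ≤ c * eR p ^ K) :
    nTwo (fun p => g p * ‖U p‖ₑ) ≤ c * nTwo (fun p => eR p ^ K * ‖U p‖ₑ) := by
  have hU := measurable_enorm_coe U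
  rw [← nTwo_const_mul c _ (by fun_prop)]
  refine nTwo_mono fun p => ?_
  rw [← mul_assoc]
  gcongr
  exact hg p

theorem Rapid.nTwo_lt_top {U : CL2} (h : Rapid U) {g : Plane → ℝ≥0∞} {c : ℝ≥0∞} (hc : c ≠ ∞)
    {K : ℕ} (hg : ∀ p, g p ≤ c * eR p ^ K) : nTwo (fun p => g p * ‖U p‖ₑ) < ∞ :=
  (nTwo_weight_le hg).trans_lt (ENNReal.mul_lt_top hc.lt_top (h K))

theorem eS_le (N : ℕ) (p : Plane) : eS N p ≤ 3 * eR p ^ (N + 3) := by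
  have h1 := one_le_wR (cx p) (cy p)
  have h0 : 0 ≤ wR (cx p) (cy p) := by linarith
  rw [eS, eR, ← ENNReal.ofReal_pow h0, show (3 : ℝ≥0∞) = ENNReal.ofReal 3 by norm_num,
    ← ENNReal.ofReal_mul (by norm_num)]
  refine ENNReal.ofReal_le_ofReal ?_
  have hx := abs_nonneg (cx p)
  have hy := abs_nonneg (cy p)
  have ex : |cx p| ≤ wR (cx p) (cy p) := by unfold wR; linarith
  have ey : |cy p| ≤ wR (cx p) (cy p) := by unfold wR; linarith
  have er : |cx p| + |cy p| ≤ wR (cx p) (cy p) := by unfold wR; linarith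
  unfold wS
  rw [← sq_abs (cy p)]
  set R := wR (cx p) (cy p)
  have e1 : 1 ≤ R ^ (N + 3) := one_le_pow₀ h1
  have e2 : (|cx p| + |cy p|) ^ N * (|cx p| ^ 3 + |cy p| ^ 2) ≤ R ^ N * (R ^ 3 + R ^ 3) := by
    have : R ^ 2 ≤ R ^ 3 := pow_le_pow_right₀ h1 (by norm_num)
    have : |cy p| ^ 2 ≤ R ^ 2 := by gcongr
    gcongr
    linarith
  calc _ ≤ R ^ (N + 3) + R ^ N * (R ^ 3 + R ^ 3) := by linarith
    _ = _ := by ring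

theorem Rapid.lintegral_lt_top {U : CL2} (h : Rapid U) (K : ℕ) :
    ∫⁻ p, eR p ^ K * ‖U p‖ₑ < ∞ := by
  obtain ⟨C, hC, hle⟩ := exists_lintegral_eR_le K
  refine lt_of_le_of_lt (lintegral_mono fun p => ?_) ((hle U).trans_lt
    (ENNReal.mul_lt_top hC.lt_top (h.nTwo_lt_top (c := 3) (by norm_num) (eS_le K))))
  gcongr
  · exact one_le_eR p
  · omega

theorem Rapid.integrable_mul {U : CL2} (h : Rapid U) {g : Plane → ℂ}
    (hg : AEStronglyMeasurable g volume) {K : ℕ} (hle : ∀ p, ‖g p‖ₑ ≤ eR p ^ K) :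
    Integrable (fun p => g p * U p) volume := by
  refine ⟨hg.mul (Lp.aestronglyMeasurable U), lt_of_le_of_lt (lintegral_mono fun p => ?_)
    (h.lintegral_lt_top K)⟩
  rw [enorm_mul]
  gcongr
  exact hle p

theorem Rapid.memLp_mul {U : CL2} (h : Rapid U) {g : Plane → ℂ}
    (hg : AEStronglyMeasurable g volume) {K : ℕ} (hle : ∀ p, ‖g p‖ₑ ≤ eR p ^ K) :
    MemLp (fun p => g p * U p) 2 volume := by
  refine (memLp_two_iff_lintegral (f := fun p => g p * U p)
    (hg.mul (Lp.aestronglyMeasurable U))).2 ?_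
  have := h K
  replace this := ENNReal.pow_lt_top (n := 2) this
  rw [nTwo_sq] at this
  refine lt_of_le_of_lt (lintegral_mono fun p => ?_) this
  rw [enorm_mul]
  gcongr
  exact hle p

theorem Rapid.integrable {U : CL2} (h : Rapid U) : Integrable U volume := by
  simpa using h.integrable_mul (g := fun _ => 1) (K := 0) aestronglyMeasurable_const (by simp)

theorem enorm_cx_le (p : Plane) : ‖cx p‖ₑ ≤ eR p := by
  rw [← ofReal_norm, eR]
  refine ENNReal.ofReal_le_ofReal ?_
  rw [Real.norm_eq_abs]
  unfold wR
  linarith [abs_nonneg (cy p)]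

theorem enorm_cy_le (p : Plane) : ‖cy p‖ₑ ≤ eR p := by
  rw [← ofReal_norm, eR]
  refine ENNReal.ofReal_le_ofReal ?_
  rw [Real.norm_eq_abs]
  unfold wR
  linarith [abs_nonneg (cx p)]

theorem enorm_mono_le (a b : ℕ) (p : Plane) : ‖mono a b p‖ₑ ≤ eR p ^ (a + b) := by
  rw [mono, enorm_mul, enorm_pow, enorm_pow, pow_add]
  gcongr
  · exact enorm_cx_le p
  · exact enorm_cy_le p

theorem enorm_symb_le (a b : ℕ) (p : Plane) : ‖symb a b p‖ₑ ≤ eR p ^ (a + b) :=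
  (enorm_symb a b p).trans_le (enorm_mono_le a b p)

theorem Rapid.derivSq_eq {a b : ℕ} {f : L2} (h : Rapid (fhat f)) :
    derivSq a b f = ∫⁻ p, ‖(mono a b p : ℂ) * fhat f p‖ₑ ^ 2 := by
  have hm := (continuous_symb a b).aestronglyMeasurable (μ := (volume : Measure Plane))
  rw [KP.derivSq_eq h.integrable (h.integrable_mul hm (enorm_symb_le a b))
    (h.memLp_mul hm (enorm_symb_le a b))]
  refine lintegral_congr fun p => ?_
  rw [enorm_mul, enorm_symb, enorm_real_mul]

theorem nTwo_mono_sq_le (a b : ℕ) (f : L2) :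
    nTwo (fun p => ‖mono a b p‖ₑ * ‖fhat f p‖ₑ) ^ 2 ≤ derivSq a b f := by
  rw [nTwo_sq]
  simp only [mul_pow]
  exact lintegral_mono_le_derivSq a b f

theorem le_of_sq_le_sq {a b : ℝ≥0∞} (h : a ^ 2 ≤ b ^ 2) : a ≤ b :=
  (ENNReal.pow_le_pow_left_iff (n := 2) (by norm_num)).1 h

theorem tri_weighted_eq {σ : Plane → ℝ} {w U : CL2} {g1 g2 : Plane → ℝ≥0∞} :
    ∫⁻ p, ∫⁻ q, (‖σ p‖ₑ * ‖U p‖ₑ) * (g1 (p - q) * g2 q * ‖w (p - q)‖ₑ * ‖U q‖ₑ) =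
    tri (fun p => ‖σ p‖ₑ * ‖U p‖ₑ) (fun p => g1 p * ‖w p‖ₑ) (fun q => g2 q * ‖U q‖ₑ) :=
  lintegral_congr fun p => lintegral_congr fun q => by ring

/-- Weighted estimate for the transport term under a commutator bound on the weight. -/
theorem transport_estimate {N : ℕ} {σ : Plane → ℝ} (hσ : Measurable σ) {K : ℕ}
    (hK : ∀ p, ‖σ p‖ₑ ≤ eR p ^ K) {β γ : Plane → ℝ≥0∞} (hβ : Measurable β) (hγ : Measurable γ)
    {C : ℝ≥0∞} (hC : ∀ p q, ‖σ p - σ q‖ₑ * ‖cx q‖ₑ ≤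
      C * (eR (p - q) ^ (N + 1) * β q + eS N (p - q) * γ q))
    {w U Ux : CL2} (hwR : Rapid w) (hUR : Rapid U)
    (hw : ∀ᵐ p, w (-p) = (starRingEnd ℂ) (w p))
    (hUx : Ux =ᵐ[volume] fun q => symb 1 0 q * U q) :
    ‖∫ p, σ p ^ 2 * ((starRingEnd ℂ) (U p) * conv w Ux p).re‖ₑ ≤
      C * (nTwo (fun p => ‖σ p‖ₑ * ‖U p‖ₑ) * (∫⁻ p, eR p ^ (N + 1) * ‖w p‖ₑ) *
          nTwo (fun p => β p * ‖U p‖ₑ) +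
        nTwo (fun p => ‖σ p‖ₑ * ‖U p‖ₑ) * nTwo (fun p => eS N p * ‖w p‖ₑ) *
          ∫⁻ p, γ p * ‖U p‖ₑ) +
      nTwo (fun p => ‖σ p‖ₑ * ‖U p‖ₑ) * (∫⁻ p, eR p ^ (N + 1) * ‖w p‖ₑ) *
        nTwo (fun p => ‖σ p‖ₑ * ‖U p‖ₑ) := by
  have mU := measurable_enorm_coe U
  have mw := measurable_enorm_coe w
  have mσ := hσ.enorm
  have mc := continuous_cx.measurable.enorm
  have hw1 : ∫⁻ p, ‖w p‖ₑ ≠ ∞ := hwR.integrable.2.ne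
  refine (enorm_transport_le hσ hw hUx ?_ ?_).trans (add_le_add ?_ ?_)
  -- These finiteness conditions only justify Fubini; rapid decay gives them, and `K` does not enter
  -- the estimate.
  · refine ne_top_of_le_ne_top ?_ (tri_le_one_two (by fun_prop) mw (by fun_prop))
    refine ENNReal.mul_ne_top (ENNReal.mul_ne_top (hUR.nTwo_lt_top (c := 1) (K := K * 2)
      (by norm_num) fun p => ?_).ne hw1) (hUR.nTwo_lt_top (c := 1) (K := 1) (by norm_num)
      fun p => ?_).ne
    · rw [one_mul, pow_mul]; gcongr; exact hK p
    · rw [one_mul, pow_one]; exact enorm_cx_le p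
  · refine ne_top_of_le_ne_top ?_ (tri_le_one_two (by fun_prop) mw (by fun_prop))
    simp only [← mul_assoc]
    refine ENNReal.mul_ne_top (ENNReal.mul_ne_top (hUR.nTwo_lt_top (c := 1) (K := K)
      (by norm_num) fun p => ?_).ne hw1) (hUR.nTwo_lt_top (c := 1) (K := K + 1) (by norm_num)
      fun p => ?_).ne
    · rw [one_mul]; exact hK p
    · rw [one_mul, pow_succ]; gcongr
      · exact hK p
      · exact enorm_cx_le p
  · calc ∫⁻ p, ∫⁻ q, (‖σ p‖ₑ * ‖U p‖ₑ) * (‖σ p - σ q‖ₑ * ‖cx q‖ₑ * ‖w (p - q)‖ₑ * ‖U q‖ₑ)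
        ≤ ∫⁻ p, ∫⁻ q, C * ((‖σ p‖ₑ * ‖U p‖ₑ) *
            (eR (p - q) ^ (N + 1) * β q * ‖w (p - q)‖ₑ * ‖U q‖ₑ) +
            (‖σ p‖ₑ * ‖U p‖ₑ) * (eS N (p - q) * γ q * ‖w (p - q)‖ₑ * ‖U q‖ₑ)) := by
          refine lintegral_mono fun p => lintegral_mono fun q => ?_
          calc (‖σ p‖ₑ * ‖U p‖ₑ) * (‖σ p - σ q‖ₑ * ‖cx q‖ₑ * ‖w (p - q)‖ₑ * ‖U q‖ₑ)
              ≤ (‖σ p‖ₑ * ‖U p‖ₑ) * ((C * (eR (p - q) ^ (N + 1) * β q + eS N (p - q) * γ q)) *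
                ‖w (p - q)‖ₑ * ‖U q‖ₑ) :=
                mul_le_mul' le_rfl (mul_le_mul' (mul_le_mul' (hC p q) le_rfl) le_rfl)
            _ = _ := by ring
      _ = C * (tri (fun p => ‖σ p‖ₑ * ‖U p‖ₑ) (fun p => eR p ^ (N + 1) * ‖w p‖ₑ)
            (fun q => β q * ‖U q‖ₑ) +
          tri (fun p => ‖σ p‖ₑ * ‖U p‖ₑ) (fun p => eS N p * ‖w p‖ₑ)
            (fun q => γ q * ‖U q‖ₑ)) := by
          rw [← tri_weighted_eq, ← tri_weighted_eq]
          rw [← lintegral_add_left (Measurable.lintegral_prod_right' (f := fun z : Plane × Plane =>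
            (‖σ z.1‖ₑ * ‖U z.1‖ₑ) * (eR (z.1 - z.2) ^ (N + 1) * β z.2 * ‖w (z.1 - z.2)‖ₑ *
              ‖U z.2‖ₑ)) (by fun_prop)), ← lintegral_const_mul]
          · refine lintegral_congr fun p => ?_
            rw [← lintegral_add_left (by fun_prop), ← lintegral_const_mul _ (by fun_prop)]
          · refine Measurable.add ?_ ?_
            · exact Measurable.lintegral_prod_right' (f := fun z : Plane × Plane =>
                (‖σ z.1‖ₑ * ‖U z.1‖ₑ) * (eR (z.1 - z.2) ^ (N + 1) * β z.2 * ‖w (z.1 - z.2)‖ₑ *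
                ‖U z.2‖ₑ)) (by fun_prop)
            · exact Measurable.lintegral_prod_right' (f := fun z : Plane × Plane =>
                (‖σ z.1‖ₑ * ‖U z.1‖ₑ) * (eS N (z.1 - z.2) * γ z.2 * ‖w (z.1 - z.2)‖ₑ *
                ‖U z.2‖ₑ)) (by fun_prop)
      _ ≤ _ := by
          gcongr
          -- The factor carrying the isotropic weight goes in $L^1$: here the coefficient, in the
          -- next term `U`.
          · exact tri_le_one_two (by fun_prop) (by fun_prop) (by fun_prop)
          · exact tri_le_two_one (by fun_prop) (by fun_prop) (by fun_prop)
  · refine (tri_le_one_two (by fun_prop) (by fun_prop) (by fun_prop)).trans ?_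
    gcongr with p
    refine (enorm_cx_le p).trans ?_
    exact le_self_pow₀ (one_le_eR p) (by omega)

/-- The exponents of the top order derivatives in the spatial norm, together with `(0, 0)`. -/
def SpatialExp (N a b : ℕ) : Prop :=
  (a = 0 ∧ b = 0) ∨ (∃ i k, i + k = N ∧ a = i + 3 ∧ b = k) ∨ ∃ i k, i + k = N ∧ a = i ∧ b = k + 2

theorem exists_spatial_commutator (N : ℕ) : ∃ C : ℝ, 0 ≤ C ∧ ∀ e f : ℕ, SpatialExp N e f →
    ∀ a b x y : ℝ, |(a + x) ^ e * (b + y) ^ f - x ^ e * y ^ f| * |x| ≤ C * wC N a b x y := by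
  have hx : ∀ i : ℕ, ∃ C : ℝ, 0 ≤ C ∧ (i ≤ N → ∀ a b x y : ℝ,
      |(a + x) ^ (i + 3) * (b + y) ^ (N - i) - x ^ (i + 3) * y ^ (N - i)| * |x| ≤
        C * wC N a b x y) := fun i => by
    by_cases h : i ≤ N
    · obtain ⟨C, h0, hC⟩ := commutator_x_le N i (N - i) (by omega)
      exact ⟨C, h0, fun _ => hC⟩
    · exact ⟨0, le_rfl, fun h' => absurd h' h⟩
  have hy : ∀ i : ℕ, ∃ C : ℝ, 0 ≤ C ∧ (i ≤ N → ∀ a b x y : ℝ,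
      |(a + x) ^ i * (b + y) ^ (N - i + 2) - x ^ i * y ^ (N - i + 2)| * |x| ≤
        C * wC N a b x y) := fun i => by
    by_cases h : i ≤ N
    · obtain ⟨C, h0, hC⟩ := commutator_y_le N i (N - i) (by omega)
      exact ⟨C, h0, fun _ => hC⟩
    · exact ⟨0, le_rfl, fun h' => absurd h' h⟩
  choose Cx hCx0 hCx using hx
  choose Cy hCy0 hCy using hy
  -- There are finitely many exponents of each type, so the sum of the constants serves them all.
  refine ⟨∑ i ∈ Finset.range (N + 1), (Cx i + Cy i),
    Finset.sum_nonneg fun i _ => add_nonneg (hCx0 i) (hCy0 i), ?_⟩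
  have hle : ∀ i, i ≤ N → Cx i + Cy i ≤ ∑ i ∈ Finset.range (N + 1), (Cx i + Cy i) := fun i hi =>
    Finset.single_le_sum (f := fun i => Cx i + Cy i)
      (fun i _ => add_nonneg (hCx0 i) (hCy0 i)) (Finset.mem_range.2 (by omega))
  rintro e f (⟨rfl, rfl⟩ | ⟨i, k, h, rfl, rfl⟩ | ⟨i, k, h, rfl, rfl⟩) a b x y
  · have h0 := wC_nonneg N a b x y
    have h1 : 0 ≤ ∑ i ∈ Finset.range (N + 1), (Cx i + Cy i) :=
      Finset.sum_nonneg fun i _ => add_nonneg (hCx0 i) (hCy0 i)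
    simpa using mul_nonneg h1 h0
  · obtain rfl : f = N - i := by omega
    refine (hCx i (by omega) a b x y).trans ?_
    have := hle i (by omega)
    have := hCy0 i
    gcongr
    · exact wC_nonneg _ _ _ _ _
    · linarith
  · obtain rfl : k = N - e := by omega
    refine (hCy e (by omega) a b x y).trans ?_
    have := hle e (by omega)
    have := hCx0 e
    gcongr
    · exact wC_nonneg _ _ _ _ _
    · linarith

theorem enorm_mul_le_of_real {s t u : ℝ} (h : |s| * |t| ≤ u) :
    ‖s‖ₑ * ‖t‖ₑ ≤ ENNReal.ofReal u := by
  rw [← ofReal_norm, ← ofReal_norm, ← ENNReal.ofReal_mul (norm_nonneg _)]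
  exact ENNReal.ofReal_le_ofReal h

theorem ofReal_wC (N : ℕ) (p q : Plane) :
    ENNReal.ofReal (wC N (cx (p - q)) (cy (p - q)) (cx q) (cy q)) =
      eR (p - q) ^ (N + 1) * eS N q + eS N (p - q) * eR q ^ (N + 1) := by
  have h1 := zero_le_one.trans (one_le_wR (cx (p - q)) (cy (p - q)))
  have h2 := zero_le_one.trans (one_le_wR (cx q) (cy q))
  have h3 := zero_le_one.trans (one_le_wS N (cx (p - q)) (cy (p - q)))
  have h4 := zero_le_one.trans (one_le_wS N (cx q) (cy q))
  rw [wC, ENNReal.ofReal_add (by positivity) (by positivity), ENNReal.ofReal_mul (by positivity),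
    ENNReal.ofReal_mul (by positivity), ENNReal.ofReal_pow h1, ENNReal.ofReal_pow h2]
  rfl

theorem exists_spatial_commutator_plane (N : ℕ) : ∃ C : ℝ≥0∞, C ≠ ∞ ∧ ∀ e f : ℕ,
    SpatialExp N e f → ∀ p q : Plane, ‖mono e f p - mono e f q‖ₑ * ‖cx q‖ₑ ≤
      C * (eR (p - q) ^ (N + 1) * eS N q + eS N (p - q) * eR q ^ (N + 1)) := by
  obtain ⟨C, hC0, hC⟩ := exists_spatial_commutator N
  refine ⟨ENNReal.ofReal C, ENNReal.ofReal_ne_top, fun e f h p q => ?_⟩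
  rw [← ofReal_wC, ← ENNReal.ofReal_mul hC0]
  refine enorm_mul_le_of_real ?_
  have := hC e f h (cx (p - q)) (cy (p - q)) (cx q) (cy q)
  rw [cx_sub, cy_sub, sub_add_cancel, sub_add_cancel] at this
  rw [cx_sub, cy_sub]
  exact this

theorem derivSq_le_spaceSq {N a b : ℕ} (h : SpatialExp N a b) {f : L2} (hf : Rapid (fhat f)) :
    derivSq a b f ≤ spaceSq N f := by
  rcases h with ⟨rfl, rfl⟩ | ⟨i, k, h, rfl, rfl⟩ | ⟨i, k, h, rfl, rfl⟩
  · rw [hf.derivSq_eq]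
    simp only [mono, pow_zero, mul_one, Complex.ofReal_one, one_mul]
    rw [← enorm_sq_eq_lintegral, enorm_fhat]
    exact le_self_add
  · refine le_trans ?_ (le_add_self : _ ≤ spaceSq N f)
    refine le_trans ?_ (Finset.single_le_sum (f := fun j : ℕ × ℕ =>
      derivSq (j.1 + 3) j.2 f + derivSq j.1 (j.2 + 2) f) (fun _ _ => zero_le)
      (Finset.HasAntidiagonal.mem_antidiagonal.2 h : (i, b) ∈ _))
    exact le_self_add
  · refine le_trans ?_ (le_add_self : _ ≤ spaceSq N f)
    refine le_trans ?_ (Finset.single_le_sum (f := fun j : ℕ × ℕ =>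
      derivSq (j.1 + 3) j.2 f + derivSq j.1 (j.2 + 2) f) (fun _ _ => zero_le)
      (Finset.HasAntidiagonal.mem_antidiagonal.2 h : (a, k) ∈ _))
    exact le_add_self

theorem nTwo_eS_le {N : ℕ} {f : L2} {n : ℝ≥0∞} (hn : spaceSq N f ≤ n ^ 2) :
    nTwo (fun p => eS N p * ‖fhat f p‖ₑ) ≤ ENNReal.ofReal (15 * 4 ^ N) * n := by
  refine le_of_sq_le_sq ((nTwo_eS_sq_le N f).trans ?_)
  rw [mul_pow]
  -- A constant that is at least one is bounded by its square, so no square root is needed.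
  have h1 : (1 : ℝ≥0∞) ≤ ENNReal.ofReal (15 * 4 ^ N) := by
    rw [← ENNReal.ofReal_one]
    refine ENNReal.ofReal_le_ofReal ?_
    have : (1 : ℝ) ≤ 4 ^ N := one_le_pow₀ (by norm_num)
    linarith
  gcongr
  exact le_self_pow₀ h1 (by norm_num)

theorem nTwo_eR_le {N : ℕ} {f : L2} {n : ℝ≥0∞} (hn : timeSq N f ≤ n ^ 2) :
    nTwo (fun p => eR p ^ N * ‖fhat f p‖ₑ) ≤ ENNReal.ofReal (3 * 16 ^ N) * n := by
  refine le_of_sq_le_sq ((nTwo_eR_sq_le N f).trans ?_)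
  rw [mul_pow]
  have h1 : (1 : ℝ≥0∞) ≤ ENNReal.ofReal (3 * 16 ^ N) := by
    rw [← ENNReal.ofReal_one]
    refine ENNReal.ofReal_le_ofReal ?_
    have : (1 : ℝ) ≤ 16 ^ N := one_le_pow₀ (by norm_num)
    linarith
  gcongr
  exact le_self_pow₀ h1 (by norm_num)

/-- The commutator majorant is symmetric: either $w$ is in $L^1$ with isotropic weight and $v$ in
$L^2$ with weight `eS`, or conversely. Both kinds of norm are controlled by `spaceSq`. -/
theorem exists_spatial_estimate (N : ℕ) : ∃ C : ℝ≥0∞, C ≠ ∞ ∧ ∀ e f : ℕ, SpatialExp N e f →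
    ∀ (w v vx : L2) (nw nv : ℝ≥0∞), Rapid (fhat w) → Rapid (fhat v) → HasDerivL2 1 0 v vx →
      spaceSq N w ≤ nw ^ 2 → spaceSq N v ≤ nv ^ 2 →
      ‖∫ p, mono e f p ^ 2 *
        ((starRingEnd ℂ) (fhat v p) * conv (fhat w) (fhat vx) p).re‖ₑ ≤ C * (nw * nv ^ 2) := by
  obtain ⟨C₁, hC₁, hcomm⟩ := exists_spatial_commutator_plane N
  obtain ⟨C₂, hC₂, hint⟩ := exists_lintegral_eR_le N
  set A : ℝ≥0∞ := ENNReal.ofReal (15 * 4 ^ N) with hA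
  refine ⟨C₁ * (C₂ * A * A + A * (C₂ * A)) + C₂ * A, by finiteness, ?_⟩
  intro e f hef w v vx nw nv hw hv hvx hnw hnv
  have h1 := nTwo_eS_le hnw
  have h2 := nTwo_eS_le hnv
  have h3 : nTwo (fun p => ‖mono e f p‖ₑ * ‖fhat v p‖ₑ) ≤ nv :=
    le_of_sq_le_sq ((nTwo_mono_sq_le e f v).trans ((derivSq_le_spaceSq hef hv).trans hnv))
  have h4 : ∫⁻ p, eR p ^ (N + 1) * ‖fhat w p‖ₑ ≤ C₂ * (A * nw) := (hint _).trans (by gcongr)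
  have h5 : ∫⁻ p, eR p ^ (N + 1) * ‖fhat v p‖ₑ ≤ C₂ * (A * nv) := (hint _).trans (by gcongr)
  refine (transport_estimate (continuous_mono e f).measurable (enorm_mono_le e f)
    (measurable_eS N) (by fun_prop) (hcomm e f hef) hw hv (fhat_neg hw.integrable)
    ((hasDerivL2_iff _ _ _ _).1 hvx)).trans ?_
  calc _ ≤ C₁ * (nv * (C₂ * (A * nw)) * (A * nv) + nv * (A * nw) * (C₂ * (A * nv))) +
        nv * (C₂ * (A * nw)) * nv := by gcongr
    _ = _ := by ring

theorem eR_eq_ofReal_mul {i k : ℕ} (p q : Plane) (c : ℝ) (hc : 0 ≤ c) :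
    ENNReal.ofReal (c * (wR (cx (p - q)) (cy (p - q)) ^ i * wR (cx q) (cy q) ^ k)) =
      ENNReal.ofReal c * (eR (p - q) ^ i * eR q ^ k) := by
  have h1 := zero_le_one.trans (one_le_wR (cx (p - q)) (cy (p - q)))
  have h2 := zero_le_one.trans (one_le_wR (cx q) (cy q))
  rw [ENNReal.ofReal_mul hc, ENNReal.ofReal_mul (by positivity), ENNReal.ofReal_pow h1,
    ENNReal.ofReal_pow h2]
  rfl

theorem time_commutator_plane {N e f : ℕ} (h : e + f ≤ N) (p q : Plane) :
    ‖mono e f p - mono e f q‖ₑ * ‖cx q‖ₑ ≤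
      ENNReal.ofReal (N * 2 ^ N) * (eR (p - q) ^ (N + 1) * eR q ^ N + eS N (p - q) * 0) := by
  rw [mul_zero, add_zero, ← eR_eq_ofReal_mul _ _ _ (by positivity)]
  refine enorm_mul_le_of_real ?_
  have := commutator_time_le N e f h (cx (p - q)) (cy (p - q)) (cx q) (cy q)
  rw [cx_sub, cy_sub, sub_add_cancel, sub_add_cancel] at this
  rw [cx_sub, cy_sub]
  exact this

theorem time_symbol_plane {N e f : ℕ} (h : e + f ≤ N) (p q : Plane) :
    ‖mono e f p‖ₑ * ‖cx q‖ₑ ≤ ENNReal.ofReal (2 ^ N) * (eR (p - q) ^ N * eR q ^ (N + 1)) := by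
  rw [← eR_eq_ofReal_mul _ _ _ (by positivity)]
  refine enorm_mul_le_of_real ?_
  have := symbol_time_le N e f h (cx (p - q)) (cy (p - q)) (cx q) (cy q)
  rw [cx_sub, cy_sub, sub_add_cancel, sub_add_cancel] at this
  rw [cx_sub, cy_sub]
  exact this

theorem derivSq_le_timeSq {N a b : ℕ} (h : (a, b) ∈ insert (0, 0)
    (Finset.HasAntidiagonal.antidiagonal N)) (f : L2) : derivSq a b f ≤ timeSq N f :=
  Finset.single_le_sum (f := fun j : ℕ × ℕ => derivSq j.1 j.2 f) (fun _ _ => zero_le) h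

/-- The coefficient $w$ always goes in $L^1$, absorbing $N+1$ powers, so that $v_t$ is measured only
by `timeSq`. The second commutator weight is accordingly zero. -/
theorem exists_time_estimate (N : ℕ) : ∃ C : ℝ≥0∞, C ≠ ∞ ∧ ∀ e f : ℕ,
    (e, f) ∈ insert (0, 0) (Finset.HasAntidiagonal.antidiagonal N) →
    ∀ (w vt vtx : L2) (nw nv : ℝ≥0∞), Rapid (fhat w) → Rapid (fhat vt) →
      HasDerivL2 1 0 vt vtx → spaceSq N w ≤ nw ^ 2 → timeSq N vt ≤ nv ^ 2 →
      ‖∫ p, mono e f p ^ 2 *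
        ((starRingEnd ℂ) (fhat vt p) * conv (fhat w) (fhat vtx) p).re‖ₑ ≤ C * (nw * nv ^ 2) := by
  obtain ⟨C₂, hC₂, hint⟩ := exists_lintegral_eR_le N
  set A : ℝ≥0∞ := ENNReal.ofReal (15 * 4 ^ N) with hA
  set B : ℝ≥0∞ := ENNReal.ofReal (3 * 16 ^ N) with hB
  set D : ℝ≥0∞ := ENNReal.ofReal (N * 2 ^ N) with hD
  refine ⟨D * (C₂ * A * B) + C₂ * A, by finiteness, ?_⟩
  intro e f hef w vt vtx nw nv hw hv hvx hnw hnv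
  have hef' : e + f ≤ N := by
    rcases Finset.mem_insert.1 hef with h | h
    · simp only [Prod.mk.injEq] at h; omega
    · exact (Finset.HasAntidiagonal.mem_antidiagonal.1 h).le
  have h1 := nTwo_eS_le hnw
  have h2 := nTwo_eR_le hnv
  have h3 : nTwo (fun p => ‖mono e f p‖ₑ * ‖fhat vt p‖ₑ) ≤ nv :=
    le_of_sq_le_sq ((nTwo_mono_sq_le e f vt).trans ((derivSq_le_timeSq hef vt).trans hnv))
  have h4 : ∫⁻ p, eR p ^ (N + 1) * ‖fhat w p‖ₑ ≤ C₂ * (A * nw) := (hint _).trans (by gcongr)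
  refine (transport_estimate (continuous_mono e f).measurable (enorm_mono_le e f)
    (by fun_prop) measurable_const (time_commutator_plane hef') hw hv (fhat_neg hw.integrable)
    ((hasDerivL2_iff _ _ _ _).1 hvx)).trans ?_
  simp only [zero_mul, lintegral_zero, mul_zero, add_zero]
  calc _ ≤ D * (nv * (C₂ * (A * nw)) * (B * nv)) + nv * (C₂ * (A * nw)) * nv := by gcongr
    _ = _ := by ring

/-- No derivative is lost here: $v_t$ and $w_t$ go in $L^2$, and $v$ in $L^1$ with $N+1$ powers,
which `spaceSq` controls. -/
theorem exists_time_coeff_estimate (N : ℕ) : ∃ C : ℝ≥0∞, C ≠ ∞ ∧ ∀ e f : ℕ,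
    (e, f) ∈ insert (0, 0) (Finset.HasAntidiagonal.antidiagonal N) →
    ∀ (wt v vt vx : L2) (nw nv : ℝ≥0∞), HasDerivL2 1 0 v vx → timeSq N wt ≤ nw ^ 2 →
      timeSq N vt ≤ nv ^ 2 → spaceSq N v ≤ nv ^ 2 →
      ‖∫ p, mono e f p ^ 2 *
        ((starRingEnd ℂ) (fhat vt p) * conv (fhat wt) (fhat vx) p).re‖ₑ ≤ C * (nw * nv ^ 2) := by
  obtain ⟨C₂, hC₂, hint⟩ := exists_lintegral_eR_le N
  set A : ℝ≥0∞ := ENNReal.ofReal (15 * 4 ^ N) with hA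
  set B : ℝ≥0∞ := ENNReal.ofReal (3 * 16 ^ N) with hB
  set D : ℝ≥0∞ := ENNReal.ofReal (2 ^ N) with hD
  refine ⟨D * (B * C₂ * A), by finiteness, ?_⟩
  intro e f hef wt v vt vx nw nv hvx hnw hnv hnv'
  have hef' : e + f ≤ N := by
    rcases Finset.mem_insert.1 hef with h | h
    · simp only [Prod.mk.injEq] at h; omega
    · exact (Finset.HasAntidiagonal.mem_antidiagonal.1 h).le
  have h1 := nTwo_eR_le hnw
  have h2 := nTwo_eS_le hnv'
  have h3 : nTwo (fun p => ‖mono e f p‖ₑ * ‖fhat vt p‖ₑ) ≤ nv :=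
    le_of_sq_le_sq ((nTwo_mono_sq_le e f vt).trans ((derivSq_le_timeSq hef vt).trans hnv))
  have h4 : ∫⁻ p, eR p ^ (N + 1) * ‖fhat v p‖ₑ ≤ C₂ * (A * nv) := (hint _).trans (by gcongr)
  have m1 := measurable_enorm_coe (fhat wt)
  have m2 := measurable_enorm_coe (fhat v)
  have m3 := measurable_enorm_coe (fhat vt)
  have m4 := (continuous_mono e f).measurable.enorm
  have hvx' := (hasDerivL2_iff _ _ _ _).1 hvx
  have e1 : ∀ p, conv (fhat wt) (fhat vx) p = conv (fhat wt) (fun q => symb 1 0 q * fhat v q) p :=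
    fun p => conv_congr hvx' p
  simp only [e1]
  refine (enorm_pairing_le _ _ _ _).trans ?_
  calc ∫⁻ p, ∫⁻ q, (‖mono e f p‖ₑ * ‖fhat vt p‖ₑ) *
        (‖mono e f p‖ₑ * ‖fhat wt (p - q)‖ₑ * ‖symb 1 0 q * fhat v q‖ₑ)
      ≤ ∫⁻ p, ∫⁻ q, D * ((‖mono e f p‖ₑ * ‖fhat vt p‖ₑ) * (eR (p - q) ^ N * ‖fhat wt (p - q)‖ₑ) *
          (eR q ^ (N + 1) * ‖fhat v q‖ₑ)) := by
        refine lintegral_mono fun p => lintegral_mono fun q => ?_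
        have hs : ‖symb 1 0 q‖ₑ = ‖cx q‖ₑ := by rw [enorm_symb]; simp [mono]
        rw [enorm_mul, hs]
        calc (‖mono e f p‖ₑ * ‖fhat vt p‖ₑ) *
            (‖mono e f p‖ₑ * ‖fhat wt (p - q)‖ₑ * (‖cx q‖ₑ * ‖fhat v q‖ₑ))
            = (‖mono e f p‖ₑ * ‖fhat vt p‖ₑ) *
              ((‖mono e f p‖ₑ * ‖cx q‖ₑ) * ‖fhat wt (p - q)‖ₑ * ‖fhat v q‖ₑ) := by ring
          _ ≤ (‖mono e f p‖ₑ * ‖fhat vt p‖ₑ) *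
              ((D * (eR (p - q) ^ N * eR q ^ (N + 1))) * ‖fhat wt (p - q)‖ₑ * ‖fhat v q‖ₑ) :=
              mul_le_mul' le_rfl (mul_le_mul'
                (mul_le_mul' (time_symbol_plane hef' p q) le_rfl) le_rfl)
          _ = _ := by ring
    _ = D * tri (fun p => ‖mono e f p‖ₑ * ‖fhat vt p‖ₑ) (fun p => eR p ^ N * ‖fhat wt p‖ₑ)
          (fun q => eR q ^ (N + 1) * ‖fhat v q‖ₑ) := by
        unfold tri
        rw [← lintegral_const_mul' _ _ ENNReal.ofReal_ne_top]
        refine lintegral_congr fun p => ?_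
        rw [← lintegral_const_mul' _ _ ENNReal.ofReal_ne_top]
    _ ≤ D * (nv * (B * nw) * (C₂ * (A * nv))) := by
        gcongr
        refine (tri_le_two_one (by fun_prop) (by fun_prop) (by fun_prop)).trans ?_
        gcongr
    _ = _ := by ring

/-! ### Uniform bounds in time -/

/-- The weighted norms are bounded on `[0, T]`. -/
def UnifRapid (T : ℝ) (U : ℝ → CL2) : Prop :=
  ∀ K : ℕ, ∃ C : ℝ≥0∞, C ≠ ∞ ∧ ∀ s ∈ Icc 0 T, nTwo (fun p => eR p ^ K * ‖U s p‖ₑ) ≤ C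

theorem UnifRapid.rapid {T : ℝ} {U : ℝ → CL2} (h : UnifRapid T U) {s : ℝ} (hs : s ∈ Icc 0 T) :
    Rapid (U s) := fun K => by
  obtain ⟨C, hC, hle⟩ := h K
  exact (hle s hs).trans_lt hC.lt_top

theorem UnifRapid.exists_nTwo_le {T : ℝ} {U : ℝ → CL2} (h : UnifRapid T U)
    {g : Plane → ℝ≥0∞} {K : ℕ} (hg : ∀ p, g p ≤ eR p ^ K) :
    ∃ C : ℝ≥0∞, C ≠ ∞ ∧ ∀ s ∈ Icc 0 T, nTwo (fun p => g p * ‖U s p‖ₑ) ≤ C := by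
  obtain ⟨C, hC, hle⟩ := h K
  exact ⟨C, hC, fun s hs => (nTwo_mono fun p => by gcongr; exact hg p).trans (hle s hs)⟩

theorem UnifRapid.exists_lintegral_le {T : ℝ} {U : ℝ → CL2} (h : UnifRapid T U) :
    ∃ C : ℝ≥0∞, C ≠ ∞ ∧ ∀ s ∈ Icc 0 T, ∫⁻ p, ‖U s p‖ₑ ≤ C := by
  obtain ⟨A, hA, hint⟩ := exists_lintegral_eR_le 0
  obtain ⟨C, hC, hle⟩ := h 3
  refine ⟨A * (3 * C), by finiteness, fun s hs => ?_⟩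
  calc ∫⁻ p, ‖U s p‖ₑ ≤ ∫⁻ p, eR p ^ (0 + 1) * ‖U s p‖ₑ := lintegral_mono fun p =>
        le_mul_of_one_le_left zero_le (one_le_pow_of_one_le' (one_le_eR p) _)
    _ ≤ A * nTwo (fun p => eS 0 p * ‖U s p‖ₑ) := hint _
    _ ≤ A * (3 * C) := by
        gcongr
        exact (nTwo_weight_le (eS_le 0)).trans (by gcongr; exact hle s hs)

theorem UnifRapid.of_ae_eq_mul {T : ℝ} {U W : ℝ → CL2} (h : UnifRapid T U) {g : Plane → ℂ} {m : ℕ}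
    (hg : ∀ p, ‖g p‖ₑ ≤ eR p ^ m)
    (hW : ∀ s ∈ Icc 0 T, W s =ᵐ[volume] fun p => g p * U s p) : UnifRapid T W := fun K => by
  obtain ⟨C, hC, hle⟩ := h (K + m)
  refine ⟨C, hC, fun s hs => le_trans ?_ (hle s hs)⟩
  unfold nTwo
  refine ENNReal.rpow_le_rpow (lintegral_mono_ae ?_) (by norm_num)
  filter_upwards [hW s hs] with p hp
  rw [hp, enorm_mul, pow_add, mul_assoc]
  gcongr
  exact hg p

theorem wR_pow_le {K a b : ℕ} (ha : K ≤ a) (hb : K ≤ b) (x y : ℝ) :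
    wR x y ^ K ≤ 3 ^ K * (1 + |x| ^ a + |y| ^ b) := by
  have hx := abs_nonneg x
  have hy := abs_nonneg y
  set m := max 1 (max |x| |y|) with hm
  have h1 : wR x y ≤ 3 * m := by
    have e1 : 1 ≤ m := le_max_left _ _
    have e2 : |x| ≤ m := (le_max_left _ _).trans (le_max_right _ _)
    have e3 : |y| ≤ m := (le_max_right _ _).trans (le_max_right _ _)
    unfold wR; linarith
  have hxa : 0 ≤ |x| ^ a := by positivity
  have hyb : 0 ≤ |y| ^ b := by positivity
  have h2 : m ^ K ≤ 1 + |x| ^ a + |y| ^ b := by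
    have hpow : ∀ {z : ℝ} {c : ℕ}, 0 ≤ z → K ≤ c → z ^ K ≤ 1 + z ^ c := fun {z c} hz hc => by
      rcases le_total z 1 with h | h
      · have := pow_le_one₀ (n := K) hz h
        have : 0 ≤ z ^ c := by positivity
        linarith
      · have := pow_le_pow_right₀ h hc
        linarith
    rcases max_choice 1 (max |x| |y|) with h | h <;> rw [hm, h]
    · rw [one_pow]; linarith
    · rcases max_choice |x| |y| with h | h <;> rw [h]
      · linarith [hpow hx ha]
      · linarith [hpow hy hb]
  calc wR x y ^ K ≤ (3 * m) ^ K := pow_le_pow_left₀ (zero_le_one.trans (one_le_wR x y)) h1 K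
    _ = 3 ^ K * m ^ K := mul_pow _ _ _
    _ ≤ _ := by gcongr

theorem nTwo_eR_pow_sq_le {K a b : ℕ} (ha : K ≤ a) (hb : K ≤ b) (f : L2) :
    nTwo (fun p => eR p ^ K * ‖fhat f p‖ₑ) ^ 2 ≤
      ENNReal.ofReal (3 * 9 ^ K) * (‖f‖ₑ ^ 2 + derivSq a 0 f + derivSq 0 b f) := by
  have mf := measurable_enorm_coe (fhat f)
  have ma := (continuous_mono a 0).measurable
  have mb := (continuous_mono 0 b).measurable
  calc nTwo (fun p => eR p ^ K * ‖fhat f p‖ₑ) ^ 2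
      ≤ ∫⁻ p, ENNReal.ofReal (3 * 9 ^ K) * (‖fhat f p‖ₑ ^ 2 +
          ‖mono a 0 p‖ₑ ^ 2 * ‖fhat f p‖ₑ ^ 2 + ‖mono 0 b p‖ₑ ^ 2 * ‖fhat f p‖ₑ ^ 2) := by
        rw [nTwo_sq]
        refine lintegral_mono fun p => ?_
        have h0 : 0 ≤ wR (cx p) (cy p) := zero_le_one.trans (one_le_wR _ _)
        have h1 : (eR p ^ K) ^ 2 ≤ ENNReal.ofReal (3 * 9 ^ K) *
            (1 + ‖mono a 0 p‖ₑ ^ 2 + ‖mono 0 b p‖ₑ ^ 2) := by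
          rw [eR, enorm_pow_two, enorm_pow_two, ← ENNReal.ofReal_one,
            ← ENNReal.ofReal_add (by norm_num) (by positivity),
            ← ENNReal.ofReal_add (by positivity) (by positivity),
            ← ENNReal.ofReal_mul (by positivity), ← ENNReal.ofReal_pow h0,
            ← ENNReal.ofReal_pow (by positivity)]
          refine ENNReal.ofReal_le_ofReal ?_
          have h2 := wR_pow_le ha hb (cx p) (cy p)
          have h3 : (mono a 0 p) ^ 2 = (|cx p| ^ a) ^ 2 := by
            rw [mono, pow_zero, mul_one, ← abs_pow, sq_abs]
          have h4 : (mono 0 b p) ^ 2 = (|cy p| ^ b) ^ 2 := by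
            rw [mono, pow_zero, one_mul, ← abs_pow, sq_abs]
          rw [h3, h4]
          set X := |cx p| ^ a
          set Y := |cy p| ^ b
          calc (wR (cx p) (cy p) ^ K) ^ 2 ≤ (3 ^ K * (1 + X + Y)) ^ 2 := by gcongr
            _ = 9 ^ K * (1 + X + Y) ^ 2 := by
                rw [mul_pow, ← pow_mul, mul_comm K 2, pow_mul]; norm_num
            _ ≤ 9 ^ K * (3 * (1 + X ^ 2 + Y ^ 2)) := by
                gcongr
                nlinarith [sq_nonneg (1 - X), sq_nonneg (1 - Y), sq_nonneg (X - Y)]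
            _ = _ := by ring
        calc (eR p ^ K * ‖fhat f p‖ₑ) ^ 2 = (eR p ^ K) ^ 2 * ‖fhat f p‖ₑ ^ 2 := mul_pow _ _ _
          _ ≤ (ENNReal.ofReal (3 * 9 ^ K) *
            (1 + ‖mono a 0 p‖ₑ ^ 2 + ‖mono 0 b p‖ₑ ^ 2)) * ‖fhat f p‖ₑ ^ 2 := by gcongr
          _ = _ := by ring
    _ ≤ _ := by
        rw [lintegral_const_mul _ (by fun_prop), lintegral_add_right _ (by fun_prop),
          lintegral_add_right _ (by fun_prop), ← enorm_sq_eq_lintegral, enorm_fhat]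
        gcongr
        · exact lintegral_mono_le_derivSq a 0 f
        · exact lintegral_mono_le_derivSq 0 b f

/-- Pure derivatives of order at least $K$ in each direction dominate $K$ isotropic powers. The
functional `Φ` allows the anisotropic and isotropic Sobolev bounds to be treated at once. -/
theorem unifRapid_of_bound {T : ℝ} {u : ℝ → L2} {Φ : ℕ → L2 → ℝ≥0∞}
    (hΦ : ∀ K f, ∃ a b, K ≤ a ∧ K ≤ b ∧ ‖f‖ₑ ^ 2 + derivSq a 0 f + derivSq 0 b f ≤ 3 * Φ K f)
    (h : ∀ K, (⨆ s ∈ Icc 0 T, Φ K (u s)) < ∞) : UnifRapid T fun s => fhat (u s) := fun K => by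
  refine ⟨(ENNReal.ofReal (3 * 9 ^ K) * (3 * ⨆ s ∈ Icc 0 T, Φ K (u s))) ^ (1 / 2 : ℝ),
    ENNReal.rpow_ne_top_of_nonneg (by norm_num)
      (ENNReal.mul_ne_top ENNReal.ofReal_ne_top (ENNReal.mul_ne_top (by norm_num) (h K).ne)),
    fun s hs => le_of_sq_le_sq ?_⟩
  rw [← ENNReal.rpow_natCast _ 2, ← ENNReal.rpow_natCast _ 2, ← ENNReal.rpow_mul _ (1 / 2),
    show (1 / 2 : ℝ) * ((2 : ℕ) : ℝ) = 1 by norm_num, ENNReal.rpow_one, ENNReal.rpow_natCast]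
  obtain ⟨a, b, ha, hb, hab⟩ := hΦ K (u s)
  refine (nTwo_eR_pow_sq_le ha hb (u s)).trans ?_
  gcongr
  refine hab.trans ?_
  gcongr
  exact le_iSup₂ (f := fun s (_ : s ∈ Icc 0 T) => Φ K (u s)) s hs

theorem unifRapid_of_memZ {T : ℝ} {u ut : ℝ → L2} (h : ∀ M, MemZ M T u ut) :
    UnifRapid T fun s => fhat (u s) := by
  refine unifRapid_of_bound (Φ := fun M => anisoSq (M + 3) (M + 2))
    (fun K f => ⟨K + 3, K + 2, by omega, by omega, ?_⟩) fun M => (h M).2.1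
  exact le_mul_of_one_le_left zero_le (by norm_num)

theorem derivSq_le_sobolevSq {N a b : ℕ} (h : a + b ≤ N) (f : L2) :
    derivSq a b f ≤ sobolevSq N f := by
  refine le_trans ?_ (Finset.single_le_sum (f := fun n =>
    ∑ j ∈ Finset.HasAntidiagonal.antidiagonal n, derivSq j.1 j.2 f) (fun _ _ => zero_le)
    (Finset.mem_range.2 (by omega) : a + b ∈ Finset.range (N + 1)))
  exact Finset.single_le_sum (f := fun j : ℕ × ℕ => derivSq j.1 j.2 f) (fun _ _ => zero_le)
    (Finset.HasAntidiagonal.mem_antidiagonal.2 rfl : (a, b) ∈ _)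

theorem enorm_sq_le_derivSq (f : L2) : ‖f‖ₑ ^ 2 ≤ derivSq 0 0 f := by
  rw [← enorm_fhat, enorm_sq_eq_lintegral]
  simpa [symb] using lintegral_symb_le_derivSq 0 0 f

theorem unifRapid_of_memZ_deriv {T : ℝ} {u ut : ℝ → L2} (h : ∀ M, MemZ M T u ut) :
    UnifRapid T fun s => fhat (ut s) := by
  refine unifRapid_of_bound (Φ := sobolevSq) (fun K f => ⟨K, K, le_rfl, le_rfl, ?_⟩)
    fun M => (h M).2.2
  calc _ ≤ sobolevSq K f + sobolevSq K f + sobolevSq K f := by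
        gcongr
        · exact (enorm_sq_le_derivSq f).trans (derivSq_le_sobolevSq (by omega) f)
        · exact derivSq_le_sobolevSq (by omega) f
        · exact derivSq_le_sobolevSq (by omega) f
    _ = _ := by ring

theorem UnifRapid.exists_derivSq_le {T : ℝ} {u : ℝ → L2} (h : UnifRapid T fun s => fhat (u s))
    (a b : ℕ) : ∃ C : ℝ≥0∞, C ≠ ∞ ∧ ∀ s ∈ Icc 0 T, derivSq a b (u s) ≤ C := by
  obtain ⟨C, hC, hle⟩ := h.exists_nTwo_le (enorm_mono_le a b)
  refine ⟨C ^ 2, by finiteness, fun s hs => ?_⟩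
  rw [(h.rapid hs).derivSq_eq]
  simp only [enorm_real_mul]
  rw [← nTwo_sq]
  gcongr
  exact hle s hs

theorem UnifRapid.exists_sum_derivSq_le {T : ℝ} {u : ℝ → L2}
    (h : UnifRapid T fun s => fhat (u s)) {ι : Type*} (S : Finset ι) (α β : ι → ℕ) :
    ∃ C : ℝ≥0∞, C ≠ ∞ ∧ ∀ s ∈ Icc 0 T, ∑ j ∈ S, derivSq (α j) (β j) (u s) ≤ C := by
  choose C hC hle using fun j => h.exists_derivSq_le (α j) (β j)
  exact ⟨∑ j ∈ S, C j, ENNReal.sum_ne_top.2 fun j _ => hC j,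
    fun s hs => Finset.sum_le_sum fun j _ => hle j s hs⟩

theorem zNorm_sq (N : ℕ) (T : ℝ) (u ut : ℝ → L2) : zNorm N T u ut ^ 2 = zSq N T u ut := by
  rw [zNorm, ← ENNReal.rpow_natCast, ← ENNReal.rpow_mul]
  norm_num

theorem spaceSq_add_timeSq_le_zNorm_sq (N : ℕ) {T : ℝ} (u ut : ℝ → L2) {s : ℝ}
    (hs : s ∈ Icc 0 T) : spaceSq N (u s) + timeSq N (ut s) ≤ zNorm N T u ut ^ 2 := by
  rw [zNorm_sq]
  exact le_iSup₂ (f := fun s (_ : s ∈ Icc 0 T) => spaceSq N (u s) + timeSq N (ut s)) s hs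

/-- Finiteness is essential: the energy argument uses the trilinear bound as a real number before
returning to extended values. -/
theorem zNorm_ne_top (N : ℕ) {T : ℝ} {u ut : ℝ → L2} (h : UnifRapid T fun s => fhat (u s))
    (ht : UnifRapid T fun s => fhat (ut s)) : zNorm N T u ut ≠ ∞ := by
  refine ENNReal.rpow_ne_top_of_nonneg (by norm_num) ?_
  obtain ⟨C₀, h₀, k₀⟩ := h.exists_derivSq_le 0 0
  obtain ⟨C₁, h₁, k₁⟩ := h.exists_sum_derivSq_le (Finset.HasAntidiagonal.antidiagonal N)
    (fun j => j.1 + 3) (fun j => j.2)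
  obtain ⟨C₂, h₂, k₂⟩ := h.exists_sum_derivSq_le (Finset.HasAntidiagonal.antidiagonal N)
    (fun j => j.1) (fun j => j.2 + 2)
  obtain ⟨C₃, h₃, k₃⟩ := ht.exists_sum_derivSq_le
    (insert (0, 0) (Finset.HasAntidiagonal.antidiagonal N)) (fun j => j.1) (fun j => j.2)
  refine ne_top_of_le_ne_top (by finiteness : C₀ + (C₁ + C₂) + C₃ ≠ ∞) (iSup₂_le fun s hs => ?_)
  unfold spaceSq timeSq
  rw [Finset.sum_add_distrib]
  gcongr
  · exact (enorm_sq_le_derivSq _).trans (k₀ s hs)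
  · exact k₁ s hs
  · exact k₂ s hs
  · exact k₃ s hs

/-! ### Convolutions that depend on time -/

/-- A positive square integrable weight. -/
noncomputable def decay (p : Plane) : ℝ := (1 + ‖p‖) ^ (-2 : ℝ)

theorem decay_pos (p : Plane) : 0 < decay p := by unfold decay; positivity

theorem continuous_decay : Continuous decay := by
  unfold decay
  refine Continuous.rpow_const (by fun_prop) fun p => Or.inl ?_
  positivity

theorem memLp_decay : MemLp (fun p => (decay p : ℂ)) 2 volume := by
  refine (memLp_two_iff_lintegral (f := fun p => (decay p : ℂ))
    (Complex.continuous_ofReal.comp continuous_decay).aestronglyMeasurable).2 ?_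
  have h : Integrable (fun p : Plane => (1 + ‖p‖) ^ (-4 : ℝ)) volume :=
    integrable_one_add_norm (by simp; norm_num)
  refine lt_of_le_of_lt (lintegral_mono fun p => le_of_eq ?_) h.2
  rw [← ofReal_norm, Complex.norm_real, ofReal_norm, ← enorm_pow, decay, ← Real.rpow_natCast,
    ← Real.rpow_mul (by positivity)]
  norm_num

theorem integrable_conv_kernel (a b : CL2) (p : Plane) :
    Integrable (fun q => a (p - q) * b q) volume := by
  have ha : MemLp (fun q => a (p - q)) 2 volume :=
    (Lp.memLp a).comp_measurePreserving (Measure.measurePreserving_sub_left volume p)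
  exact ha.integrable_mul (Lp.memLp b)

theorem stronglyMeasurable_conv (a b : CL2) : StronglyMeasurable (conv a b) := by
  have ha := (Lp.stronglyMeasurable a).measurable
  have hb := (Lp.stronglyMeasurable b).measurable
  have h : Measurable fun z : Plane × Plane => a (z.1 - z.2) * b z.2 :=
    (ha.comp (measurable_fst.sub measurable_snd)).mul (hb.comp measurable_snd)
  exact h.stronglyMeasurable.integral_prod_right

theorem norm_conv_le (a b : CL2) (p : Plane) : ‖conv a b p‖ ≤ ‖a‖ * ‖b‖ := by
  have h : ‖conv a b p‖ₑ ≤ ‖a‖ₑ * ‖b‖ₑ := by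
    refine (enorm_integral_le_lintegral_enorm _).trans ?_
    simp only [enorm_mul]
    rw [← nTwo_enorm_eq a, ← nTwo_enorm_eq b]
    exact lintegral_conv_le (measurable_enorm_coe a) (measurable_enorm_coe b) p
  rw [← ofReal_norm, ← ofReal_norm a, ← ofReal_norm b, ← ENNReal.ofReal_mul (norm_nonneg _),
    ENNReal.ofReal_le_ofReal_iff (by positivity)] at h
  exact h

/-- A convolution of two $L^2$ functions is bounded but need not lie in $L^2$. Multiplied by `decay`
it does, which makes convolution a continuous bilinear map on $L^2$. -/
theorem memLp_decay_conv (a b : CL2) : MemLp (fun p => (decay p : ℂ) * conv a b p) 2 volume := by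
  refine memLp_decay.of_le_mul (c := ‖a‖ * ‖b‖)
    (memLp_decay.1.mul (stronglyMeasurable_conv a b).aestronglyMeasurable)
    (Eventually.of_forall fun p => ?_)
  rw [norm_mul, mul_comm]
  gcongr
  exact norm_conv_le a b p

theorem conv_add_left (a a' b : CL2) (p : Plane) :
    conv (a + a' : CL2) b p = conv a b p + conv a' b p := by
  unfold conv
  rw [← integral_add (integrable_conv_kernel a b p) (integrable_conv_kernel a' b p)]
  refine integral_congr_ae ?_
  filter_upwards [(Measure.measurePreserving_sub_left volume p).quasiMeasurePreserving.ae
    (Lp.coeFn_add a a')] with q hq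
  rw [hq, Pi.add_apply, add_mul]

theorem conv_add_right (a b b' : CL2) (p : Plane) :
    conv a (b + b' : CL2) p = conv a b p + conv a b' p := by
  unfold conv
  rw [← integral_add (integrable_conv_kernel a b p) (integrable_conv_kernel a b' p)]
  refine integral_congr_ae ?_
  filter_upwards [Lp.coeFn_add b b'] with q hq
  rw [hq, Pi.add_apply, mul_add]

theorem conv_smul_left (c : ℝ) (a b : CL2) (p : Plane) :
    conv (c • a : CL2) b p = c • conv a b p := by
  unfold conv
  rw [← integral_smul]
  refine integral_congr_ae ?_
  filter_upwards [(Measure.measurePreserving_sub_left volume p).quasiMeasurePreserving.ae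
    (Lp.coeFn_smul c a)] with q hq
  rw [hq, Pi.smul_apply, smul_mul_assoc]

theorem conv_smul_right (c : ℝ) (a b : CL2) (p : Plane) :
    conv a (c • b : CL2) p = c • conv a b p := by
  unfold conv
  rw [← integral_smul]
  refine integral_congr_ae ?_
  filter_upwards [Lp.coeFn_smul c b] with q hq
  rw [hq, Pi.smul_apply, mul_smul_comm]

/-- The convolution of two square integrable functions, weighted by `decay`. -/
noncomputable def convL : CL2 →L[ℝ] CL2 →L[ℝ] CL2 :=
  LinearMap.mkContinuous₂
    (LinearMap.mk₂ ℝ (fun a b : CL2 => (memLp_decay_conv a b).toLp _)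
      (fun a a' b => by
        refine Lp.ext ?_
        filter_upwards [(memLp_decay_conv (a + a') b).coeFn_toLp, (memLp_decay_conv a b).coeFn_toLp,
          (memLp_decay_conv a' b).coeFn_toLp, Lp.coeFn_add ((memLp_decay_conv a b).toLp _)
            ((memLp_decay_conv a' b).toLp _)] with p h1 h2 h3 h4
        rw [h1, h4, Pi.add_apply, h2, h3, conv_add_left, mul_add])
      (fun c a b => by
        refine Lp.ext ?_
        filter_upwards [(memLp_decay_conv (c • a) b).coeFn_toLp, (memLp_decay_conv a b).coeFn_toLp,
          Lp.coeFn_smul c ((memLp_decay_conv a b).toLp _)] with p h1 h2 h3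
        rw [h1, h3, Pi.smul_apply, h2, conv_smul_left, mul_smul_comm])
      (fun a b b' => by
        refine Lp.ext ?_
        filter_upwards [(memLp_decay_conv a (b + b')).coeFn_toLp, (memLp_decay_conv a b).coeFn_toLp,
          (memLp_decay_conv a b').coeFn_toLp, Lp.coeFn_add ((memLp_decay_conv a b).toLp _)
            ((memLp_decay_conv a b').toLp _)] with p h1 h2 h3 h4
        rw [h1, h4, Pi.add_apply, h2, h3, conv_add_right, mul_add])
      (fun c a b => by
        refine Lp.ext ?_
        filter_upwards [(memLp_decay_conv a (c • b)).coeFn_toLp, (memLp_decay_conv a b).coeFn_toLp,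
          Lp.coeFn_smul c ((memLp_decay_conv a b).toLp _)] with p h1 h2 h3
        rw [h1, h3, Pi.smul_apply, h2, conv_smul_right, mul_smul_comm]))
    ‖memLp_decay.toLp _‖ fun a b => by
      rw [LinearMap.mk₂_apply, mul_assoc, mul_comm]
      refine Lp.norm_le_mul_norm_of_ae_le_mul ?_
      filter_upwards [(memLp_decay_conv a b).coeFn_toLp, memLp_decay.coeFn_toLp] with p h1 h2
      rw [h1, h2, norm_mul, mul_comm]
      gcongr
      exact norm_conv_le a b p

theorem coeFn_convL (a b : CL2) :
    convL a b =ᵐ[volume] fun p => (decay p : ℂ) * conv a b p :=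
  (memLp_decay_conv a b).coeFn_toLp

theorem norm_le_of_ae_eq_conv_add {F a b a' b' : CL2}
    (h : F =ᵐ[volume] fun p => conv a b p + conv a' b' p) {A : ℝ≥0∞} (hA : A ≠ ∞)
    (h1 : ‖a‖ₑ ≤ A) (h2 : ‖b‖ₑ ≤ A) (h3 : ‖a'‖ₑ ≤ A) (h4 : ‖b'‖ₑ ≤ A) (k1 : ∫⁻ p, ‖a p‖ₑ ≤ A)
    (k2 : ∫⁻ p, ‖b p‖ₑ ≤ A) (k3 : ∫⁻ p, ‖a' p‖ₑ ≤ A) (k4 : ∫⁻ p, ‖b' p‖ₑ ≤ A) :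
    ‖F‖ ≤ (2 * A ^ 2).toReal := by
  have hc : ∀ {a b : CL2}, ‖a‖ₑ ≤ A → ‖b‖ₑ ≤ A → ∫⁻ p, ‖a p‖ₑ ≤ A → ∫⁻ p, ‖b p‖ₑ ≤ A →
      ∫⁻ p, ‖conv a b p‖ₑ ^ 2 ≤ A ^ 4 := fun {a b} h1 h2 k1 k2 => by
    refine (lintegral_enorm_conv_sq_le a b).trans ?_
    rw [nTwo_enorm_eq, nTwo_enorm_eq]
    calc _ ≤ (A * A) * (A * A) := by gcongr
      _ = A ^ 4 := by ring
  have hF : ‖F‖ₑ ≤ 2 * A ^ 2 := by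
    refine le_of_sq_le_sq ?_
    rw [enorm_sq_eq_lintegral]
    calc ∫⁻ p, ‖F p‖ₑ ^ 2 ≤ ∫⁻ p, 2 * (‖conv a b p‖ₑ ^ 2 + ‖conv a' b' p‖ₑ ^ 2) := by
          refine lintegral_mono_ae ?_
          filter_upwards [h] with p hp
          rw [hp]
          calc _ ≤ (‖conv a b p‖ₑ + ‖conv a' b' p‖ₑ) ^ 2 := by
                gcongr; exact enorm_add_le _ _
            _ ≤ _ := by
                have := ENNReal.rpow_add_le_mul_rpow_add_rpow ‖conv a b p‖ₑ ‖conv a' b' p‖ₑ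
                  one_le_two
                norm_num at this
                exact this
      _ ≤ 2 * (A ^ 4 + A ^ 4) := by
          have m1 := (stronglyMeasurable_conv a b).measurable.enorm
          have m2 := (stronglyMeasurable_conv a' b').measurable.enorm
          rw [lintegral_const_mul _ (by fun_prop), lintegral_add_left (by fun_prop)]
          gcongr
          · exact hc h1 h2 k1 k2
          · exact hc h3 h4 k3 k4
      _ = _ := by ring
  rw [← ofReal_norm] at hF
  exact (ENNReal.ofReal_le_iff_le_toReal (by finiteness)).1 hF

theorem UnifRapid.exists_bound {T : ℝ} {U : ℝ → CL2} (h : UnifRapid T U) :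
    ∃ C : ℝ≥0∞, C ≠ ∞ ∧ ∀ s ∈ Icc 0 T, ‖U s‖ₑ ≤ C ∧ ∫⁻ p, ‖U s p‖ₑ ≤ C := by
  obtain ⟨A, hA, h1⟩ := h.exists_lintegral_le
  obtain ⟨B, hB, h2⟩ := h 0
  refine ⟨A + B, by finiteness, fun s hs => ⟨?_, (h1 s hs).trans le_self_add⟩⟩
  have := h2 s hs
  simp only [pow_zero, one_mul, nTwo_enorm_eq] at this
  exact this.trans le_add_self

theorem UnifRapid.exists_norm_le {T : ℝ} {U : ℝ → CL2} (h : UnifRapid T U) :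
    ∃ C : ℝ, ∀ s ∈ Icc 0 T, ‖U s‖ ≤ C := by
  obtain ⟨C, hC, hle⟩ := h.exists_bound
  refine ⟨C.toReal, fun s hs => ?_⟩
  have := (hle s hs).1
  rw [← ofReal_norm] at this
  exact (ENNReal.ofReal_le_iff_le_toReal hC).1 this

theorem exists_norm_conv_add_le {T : ℝ} {F a b a' b' : ℝ → CL2}
    (ha : UnifRapid T a) (hb : UnifRapid T b) (ha' : UnifRapid T a') (hb' : UnifRapid T b')
    (h : ∀ s ∈ Icc 0 T, F s =ᵐ[volume] fun p => conv (a s) (b s) p + conv (a' s) (b' s) p) :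
    ∃ C : ℝ, ∀ s ∈ Icc 0 T, ‖F s‖ ≤ C := by
  obtain ⟨A₁, hA₁, h₁⟩ := ha.exists_bound
  obtain ⟨A₂, hA₂, h₂⟩ := hb.exists_bound
  obtain ⟨A₃, hA₃, h₃⟩ := ha'.exists_bound
  obtain ⟨A₄, hA₄, h₄⟩ := hb'.exists_bound
  set A := A₁ + A₂ + A₃ + A₄ with hA
  have l₁ : A₁ ≤ A := by rw [hA, add_assoc, add_assoc]; exact le_self_add
  have l₂ : A₂ ≤ A := by
    rw [hA, add_assoc, add_assoc, add_left_comm]; exact le_self_add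
  have l₃ : A₃ ≤ A := le_add_self.trans le_self_add
  have l₄ : A₄ ≤ A := le_add_self
  exact ⟨_, fun s hs => norm_le_of_ae_eq_conv_add (h s hs) (A := A) (by finiteness)
    ((h₁ s hs).1.trans l₁) ((h₂ s hs).1.trans l₂) ((h₃ s hs).1.trans l₃) ((h₄ s hs).1.trans l₄)
    ((h₁ s hs).2.trans l₁) ((h₂ s hs).2.trans l₂) ((h₃ s hs).2.trans l₃) ((h₄ s hs).2.trans l₄)⟩

/-- The Leibniz rule in time for a convolution. -/
theorem IsPrimitive.conv {T : ℝ} (hT : 0 ≤ T) {a a' b b' F F' : ℝ → CL2}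
    (ha : IsPrimitive T a a') (hb : IsPrimitive T b b')
    (hF : ∀ s ∈ Icc 0 T, F s =ᵐ[volume] conv (a s) (b s))
    (hF' : ∀ s ∈ Icc 0 T, F' s =ᵐ[volume] fun p => conv (a' s) (b s) p + conv (a s) (b' s) p)
    {C : ℝ} (hC : ∀ s ∈ Icc 0 T, ‖F' s‖ ≤ C) : IsPrimitive T F F' := by
  -- The Leibniz rule holds for the damped convolution; the damping is then undone by the unbounded
  -- multiplier `1/decay`, which is legitimate since $F'$ stays bounded in $L^2$.
  refine (IsPrimitive.bilin convL hT ha hb).multiplier hT (g := fun p => ((decay p)⁻¹ : ℂ))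
    (Complex.measurable_ofReal.comp continuous_decay.measurable).inv (fun s hs => ?_)
    (fun s hs => ?_) hC
  · filter_upwards [hF s hs, coeFn_convL (a s) (b s)] with p h1 h2
    have : (decay p : ℂ) ≠ 0 := by exact_mod_cast (decay_pos p).ne'
    rw [h1, h2]
    field_simp
  · filter_upwards [hF' s hs, Lp.coeFn_add (convL (a' s) (b s)) (convL (a s) (b' s)),
      coeFn_convL (a' s) (b s), coeFn_convL (a s) (b' s)] with p h1 h2 h3 h4
    have : (decay p : ℂ) ≠ 0 := by exact_mod_cast (decay_pos p).ne'
    rw [h1, h2, Pi.add_apply, h3, h4]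
    field_simp

/-! ### The equation on the Fourier side -/

/-- The dispersion relation of the linear part of the equation. -/
noncomputable def disp (p : Plane) : ℝ := cx p ^ 3 - cx p + cy p ^ 2 / cx p

theorem measurable_disp : Measurable disp := by
  have := continuous_cx.measurable
  have := continuous_cy.measurable
  unfold disp
  fun_prop

theorem Rapid.exists_hasDerivL2 {f : L2} (h : Rapid (fhat f)) (a b : ℕ) :
    ∃ g : L2, HasDerivL2 a b f g := by
  have hm := (continuous_symb a b).aestronglyMeasurable (μ := (volume : Measure Plane))
  have h1 := h.integrable_mul hm (enorm_symb_le a b)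
  have h2 := h.memLp_mul hm (enorm_symb_le a b)
  obtain ⟨g, hg⟩ := exists_fhat_eq (G := h2.toLp _) (h1.congr h2.coeFn_toLp.symm) (by
    have hn := (Measure.measurePreserving_neg (volume : Measure Plane)).quasiMeasurePreserving.ae
      h2.coeFn_toLp
    filter_upwards [h2.coeFn_toLp, hn, fhat_neg h.integrable] with p k1 k2 k3
    rw [k2, k1, k3, symb_neg, map_mul])
  refine ⟨g, ?_⟩
  rw [hasDerivL2_iff, hg]
  exact h2.coeFn_toLp

/-- The linear terms are Fourier multipliers that assemble into $i\varphi$; the product becomes a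
convolution by `fhat_mul`. -/
theorem LinearizedKP.fhat_eq {v vt w vx : L2} (h : LinearizedKP v vt w)
    (hw : Integrable (fhat w) volume) (hvx : HasDerivL2 1 0 v vx)
    (hi : Integrable (fhat vx) volume) :
    fhat vt =ᵐ[volume] fun p =>
      Complex.I * disp p * fhat v p - conv (fhat w) (fhat vx) p := by
  obtain ⟨vx', vxxx, vyy, q, h1, h3, h2, hq, heq⟩ := h
  rw [hasDerivL2_iff] at h1 h2 h3 hvx
  have e : fhat vx' = fhat vx := Lp.ext (h1.trans hvx.symm)
  -- The product $wv_x$ is not assumed square integrable; the equation identifies it with this $L^2$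
  -- combination.
  set r : L2 := q - vt - vxxx - vx' with hr
  have hrw : r =ᵐ[volume] fun p => w p * vx' p := by
    filter_upwards [Lp.coeFn_sub (q - vt - vxxx) vx', Lp.coeFn_sub (q - vt) vxxx,
      Lp.coeFn_sub q vt, heq] with p k1 k2 k3 k4
    rw [hr, k1, Pi.sub_apply, k2, Pi.sub_apply, k3, Pi.sub_apply]
    linarith
  have hfr := fhat_mul hrw hw (by rwa [e])
  have hlin : fhat vt = fhat q - fhat vxxx - fhat vx' - fhat r := by
    simp only [← fhatL_apply, hr, map_sub]
    abel
  rw [hlin]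
  filter_upwards [hfr, Lp.coeFn_sub (fhat q - fhat vxxx - fhat vx') (fhat r),
    Lp.coeFn_sub (fhat q - fhat vxxx) (fhat vx'), Lp.coeFn_sub (fhat q) (fhat vxxx), hq, h1, h2, h3]
    with p k0 k1 k2 k3 k4 k5 k6 k7
  change fhat q p = fhat vyy p / _ at k4
  rw [k1, Pi.sub_apply, k2, Pi.sub_apply, k3, Pi.sub_apply, k0, k4, k5, k6, k7, e]
  congr 1
  -- At $X=0$ both sides use the convention that division by zero gives zero, so the algebra needs
  -- no exception.
  simp only [symb, disp, cx, cy, pow_zero, pow_one, one_mul, mul_one]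
  push_cast
  simp only [div_eq_mul_inv, mul_inv, Complex.inv_I, mul_pow, Complex.I_sq]
  rw [show Complex.I ^ 3 = -Complex.I by rw [pow_succ, Complex.I_sq]; ring]
  ring

theorem mulL_cut_eq {σ φ : Plane → ℝ} (hσ : Measurable σ) (hφ : Measurable φ) (n : ℕ)
    {U U' G : CL2} (h : U' =ᵐ[volume] fun p => Complex.I * φ p * U p - G p) :
    mulL (cutWeight σ φ n) U' = mulL (cutDispersion σ φ n) U - mulL (cutWeight σ φ n) G := by
  refine Lp.ext ?_
  filter_upwards [coeFn_mulL (memLp_cutWeight hσ hφ n) U', coeFn_mulL (memLp_cutWeight hσ hφ n) G,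
    coeFn_mulL (memLp_cutDispersion hσ hφ n) U, h,
    Lp.coeFn_sub (mulL (cutDispersion σ φ n) U) (mulL (cutWeight σ φ n) G)] with p h1 h2 h3 h4 h5
  rw [h5, Pi.sub_apply, h1, h2, h3, h4]
  by_cases hp : p ∈ cutoff σ φ n
  · simp only [cutWeight, cutDispersion, indicator_of_mem hp]
    ring
  · simp [cutWeight, cutDispersion, indicator_of_notMem hp]

theorem integrable_weight_re {σ : Plane → ℝ} (hσ : Measurable σ) {m : ℕ}
    (hm : ∀ p, ‖σ p‖ₑ ≤ eR p ^ m) {U : CL2} (hU : Rapid U) {G : Plane → ℂ}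
    (hG : MemLp G 2 volume) :
    Integrable (fun p => σ p ^ 2 * ((starRingEnd ℂ) (U p) * G p).re) volume := by
  have h1 : MemLp (fun p => ((σ p ^ 2 : ℝ) : ℂ) * U p) 2 volume :=
    hU.memLp_mul (K := m * 2)
      (Complex.measurable_ofReal.comp (hσ.pow_const 2)).aestronglyMeasurable fun p => by
        rw [← ofReal_norm, Complex.norm_real, ofReal_norm, enorm_pow, pow_mul]
        gcongr
        exact hm p
  refine (h1.star.integrable_mul hG).re.congr (Eventually.of_forall fun p => ?_)
  simp [pow_two]
  ring

theorem exists_pairing_bound {T C : ℝ} {U G : ℝ → CL2} (hU : UnifRapid T U)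
    (hG : ∀ s ∈ Icc 0 T, ‖G s‖ ≤ C) {σ : Plane → ℝ} (hσ : Measurable σ) {m : ℕ}
    (hm : ∀ p, ‖σ p‖ₑ ≤ eR p ^ m) : ∃ C' : ℝ, ∀ s ∈ Icc 0 T,
      ∫⁻ p, ‖σ p‖ₑ ^ 2 * ‖U s p‖ₑ * ‖G s p‖ₑ ≤ ENNReal.ofReal C' := by
  obtain ⟨A, hA, hle⟩ := hU.exists_nTwo_le (g := fun p => ‖σ p‖ₑ ^ 2) (K := m * 2)
    fun p => by rw [pow_mul]; gcongr; exact hm p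
  refine ⟨(A * ENNReal.ofReal C).toReal, fun s hs => ?_⟩
  rw [ENNReal.ofReal_toReal (by finiteness)]
  have mU := measurable_enorm_coe (U s)
  have mG := measurable_enorm_coe (G s)
  refine (lintegral_mul_le_nTwo (by fun_prop) (by fun_prop)).trans ?_
  gcongr
  · exact hle s hs
  · rw [nTwo_enorm_eq, ← ofReal_norm]
    exact ENNReal.ofReal_le_ofReal (hG s hs)

/-- Smooth solutions of the linearized equation, on the Fourier side. -/
structure FourierSolution (T : ℝ) (v vt w wt vx vtx : ℝ → L2) : Prop where
  nonneg : 0 ≤ T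
  prim_v : IsPrimitive T (fun s => fhat (v s)) fun s => fhat (vt s)
  prim_w : IsPrimitive T (fun s => fhat (w s)) fun s => fhat (wt s)
  rapid_v : UnifRapid T fun s => fhat (v s)
  rapid_vt : UnifRapid T fun s => fhat (vt s)
  rapid_w : UnifRapid T fun s => fhat (w s)
  rapid_wt : UnifRapid T fun s => fhat (wt s)
  hasDeriv_v : ∀ s ∈ Icc 0 T, HasDerivL2 1 0 (v s) (vx s)
  hasDeriv_vt : ∀ s ∈ Icc 0 T, HasDerivL2 1 0 (vt s) (vtx s)
  eqn : ∀ s ∈ Icc 0 T, fhat (vt s) =ᵐ[volume] fun p =>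
    Complex.I * disp p * fhat (v s) p - conv (fhat (w s)) (fhat (vx s)) p

theorem unifRapid_hasDerivL2 {T : ℝ} {u ux : ℝ → L2} (hu : UnifRapid T fun s => fhat (u s))
    {a b : ℕ} (h : ∀ s ∈ Icc 0 T, HasDerivL2 a b (u s) (ux s)) :
    UnifRapid T fun s => fhat (ux s) :=
  hu.of_ae_eq_mul (enorm_symb_le a b) fun s hs => (hasDerivL2_iff _ _ _ _).1 (h s hs)

theorem exists_fourierSolution {T : ℝ} (hT : 0 ≤ T) {v vt w wt : ℝ → L2}
    (hv : ∀ M, MemZ M T v vt) (hw : ∀ M, MemZ M T w wt)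
    (heq : ∀ s ∈ Icc 0 T, LinearizedKP (v s) (vt s) (w s)) :
    ∃ vx vtx : ℝ → L2, FourierSolution T v vt w wt vx vtx := by
  have rv := unifRapid_of_memZ hv
  have rvt := unifRapid_of_memZ_deriv hv
  have rw' := unifRapid_of_memZ hw
  have rwt := unifRapid_of_memZ_deriv hw
  choose! vx hvx using fun s (hs : s ∈ Icc 0 T) => (rv.rapid hs).exists_hasDerivL2 1 0
  choose! vtx hvtx using fun s (hs : s ∈ Icc 0 T) => (rvt.rapid hs).exists_hasDerivL2 1 0
  exact ⟨vx, vtx, hT, IsPrimitive.clm_comp (hv 0).1 fhatL, IsPrimitive.clm_comp (hw 0).1 fhatL,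
    rv, rvt, rw', rwt, hvx, hvtx, fun s hs => (heq s hs).fhat_eq (rw'.rapid hs).integrable
      (hvx s hs) ((unifRapid_hasDerivL2 rv hvx).rapid hs).integrable⟩

namespace FourierSolution

variable {T : ℝ} {v vt w wt vx vtx : ℝ → L2}

theorem rapid_vx (h : FourierSolution T v vt w wt vx vtx) : UnifRapid T fun s => fhat (vx s) :=
  unifRapid_hasDerivL2 h.rapid_v h.hasDeriv_v

theorem rapid_vtx (h : FourierSolution T v vt w wt vx vtx) : UnifRapid T fun s => fhat (vtx s) :=
  unifRapid_hasDerivL2 h.rapid_vt h.hasDeriv_vt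

theorem prim_vx (h : FourierSolution T v vt w wt vx vtx) :
    IsPrimitive T (fun s => fhat (vx s)) fun s => fhat (vtx s) := by
  obtain ⟨C, hC⟩ := h.rapid_vtx.exists_norm_le
  exact h.prim_v.multiplier h.nonneg (continuous_symb 1 0).measurable
    (fun s hs => (hasDerivL2_iff _ _ _ _).1 (h.hasDeriv_v s hs))
    (fun s hs => (hasDerivL2_iff _ _ _ _).1 (h.hasDeriv_vt s hs)) hC

/-- The Fourier transform of `w vₓ`, and that of its time derivative. -/
theorem exists_forcing (h : FourierSolution T v vt w wt vx vtx) : ∃ F F' : ℝ → CL2,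
    IsPrimitive T F F' ∧ (∃ C, ∀ s ∈ Icc 0 T, ‖F s‖ ≤ C) ∧ (∃ C, ∀ s ∈ Icc 0 T, ‖F' s‖ ≤ C) ∧
    (∀ s ∈ Icc 0 T, F s =ᵐ[volume] conv (fhat (w s)) (fhat (vx s))) ∧
    ∀ s ∈ Icc 0 T, F' s =ᵐ[volume] fun p =>
      conv (fhat (wt s)) (fhat (vx s)) p + conv (fhat (w s)) (fhat (vtx s)) p := by
  have key : ∀ {a b : ℝ → CL2}, UnifRapid T a → UnifRapid T b → ∀ s ∈ Icc 0 T,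
      MemLp (conv (a s) (b s)) 2 volume := fun ha hb s hs =>
    memLp_conv _ _ (ha.rapid hs).integrable (hb.rapid hs).integrable
  have h1 : ∀ s ∈ Icc 0 T, ∃ F : CL2, F =ᵐ[volume] conv (fhat (w s)) (fhat (vx s)) :=
    fun s hs => ⟨_, (key h.rapid_w h.rapid_vx s hs).coeFn_toLp⟩
  have h2 : ∀ s ∈ Icc 0 T, ∃ F' : CL2, F' =ᵐ[volume] fun p =>
      conv (fhat (wt s)) (fhat (vx s)) p + conv (fhat (w s)) (fhat (vtx s)) p :=
    fun s hs => ⟨_, ((key h.rapid_wt h.rapid_vx s hs).add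
      (key h.rapid_w h.rapid_vtx s hs)).coeFn_toLp⟩
  choose! F hF using h1
  choose! F' hF' using h2
  obtain ⟨C', hC'⟩ := exists_norm_conv_add_le h.rapid_wt h.rapid_vx h.rapid_w h.rapid_vtx hF'
  have hp := IsPrimitive.conv h.nonneg h.prim_w h.prim_vx hF hF' hC'
  obtain ⟨C, hC⟩ := isCompact_Icc.exists_bound_of_continuousOn hp.continuousOn
  exact ⟨F, F', hp, ⟨C, hC⟩, ⟨C', hC'⟩, hF, hF'⟩

theorem energy_le {U G : ℝ → CL2} (hT : 0 ≤ T) (hU : UnifRapid T U) {C : ℝ}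
    (hG : ∀ s ∈ Icc 0 T, ‖G s‖ ≤ C) {a b : ℕ}
    (hprim : ∀ n, IsPrimitive T (fun t => mulL (cutWeight (mono a b) disp n) (U t))
      fun t => mulL (cutDispersion (mono a b) disp n) (U t) -
        mulL (cutWeight (mono a b) disp n) (G t)) {B : ℝ≥0∞} (hB : B ≠ ∞)
    (hle : ∀ s ∈ Icc 0 T, ‖∫ p, mono a b p ^ 2 * ((starRingEnd ℂ) (U s p) * G s p).re‖ₑ ≤ B) :
    ∫⁻ p, ‖(mono a b p : ℂ) * U T p‖ₑ ^ 2 ≤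
      (∫⁻ p, ‖(mono a b p : ℂ) * U 0 p‖ₑ ^ 2) + ENNReal.ofReal (2 * T) * B := by
  have hσ := (continuous_mono a b).measurable
  obtain ⟨C', hC'⟩ := exists_pairing_bound hU hG hσ (enorm_mono_le a b)
  refine (energy_estimate hT hσ measurable_disp hprim hC' (B := B.toReal) fun s hs => ?_).trans ?_
  · have := hle s hs
    rw [← ofReal_norm] at this
    exact (ENNReal.ofReal_le_iff_le_toReal hB).1 this
  · rw [ENNReal.ofReal_mul (by positivity), ENNReal.ofReal_toReal hB]

theorem spatial_energy (h : FourierSolution T v vt w wt vx vtx) {a b : ℕ} {B : ℝ≥0∞} (hB : B ≠ ∞)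
    (hle : ∀ s ∈ Icc 0 T, ‖∫ p, mono a b p ^ 2 * ((starRingEnd ℂ) (fhat (v s) p) *
      conv (fhat (w s)) (fhat (vx s)) p).re‖ₑ ≤ B) :
    derivSq a b (v T) ≤ derivSq a b (v 0) + ENNReal.ofReal (2 * T) * B := by
  obtain ⟨F, F', -, ⟨C, hC⟩, -, hF, -⟩ := h.exists_forcing
  have hσ := (continuous_mono a b).measurable
  rw [(h.rapid_v.rapid ⟨h.nonneg, le_rfl⟩).derivSq_eq, (h.rapid_v.rapid ⟨le_rfl, h.nonneg⟩).derivSq_eq]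
  refine energy_le h.nonneg h.rapid_v hC (fun n => ?_) hB fun s hs => ?_
  · refine (h.prim_v.clm_comp (mulL (cutWeight (mono a b) disp n))).congr h.nonneg
      (fun s _ => rfl) fun s hs => mulL_cut_eq hσ measurable_disp n ?_
    filter_upwards [h.eqn s hs, hF s hs] with p h1 h2
    rw [h1, h2]
  · refine le_of_eq_of_le (congrArg _ (integral_congr_ae ?_)) (hle s hs)
    filter_upwards [hF s hs] with p hp
    rw [hp]

/-- The energy argument for $v_t$ satisfying the differentiated equation, whose forcing has the two
parts bounded by `B` and `B'`. -/
theorem time_energy (h : FourierSolution T v vt w wt vx vtx) {a b : ℕ} {B B' : ℝ≥0∞} (hB : B ≠ ∞)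
    (hB' : B' ≠ ∞)
    (hle : ∀ s ∈ Icc 0 T, ‖∫ p, mono a b p ^ 2 * ((starRingEnd ℂ) (fhat (vt s) p) *
      conv (fhat (wt s)) (fhat (vx s)) p).re‖ₑ ≤ B)
    (hle' : ∀ s ∈ Icc 0 T, ‖∫ p, mono a b p ^ 2 * ((starRingEnd ℂ) (fhat (vt s) p) *
      conv (fhat (w s)) (fhat (vtx s)) p).re‖ₑ ≤ B') :
    derivSq a b (vt T) ≤ derivSq a b (vt 0) + ENNReal.ofReal (2 * T) * (B + B') := by
  obtain ⟨F, F', hp, -, ⟨C, hC⟩, hF, hF'⟩ := h.exists_forcing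
  have hσ := (continuous_mono a b).measurable
  rw [(h.rapid_vt.rapid ⟨h.nonneg, le_rfl⟩).derivSq_eq,
    (h.rapid_vt.rapid ⟨le_rfl, h.nonneg⟩).derivSq_eq]
  refine energy_le h.nonneg h.rapid_vt hC (fun n => ?_) (ENNReal.add_ne_top.2 ⟨hB, hB'⟩)
    fun s hs => ?_
  -- No second time derivative is assumed: truncated, $v_t$ equals a bounded multiple of $v$ minus
  -- the truncated forcing, and both are primitives.
  · refine ((h.prim_v.clm_comp (mulL (cutDispersion (mono a b) disp n))).sub
      (hp.clm_comp (mulL (cutWeight (mono a b) disp n)))).congr h.nonneg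
      (fun s hs => (mulL_cut_eq hσ measurable_disp n ?_).symm) fun s _ => rfl
    filter_upwards [h.eqn s hs, hF s hs] with p h1 h2
    rw [h1, h2]
  · have hU := h.rapid_vt.rapid hs
    have i1 := integrable_weight_re hσ (enorm_mono_le a b) hU (memLp_conv _ _
      (h.rapid_wt.rapid hs).integrable (h.rapid_vx.rapid hs).integrable)
    have i2 := integrable_weight_re hσ (enorm_mono_le a b) hU (memLp_conv _ _
      (h.rapid_w.rapid hs).integrable (h.rapid_vtx.rapid hs).integrable)
    have e : ∫ p, mono a b p ^ 2 * ((starRingEnd ℂ) (fhat (vt s) p) * F' s p).re =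
        (∫ p, mono a b p ^ 2 * ((starRingEnd ℂ) (fhat (vt s) p) *
          conv (fhat (wt s)) (fhat (vx s)) p).re) +
        ∫ p, mono a b p ^ 2 * ((starRingEnd ℂ) (fhat (vt s) p) *
          conv (fhat (w s)) (fhat (vtx s)) p).re := by
      rw [← integral_add i1 i2]
      refine integral_congr_ae ?_
      filter_upwards [hF' s hs] with p hp
      rw [hp, mul_add, Complex.add_re, mul_add]
    rw [e]
    exact (enorm_add_le _ _).trans (add_le_add (hle s hs) (hle' s hs))

end FourierSolution

/-! ### Summation over derivatives and conclusion -/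

theorem Rapid.derivSq_zero_zero {f : L2} (h : Rapid (fhat f)) : derivSq 0 0 f = ‖f‖ₑ ^ 2 := by
  rw [h.derivSq_eq, ← enorm_fhat, enorm_sq_eq_lintegral]
  simp [mono]

theorem timeSq_le_sobolevSq (N : ℕ) (f : L2) : timeSq N f ≤ sobolevSq N f := by
  rcases Nat.eq_zero_or_pos N with rfl | hN
  · simp [timeSq, sobolevSq]
  · unfold timeSq sobolevSq
    rw [Finset.sum_insert (by simp; omega), Finset.sum_range_succ]
    gcongr
    exact derivSq_le_sobolevSq (N := N - 1) (by omega) f |>.trans_eq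
      (by rw [sobolevSq, Nat.sub_add_cancel hN])

theorem sum_le_sum_add_card {ι : Type*} (S : Finset ι) {f g : ι → ℝ≥0∞} {E : ℝ≥0∞}
    (h : ∀ j ∈ S, f j ≤ g j + E) : ∑ j ∈ S, f j ≤ ∑ j ∈ S, g j + S.card * E := by
  refine (Finset.sum_le_sum h).trans_eq ?_
  rw [Finset.sum_add_distrib, Finset.sum_const, nsmul_eq_mul]

/-- The factor $2N+3$ counts the terms: one for $f$ and two for each of the $N+1$ multi-indices. -/
theorem spaceSq_le_add {N : ℕ} {f g : L2} {E : ℝ≥0∞} (hf : Rapid (fhat f)) (hg : Rapid (fhat g))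
    (h : ∀ a b, SpatialExp N a b → derivSq a b f ≤ derivSq a b g + E) :
    spaceSq N f ≤ spaceSq N g + (2 * N + 3) * E := by
  have h0 := h 0 0 (Or.inl ⟨rfl, rfl⟩)
  rw [hf.derivSq_zero_zero, hg.derivSq_zero_zero] at h0
  have h1 := sum_le_sum_add_card (Finset.HasAntidiagonal.antidiagonal N)
    (f := fun j => derivSq (j.1 + 3) j.2 f + derivSq j.1 (j.2 + 2) f)
    (g := fun j => derivSq (j.1 + 3) j.2 g + derivSq j.1 (j.2 + 2) g) (E := 2 * E)
    fun j hj => by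
      rw [Finset.HasAntidiagonal.mem_antidiagonal] at hj
      calc _ ≤ (derivSq (j.1 + 3) j.2 g + E) + (derivSq j.1 (j.2 + 2) g + E) :=
            add_le_add (h _ _ (Or.inr (Or.inl ⟨j.1, j.2, hj, rfl, rfl⟩)))
              (h _ _ (Or.inr (Or.inr ⟨j.1, j.2, hj, rfl, rfl⟩)))
        _ = _ := by ring
  rw [Finset.Nat.card_antidiagonal] at h1
  unfold spaceSq
  refine (add_le_add h0 h1).trans_eq ?_
  push_cast
  ring

theorem timeSq_le_add {N : ℕ} {f g : L2} {E : ℝ≥0∞}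
    (h : ∀ a b, (a, b) ∈ insert (0, 0) (Finset.HasAntidiagonal.antidiagonal N) →
      derivSq a b f ≤ derivSq a b g + E) :
    timeSq N f ≤ timeSq N g + (N + 2) * E := by
  refine (sum_le_sum_add_card _ fun j hj => h j.1 j.2 hj).trans ?_
  unfold timeSq
  gcongr
  -- Only an upper bound on the number of terms holds for all $N$: when $N=0$ the inserted index is
  -- already present.
  have := Finset.card_insert_le ((0, 0) : ℕ × ℕ) (Finset.HasAntidiagonal.antidiagonal N)
  rw [Finset.Nat.card_antidiagonal] at this
  exact_mod_cast this

/-- The energy inequality for smooth solutions at a fixed time. -/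
theorem exists_energy_inequality (N : ℕ) : ∃ C : ℝ≥0∞, C ≠ ∞ ∧
    ∀ (T : ℝ) (v vt w wt vx vtx : ℝ → L2), FourierSolution T v vt w wt vx vtx →
      ∀ nw nv : ℝ≥0∞, nw ≠ ∞ → nv ≠ ∞ →
        (∀ s ∈ Icc 0 T, spaceSq N (w s) + timeSq N (wt s) ≤ nw ^ 2) →
        (∀ s ∈ Icc 0 T, spaceSq N (v s) + timeSq N (vt s) ≤ nv ^ 2) →
        spaceSq N (v T) + timeSq N (vt T) ≤ spaceSq N (v 0) + timeSq N (vt 0) +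
          C * ENNReal.ofReal T * (nw * nv ^ 2) := by
  obtain ⟨C₁, hC₁, e₁⟩ := exists_spatial_estimate N
  obtain ⟨C₂, hC₂, e₂⟩ := exists_time_coeff_estimate N
  obtain ⟨C₃, hC₃, e₃⟩ := exists_time_estimate N
  refine ⟨(2 * N + 3) * (2 * C₁) + (N + 2) * (2 * (C₂ + C₃)), by finiteness,
    fun T v vt w wt vx vtx h nw nv hnw hnv hw hv => ?_⟩
  have hX : nw * nv ^ 2 ≠ ∞ := by finiteness
  have hT0 : (0 : ℝ) ∈ Icc 0 T := ⟨le_rfl, h.nonneg⟩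
  have hTT : T ∈ Icc 0 T := ⟨h.nonneg, le_rfl⟩
  have s₁ := spaceSq_le_add (h.rapid_v.rapid hTT) (h.rapid_v.rapid hT0) fun a b hab =>
    h.spatial_energy (ENNReal.mul_ne_top hC₁ hX) fun s hs =>
      e₁ a b hab (w s) (v s) (vx s) nw nv (h.rapid_w.rapid hs) (h.rapid_v.rapid hs)
        (h.hasDeriv_v s hs) (le_self_add.trans (hw s hs)) (le_self_add.trans (hv s hs))
  have s₂ := timeSq_le_add fun a b hab =>
    h.time_energy (ENNReal.mul_ne_top hC₂ hX) (ENNReal.mul_ne_top hC₃ hX)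
      (fun s hs => e₂ a b hab (wt s) (v s) (vt s) (vx s) nw nv (h.hasDeriv_v s hs)
        (le_add_self.trans (hw s hs)) (le_add_self.trans (hv s hs))
        (le_self_add.trans (hv s hs)))
      fun s hs => e₃ a b hab (w s) (vt s) (vtx s) nw nv (h.rapid_w.rapid hs) (h.rapid_vt.rapid hs)
        (h.hasDeriv_vt s hs) (le_self_add.trans (hw s hs)) (le_add_self.trans (hv s hs))
  refine (add_le_add s₁ s₂).trans_eq ?_
  rw [ENNReal.ofReal_mul zero_le_two, show ENNReal.ofReal 2 = 2 by norm_num]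
  ring

end KP

theorem lemma3p2 (N : ℕ) :
    ∃ c : ℝ, 0 < c ∧
      ∀ v vt w wt : ℝ → KP.L2,
        (∀ (M : ℕ) (T : ℝ), 0 ≤ T → KP.MemZ M T v vt ∧ KP.MemZ M T w wt) →
        (∀ s : ℝ, 0 ≤ s → KP.LinearizedKP (v s) (vt s) (w s)) →
        ∀ t : ℝ, 0 ≤ t →
          KP.zNorm N t v vt ^ 2 ≤
            KP.spaceSq N (v 0) + KP.sobolevSq N (vt 0) +
              ENNReal.ofReal (c * t) * KP.zNorm N t w wt * KP.zNorm N t v vt ^ 2 := by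
  obtain ⟨C, hC, hmain⟩ := KP.exists_energy_inequality N
  -- Adding one makes the constant strictly positive.
  refine ⟨C.toReal + 1, by positivity, fun v vt w wt hZ heq t ht => ?_⟩
  have sol : ∀ T : ℝ, 0 ≤ T → ∃ vx vtx : ℝ → KP.L2, KP.FourierSolution T v vt w wt vx vtx :=
    fun T hT => KP.exists_fourierSolution hT (fun M => (hZ M T hT).1) (fun M => (hZ M T hT).2)
      fun s hs => heq s hs.1
  obtain ⟨_, _, ht'⟩ := sol t ht
  have hnv := KP.zNorm_ne_top N ht'.rapid_v ht'.rapid_vt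
  have hnw := KP.zNorm_ne_top N ht'.rapid_w ht'.rapid_wt
  rw [KP.zNorm_sq, KP.zSq]
  refine iSup₂_le fun s hs => ?_
  obtain ⟨vx, vtx, hsol⟩ := sol s hs.1
  -- The inequality is applied on $[0,s]$ for each $s\le t$, with both norms taken over all of
  -- $[0,t]$, so the right side is uniform in $s$ once $s$ is replaced by $t$.
  refine (hmain s v vt w wt vx vtx hsol _ _ hnw hnv
    (fun τ hτ => KP.spaceSq_add_timeSq_le_zNorm_sq N w wt ⟨hτ.1, hτ.2.trans hs.2⟩)
    (fun τ hτ => KP.spaceSq_add_timeSq_le_zNorm_sq N v vt ⟨hτ.1, hτ.2.trans hs.2⟩)).trans ?_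
  rw [← KP.zSq, ← KP.zNorm_sq, ← mul_assoc]
  gcongr
  · exact KP.timeSq_le_sobolevSq N _
  · rw [ENNReal.ofReal_mul (by positivity)]
    gcongr
    · exact (ENNReal.le_ofReal_iff_toReal_le hC (by positivity)).2 (by linarith)
    · exact hs.2
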